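/- For $n\ge 1$, let $G_n$ be the graph whose vertices are all vectors $v\in\mathbb{R}^n$ with coordinates in $\{-1,0,1\}$ and Euclidean norm $|v|=\sqrt3$, two vertices being adjacent if and only if their scalar product equals $1$. Let $c(n)=0$ if $n\equiv 0$, $c(n)=1$ if $n\equiv 1$, and $c(n)=2$ if $n\equiv 2$ or $3 \pmod 4$. Then, for every $n\ge 1$, the independence number of $G_n$ (the maximum size of a set of pairwise non-adjacent vertices) is $$\alpha(G_n)=\max\{6n-28,\; 4n-4c(n)\}.$$ -/

import Mathlib

/-- The vertex set `V_n`: vectors of `ℝⁿ` with coordinates in `{-1, 0, 1}` and Euclidean norm `√3`. -/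
def vertexSet (n : ℕ) : Set (EuclideanSpace ℝ (Fin n)) :=
  {v | (∀ i, v i = -1 ∨ v i = 0 ∨ v i = 1) ∧ ‖v‖ = Real.sqrt 3}

/-- The graph `G_n` on `V_n`: two vertices are adjacent iff their scalar product is `1`. -/
def distGraph (n : ℕ) : SimpleGraph (vertexSet n) where
  Adj v w := inner ℝ (v : EuclideanSpace ℝ (Fin n)) (w : EuclideanSpace ℝ (Fin n)) = 1
  symm := ⟨fun v w h => by rw [real_inner_comm]; exact h⟩
  loopless := ⟨fun v h => by
    rw [real_inner_self_eq_norm_sq, v.2.2, Real.sq_sqrt (by norm_num)] at h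
    norm_num at h⟩

/-- `V_n` is finite, so that the independence number of `G_n` is a maximum. -/
theorem vertexSet_finite (n : ℕ) : (vertexSet n).Finite := by
  have h : (Set.pi Set.univ (fun _ : Fin n => ({-1, 0, 1} : Set ℝ))).Finite :=
    Set.Finite.pi (fun _ => Set.toFinite _)
  refine (h.preimage (f := fun v : EuclideanSpace ℝ (Fin n) => (v : Fin n → ℝ)) ?_).subset ?_
  · intro v _ w _ hvw
    ext i
    exact congrFun hvw i
  · intro v hv i _
    simpa using hv.1 i

instance (n : ℕ) : Finite (vertexSet n) := (vertexSet_finite n).to_subtype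

/-- The constant `c(n)`: `0`, `1`, `2`, `2` according as `n ≡ 0`, `1`, `2`, `3 (mod 4)`. -/
def constC (n : ℕ) : ℤ :=
  if n % 4 = 0 then 0 else if n % 4 = 1 then 1 else 2

/-!
A vertex of the graph is a vector with support a set of three points and a sign at each of them.
That no two members of a family `F` have scalar product `1` means that two members which agree at a
point share a further point of their supports, and that two members with the same support which
agree at two points are equal (`SignedTriples`). The bounds compare `#F` with the number of signed
points `(p, s)`, of which there are `2 * n`.

**Big pairs and hubs.** A pair of points is big if it lies in at least four supports. If members
with the same sign at `p` have at least four supports, the supports without `p` form an intersecting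
family of at least four pairs, hence a star, and its centre forms a big pair with `p`
(`exists_big_of_four`). A point lies in at most two big pairs. A hub is a set of three points, each
used with both signs, such that no member contains exactly one of them. A triangle of big pairs is a
hub, and so is a support at each point of which the vectors with this support take both signs. Hence
a family without hubs is tame (`tame_of_no_hub`): no triangle of big pairs, at most two members on
each support, and these are not antipodal.

**Tame families.** Let `Ω` be a set of signed points containing those used by the tame family. Each
member distributes charge `5` among its points (`charge`, `le_sum_charge`), and a signed point
receives at most `10` on average. Without big pairs it receives at most `6`, which gives
`5 * #F ≤ 6 * #Ω`. The points of the big pairs receive much less than `10`, which gives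
`#F ≤ 2 * #Ω - 6`, and even `#F ≤ 2 * #Ω - 8` if `Ω` is closed under negation or contains no point
with both signs (`sum_slack_of_noDouble`, `Tame.card_add_le`). The charging fails when
two vectors over a big pair `a, b` agree at their third point, but then few members contain only one
of `a` and `b`, and all members meeting the pair can be removed.

**Hubs.** The members meeting a hub with `x` one-signed and `y` two-signed leaves number at most
`4 + 2 * x + 4 * y + max x (6 - x - 2 * y)` if there are at least two leaves (`Hub.card_le`), and
they use at least `6 + x + 2 * y` signed points, which are used neither by vectors avoiding the
hub nor at a disjoint hub. A hub whose only leaf is two-signed occupies four points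
entirely and carries at most sixteen vectors; it is removed by induction on `n`, as both terms
of the bound grow by at least
`16` when `n` grows by `4`. Otherwise a maximal family of disjoint hubs is taken. The vectors
avoiding them form a tame family on the signed points not used at the hubs, and the bounds add up to
the claim, with separate computations for no hub, one hub (`one_hub_arith`) and at least two hubs
(`card_le_of_two_hubs`).

**Lower bound.** On four coordinates there are sixteen pairwise non-adjacent vectors, and on three
coordinates four; disjoint copies give `4 * n - 4 * c(n)` (`realizes_blocks`). Two disjoint hubs,
the first with the entry `1` and the second with the entry `-1` at all `n - 6` remaining
coordinates, carry `2 * (4 + 3 * (n - 6)) = 6 * n - 28` vectors (`realizes_hubs`).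
-/

namespace TernaryTriples

open Finset Classical

section

/-! ### Signed triples -/

variable {ι : Type*}

/-- A family of vectors with entries in `{-1, 0, 1}` and exactly three nonzero entries, no two of
which have scalar product `1`. The last condition is recorded through its two combinatorial
consequences: two members which agree at a nonzero entry share a further point of their supports
(`share`), and two members with the same support which agree at two of its points are equal
(`same`). -/
structure SignedTriples (F : Finset (ι → ℤ)) : Prop where
  sign : ∀ v ∈ F, ∀ p, v p ≠ 0 → v p = 1 ∨ v p = -1
  three : ∀ v ∈ F, ∃ a b c, a ≠ b ∧ a ≠ c ∧ b ≠ c ∧ ∀ p, v p ≠ 0 ↔ p = a ∨ p = b ∨ p = c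
  share : ∀ v ∈ F, ∀ w ∈ F, ∀ p, v p ≠ 0 → v p = w p → ∃ q, q ≠ p ∧ v q ≠ 0 ∧ w q ≠ 0
  same : ∀ v ∈ F, ∀ w ∈ F, ∀ p q, p ≠ q → v p ≠ 0 → v q ≠ 0 → v p = w p → v q = w q →
    (∀ r, v r ≠ 0 ↔ w r ≠ 0) → v = w

namespace SignedTriples

variable {F G : Finset (ι → ℤ)}

theorem mono (hF : SignedTriples F) (h : G ⊆ F) : SignedTriples G where
  sign v hv := hF.sign v (h hv)
  three v hv := hF.three v (h hv)
  share v hv w hw := hF.share v (h hv) w (h hw)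
  same v hv w hw := hF.same v (h hv) w (h hw)

theorem supp (hF : SignedTriples F) {v : ι → ℤ} (hv : v ∈ F) {a b x : ι} (hab : a ≠ b)
    (hax : a ≠ x) (hbx : b ≠ x) (ha : v a ≠ 0) (hb : v b ≠ 0) (hx : v x ≠ 0) (q : ι) :
    v q ≠ 0 ↔ q = a ∨ q = b ∨ q = x := by
  obtain ⟨a', b', c', h1, h2, h3, h⟩ := hF.three v hv
  have h4 := (h a).1 ha
  have h5 := (h b).1 hb
  have h6 := (h x).1 hx
  rw [h q]
  grind

theorem supp_or (hF : SignedTriples F) {v : ι → ℤ} (hv : v ∈ F) {a b x : ι} (hab : a ≠ b)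
    (hax : a ≠ x) (hbx : b ≠ x) (ha : v a ≠ 0) (hb : v b ≠ 0) (hx : v x ≠ 0) {q : ι}
    (hq : v q ≠ 0) : q = a ∨ q = b ∨ q = x :=
  (hF.supp hv hab hax hbx ha hb hx q).1 hq

theorem zero_of_ne (hF : SignedTriples F) {v : ι → ℤ} (hv : v ∈ F) {a b x : ι} (hab : a ≠ b)
    (hax : a ≠ x) (hbx : b ≠ x) (ha : v a ≠ 0) (hb : v b ≠ 0) (hx : v x ≠ 0) {q : ι}
    (qa : q ≠ a) (qb : q ≠ b) (qx : q ≠ x) : v q = 0 := by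
  by_contra h
  rcases hF.supp_or hv hab hax hbx ha hb hx h with rfl | rfl | rfl <;> contradiction

theorem third (hF : SignedTriples F) {v : ι → ℤ} (hv : v ∈ F) (a b : ι) :
    ∃ x, x ≠ a ∧ x ≠ b ∧ v x ≠ 0 := by
  obtain ⟨a', b', c', h1, h2, h3, h⟩ := hF.three v hv
  have h4 := (h a').2 (by simp)
  have h5 := (h b').2 (by simp)
  have h6 := (h c').2 (by simp)
  by_cases h7 : a' ≠ a ∧ a' ≠ b
  · exact ⟨a', h7.1, h7.2, h4⟩
  by_cases h8 : b' ≠ a ∧ b' ≠ b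
  · exact ⟨b', h8.1, h8.2, h5⟩
  refine ⟨c', ?_, ?_, h6⟩ <;> grind

theorem two_others (hF : SignedTriples F) {v : ι → ℤ} (hv : v ∈ F) (p : ι) :
    ∃ q r, q ≠ p ∧ r ≠ p ∧ q ≠ r ∧ v q ≠ 0 ∧ v r ≠ 0 := by
  obtain ⟨q, hq, -, hq0⟩ := hF.third hv p p
  obtain ⟨r, hr, hr', hr0⟩ := hF.third hv p q
  exact ⟨q, r, hq, hr, hr'.symm, hq0, hr0⟩

theorem neg_of_ne (hF : SignedTriples F) {v w : ι → ℤ} (hv : v ∈ F) (hw : w ∈ F) {p : ι}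
    (h1 : v p ≠ 0) (h2 : w p ≠ 0) (h : v p ≠ w p) : w p = -v p := by
  rcases hF.sign v hv p h1 with h3 | h3 <;> rcases hF.sign w hw p h2 with h4 | h4 <;> omega

/-- Two members whose supports meet in the single point `a` have opposite entries there. -/
theorem opp (hF : SignedTriples F) {v w : ι → ℤ} (hv : v ∈ F) (hw : w ∈ F) {a b x : ι}
    (hab : a ≠ b) (hax : a ≠ x) (hbx : b ≠ x) (ha : v a ≠ 0) (hb : v b ≠ 0) (hx : v x ≠ 0)
    (wa : w a ≠ 0) (wb : w b = 0) (wx : w x = 0) : w a = -v a := by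
  refine hF.neg_of_ne hv hw ha wa fun h => ?_
  obtain ⟨q, hq, hvq, hwq⟩ := hF.share v hv w hw a ha h
  rcases hF.supp_or hv hab hax hbx ha hb hx hvq with rfl | rfl | rfl <;> contradiction

/-- Members which agree at a nonzero entry have a further common point. -/
theorem meet (hF : SignedTriples F) {v w : ι → ℤ} (hv : v ∈ F) (hw : w ∈ F) {a b x : ι}
    (hab : a ≠ b) (hax : a ≠ x) (hbx : b ≠ x) (ha : v a ≠ 0) (hb : v b ≠ 0) (hx : v x ≠ 0)
    (wa : w a = v a) : w b ≠ 0 ∨ w x ≠ 0 := by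
  by_contra! h
  have := hF.opp hv hw hab hax hbx ha hb hx (wa ▸ ha) h.1 h.2
  rcases hF.sign v hv a ha with h3 | h3 <;> omega

theorem eq_of_two (hF : SignedTriples F) {v w : ι → ℤ} (hv : v ∈ F) (hw : w ∈ F) {a b x : ι}
    (hab : a ≠ b) (hax : a ≠ x) (hbx : b ≠ x) (ha : v a ≠ 0) (hb : v b ≠ 0) (hx : v x ≠ 0)
    (wx : w x ≠ 0) (wa : v a = w a) (wb : v b = w b) : v = w :=
  hF.same v hv w hw a b hab ha hb wa wb fun r => by
    rw [hF.supp hv hab hax hbx ha hb hx, hF.supp hw hab hax hbx (wa ▸ ha) (wb ▸ hb) wx]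

end SignedTriples

/-! ### Big pairs -/

variable [Fintype ι]

/-- The points `x` such that some member of `F` has support `{a, b, x}`. -/
noncomputable def leaves (F : Finset (ι → ℤ)) (a b : ι) : Finset ι :=
  {x | x ≠ a ∧ x ≠ b ∧ ∃ v ∈ F, v a ≠ 0 ∧ v b ≠ 0 ∧ v x ≠ 0}

/-- A pair of points is big if it lies in at least four supports. -/
def Big (F : Finset (ι → ℤ)) (a b : ι) : Prop := a ≠ b ∧ 4 ≤ #(leaves F a b)

theorem mem_leaves {F : Finset (ι → ℤ)} {a b x : ι} :
    x ∈ leaves F a b ↔ x ≠ a ∧ x ≠ b ∧ ∃ v ∈ F, v a ≠ 0 ∧ v b ≠ 0 ∧ v x ≠ 0 := by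
  simp [leaves]

theorem leaves_comm (F : Finset (ι → ℤ)) (a b : ι) : leaves F a b = leaves F b a := by
  ext x
  simp only [mem_leaves]
  constructor <;> rintro ⟨h1, h2, v, hv, h3, h4, h5⟩ <;> exact ⟨h2, h1, v, hv, h4, h3, h5⟩

theorem leaves_mono {F G : Finset (ι → ℤ)} (h : G ⊆ F) (a b : ι) :
    leaves G a b ⊆ leaves F a b := by
  intro x
  simp only [mem_leaves]
  rintro ⟨h1, h2, v, hv, h3⟩
  exact ⟨h1, h2, v, h hv, h3⟩

theorem Big.symm {F : Finset (ι → ℤ)} {a b : ι} (h : Big F a b) : Big F b a :=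
  ⟨h.1.symm, leaves_comm F a b ▸ h.2⟩

theorem Big.mono {F G : Finset (ι → ℤ)} (hGF : G ⊆ F) {a b : ι} (h : Big G a b) : Big F a b :=
  ⟨h.1, h.2.trans (card_le_card (leaves_mono hGF a b))⟩

/-- A big pair has a leaf outside any prescribed three points. -/
theorem Big.exists_leaf {F : Finset (ι → ℤ)} {a b : ι} (h : Big F a b) (x y z : ι) :
    ∃ j, j ≠ x ∧ j ≠ y ∧ j ≠ z ∧ j ≠ a ∧ j ≠ b ∧ ∃ v ∈ F, v a ≠ 0 ∧ v b ≠ 0 ∧ v j ≠ 0 := by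
  have h1 : (leaves F a b \ {x, y, z}).Nonempty := by
    rw [← card_pos]
    have h2 := le_card_sdiff ({x, y, z} : Finset ι) (leaves F a b)
    have h3 : #({x, y, z} : Finset ι) ≤ 3 := card_le_three
    have h4 := h.2
    omega
  obtain ⟨j, hj⟩ := h1
  simp only [mem_sdiff, mem_insert, mem_singleton, mem_leaves] at hj
  refine ⟨j, ?_, ?_, ?_, hj.1.1, hj.1.2.1, hj.1.2.2⟩ <;> tauto

variable {F : Finset (ι → ℤ)}

/-- If `a` and `c` both form a big pair with `p`, then the members containing `p, a` but not `c`
all have the same entry at `p`, and those containing `p, c` but not `a` have the opposite one. -/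
theorem Big.opp (hF : SignedTriples F) {p a c : ι} (ha : Big F p a) (hc : Big F p c) (hac : a ≠ c)
    {v w : ι → ℤ} (hv : v ∈ F) (hw : w ∈ F) (vp : v p ≠ 0) (va : v a ≠ 0) (vc : v c = 0)
    (wp : w p ≠ 0) (wc : w c ≠ 0) (wa : w a = 0) : w p = - v p := by
  obtain ⟨x, hx1, hx2, hx⟩ := hF.third hv p a
  obtain ⟨y, hy1, hy2, hy⟩ := hF.third hw p c
  have hxc : x ≠ c := by rintro rfl; contradiction
  have hya : y ≠ a := by rintro rfl; contradiction
  by_cases hxy : x = y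
  · subst hxy
    -- choose `j` for the pair `p, a` and then `k` for the pair `p, c`, both avoiding the leaves
    obtain ⟨j, j1, j2, -, j3, j4, v', hv', v'p, v'a, v'j⟩ := ha.exists_leaf x c c
    obtain ⟨k, k1, k2, k3, k4, k5, w', hw', w'p, w'c, w'k⟩ := hc.exists_leaf x a j
    have s1 := hF.supp hv ha.1 hx1.symm hx2.symm vp va hx
    have s2 := hF.supp hw hc.1 hy1.symm hy2.symm wp wc hy
    have s3 := hF.supp hv' ha.1 j3.symm j4.symm v'p v'a v'j
    have s4 := hF.supp hw' hc.1 k4.symm k5.symm w'p w'c w'k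
    have e1 : w' p = - v p := hF.opp hv hw' ha.1 hx1.symm hx2.symm vp va hx w'p
      (by by_contra h; have := (s4 a).1 h; grind) (by by_contra h; have := (s4 x).1 h; grind)
    have e2 : w' p = - v' p := hF.opp hv' hw' ha.1 j3.symm j4.symm v'p v'a v'j w'p
      (by by_contra h; have := (s4 a).1 h; grind) (by by_contra h; have := (s4 j).1 h; grind)
    have e3 : w p = - v' p := hF.opp hv' hw ha.1 j3.symm j4.symm v'p v'a v'j wp
      wa (by by_contra h; have := (s2 j).1 h; grind)
    omega
  · have s2 := hF.supp hw hc.1 hy1.symm hy2.symm wp wc hy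
    exact hF.opp hv hw ha.1 hx1.symm hx2.symm vp va hx wp wa
      (by by_contra h; have := (s2 x).1 h; grind)

/-- If `a` and `c` both form a big pair with `p`, every member containing `p` contains `a` or
`c`. -/
theorem Big.cover (hF : SignedTriples F) {p a c : ι} (ha : Big F p a) (hc : Big F p c)
    (hac : a ≠ c) {u : ι → ℤ} (hu : u ∈ F) (up : u p ≠ 0) : u a ≠ 0 ∨ u c ≠ 0 := by
  by_contra! h
  obtain ⟨x, y, hx, hy, hxy, ux, uy⟩ := hF.two_others hu p
  obtain ⟨j, j1, j2, j0, j3, j4, v, hv, vp, va, vj⟩ := ha.exists_leaf x y c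
  obtain ⟨k, k1, k2, k0, k3, k4, w, hw, wp, wc, wk⟩ := hc.exists_leaf x y a
  have s1 := hF.supp hv ha.1 j3.symm j4.symm vp va vj
  have s2 := hF.supp hw hc.1 k3.symm k4.symm wp wc wk
  have s3 := hF.supp hu hx.symm hy.symm hxy up ux uy
  have e0 : w p = - v p := ha.opp hF hc hac hv hw vp va
      (by by_contra h; have := (s1 c).1 h; grind) wp wc (by by_contra h; have := (s2 a).1 h; grind)
  have e1 := hF.opp hv hu ha.1 j3.symm j4.symm vp va vj up h.1
    (by by_contra h; have := (s3 j).1 h; grind)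
  have e2 := hF.opp hw hu hc.1 k3.symm k4.symm wp wc wk up h.2
    (by by_contra h; have := (s3 k).1 h; grind)
  omega

/-- A point lies in at most two big pairs. -/
theorem Big.le_two (hF : SignedTriples F) {p a b c : ι} (ha : Big F p a) (hb : Big F p b)
    (hc : Big F p c) (hab : a ≠ b) (hac : a ≠ c) (hbc : b ≠ c) : False := by
  obtain ⟨j, j1, j2, -, j3, j4, v, hv, vp, va, vj⟩ := ha.exists_leaf b c c
  have s1 := hF.supp hv ha.1 j3.symm j4.symm vp va vj
  rcases hb.cover hF hc hbc hv vp with h | h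
  · have := (s1 b).1 h; have := hb.1; grind
  · have := (s1 c).1 h; have := hc.1; grind

end

section

/-! ### Charging vectors to signed points -/

variable {ι : Type*}

/-- In a pairwise intersecting family of at least four two-point sets, all sets share a point. -/
theorem exists_common_point {𝒜 : Finset (Finset ι)} (h2 : ∀ e ∈ 𝒜, #e = 2)
    (hI : ∀ e ∈ 𝒜, ∀ f ∈ 𝒜, ∃ x, x ∈ e ∧ x ∈ f) (h4 : 4 ≤ #𝒜) : ∃ c, ∀ e ∈ 𝒜, c ∈ e := by
  by_contra! hc
  obtain ⟨e₁, h₁⟩ : 𝒜.Nonempty := card_pos.1 (by omega)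
  obtain ⟨a, b, hab, rfl⟩ := card_eq_two.1 (h2 _ h₁)
  obtain ⟨e₂, h₂, ha⟩ := hc a
  obtain ⟨e₃, h₃, hb⟩ := hc b
  have hb₂ : b ∈ e₂ := by obtain ⟨x, hx, hx'⟩ := hI _ h₁ _ h₂; grind
  have ha₃ : a ∈ e₃ := by obtain ⟨x, hx, hx'⟩ := hI _ h₁ _ h₃; grind
  obtain ⟨c, hc₂, hc₃⟩ := hI _ h₂ _ h₃
  have hca : c ≠ a := by rintro rfl; exact ha hc₂
  have hcb : c ≠ b := by rintro rfl; exact hb hc₃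
  -- a fourth set meeting `{a, b}`, `{b, c}` and `{a, c}` is one of these
  have h : 𝒜 ⊆ {{a, b}, {b, c}, {a, c}} := by
    intro e he
    obtain ⟨x, y, hxy, rfl⟩ := card_eq_two.1 (h2 _ he)
    have e₂' : {b, c} = e₂ := eq_of_subset_of_card_le (by grind) (by
      rw [h2 _ h₂, card_pair hcb.symm])
    have e₃' : {a, c} = e₃ := eq_of_subset_of_card_le (by grind) (by
      rw [h2 _ h₃, card_pair hca.symm])
    subst e₂' e₃'
    obtain ⟨u, hu, hu'⟩ := hI _ h₁ _ he
    obtain ⟨v, hv, hv'⟩ := hI _ h₂ _ he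
    obtain ⟨w, hw, hw'⟩ := hI _ h₃ _ he
    simp only [mem_insert, mem_singleton] at *
    have : ((x = a ∧ y = b) ∨ (x = b ∧ y = a)) ∨ ((x = b ∧ y = c) ∨ (x = c ∧ y = b)) ∨
      ((x = a ∧ y = c) ∨ (x = c ∧ y = a)) := by grind
    rcases this with (⟨rfl, rfl⟩ | ⟨rfl, rfl⟩) | (⟨rfl, rfl⟩ | ⟨rfl, rfl⟩) |
      (⟨rfl, rfl⟩ | ⟨rfl, rfl⟩) <;> simp [pair_comm]
  have := (card_le_card h).trans card_le_three
  omega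

variable {F : Finset (ι → ℤ)}

/-- The set `Ω` of signed points contains every signed point `(p, v p)` used by a member `v` of
`F`. -/
structure Uses (F : Finset (ι → ℤ)) (Ω : Finset (ι × ℤ)) : Prop where
  mem : ∀ v ∈ F, ∀ p, v p ≠ 0 → (p, v p) ∈ Ω
  sign : ∀ h ∈ Ω, h.2 = 1 ∨ h.2 = -1

/-- The total charge received by the signed point `(p, s)`. -/
noncomputable def pay (c : (ι → ℤ) → ι → ℕ) (F : Finset (ι → ℤ)) (h : ι × ℤ) : ℕ :=
  ∑ v ∈ F with v h.1 = h.2, c v h.1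

/-- If each member of `F` distributes charge at least `k` among the points of its support, then
`k * #F` is at most the charge received by the signed points. -/
theorem mul_card_le_sum_pay {Ω : Finset (ι × ℤ)} (hΩ : Uses F Ω)
    (c : (ι → ℤ) → ι → ℕ) (k : ℕ)
    (hc : ∀ v ∈ F, ∃ x y z, x ≠ y ∧ x ≠ z ∧ y ≠ z ∧ v x ≠ 0 ∧ v y ≠ 0 ∧ v z ≠ 0 ∧
      k ≤ c v x + c v y + c v z) : k * #F ≤ ∑ h ∈ Ω, pay c F h := by
  have h1 : ∑ h ∈ Ω, pay c F h = ∑ v ∈ F, ∑ h ∈ Ω with v h.1 = h.2, c v h.1 := by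
    simp only [pay, sum_filter]
    exact sum_comm
  rw [h1, mul_comm, ← smul_eq_mul, ← sum_const]
  refine sum_le_sum fun v hv => ?_
  obtain ⟨x, y, z, hxy, hxz, hyz, hx, hy, hz, hk⟩ := hc v hv
  refine hk.trans ?_
  have h2 : ({(x, v x), (y, v y), (z, v z)} : Finset (ι × ℤ)) ⊆ {h ∈ Ω | v h.1 = h.2} := by
    intro h hh
    simp only [mem_insert, mem_singleton] at hh
    rcases hh with rfl | rfl | rfl <;> simp [hΩ.mem v hv, hx, hy, hz]
  refine le_trans ?_ (sum_le_sum_of_subset h2)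
  rw [sum_insert (by simp [hxy, hxz]), sum_insert (by simp [hyz]), sum_singleton]
  simp [add_assoc]

variable [Fintype ι]

/-- The support of a vector. -/
noncomputable def pts (v : ι → ℤ) : Finset ι := {p | v p ≠ 0}

@[simp] theorem mem_pts {v : ι → ℤ} {p : ι} : p ∈ pts v ↔ v p ≠ 0 := by simp [pts]

theorem SignedTriples.pts_eq (hF : SignedTriples F) {v : ι → ℤ} (hv : v ∈ F) {a b x : ι}
    (hab : a ≠ b) (hax : a ≠ x) (hbx : b ≠ x) (ha : v a ≠ 0) (hb : v b ≠ 0) (hx : v x ≠ 0) :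
    pts v = {a, b, x} := by
  ext q
  simp [hF.supp hv hab hax hbx ha hb hx]

theorem SignedTriples.card_pts (hF : SignedTriples F) {v : ι → ℤ} (hv : v ∈ F) :
    #(pts v) = 3 := by
  obtain ⟨a, b, c, h1, h2, h3, h⟩ := hF.three v hv
  rw [hF.pts_eq hv h1 h2 h3 (by simp [h]) (by simp [h]) (by simp [h])]
  exact card_eq_three.2 ⟨a, b, c, h1, h2, h3, rfl⟩

theorem ne_zero_of_pts {v w : ι → ℤ} (h : pts w = pts v) {p : ι} (hp : v p ≠ 0) : w p ≠ 0 := by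
  rw [← mem_pts] at *
  rwa [h]

/-- Members with the same support which agree at two of its points are equal. -/
theorem SignedTriples.eq_of_pts (hF : SignedTriples F) {v w : ι → ℤ} (hv : v ∈ F) (hw : w ∈ F)
    (h : pts v = pts w) {p q : ι} (hpq : p ≠ q) (hp : v p ≠ 0) (hq : v q ≠ 0)
    (hp' : v p = w p) (hq' : v q = w q) : v = w :=
  hF.same v hv w hw p q hpq hp hq hp' hq' fun r => by rw [← mem_pts, ← mem_pts, h]

/-- If the members of `S` agree at `p` and have at least four different supports, then they have
a second common point, which forms a big pair with `p`. -/
theorem exists_big_of_four (hF : SignedTriples F) {S : Finset (ι → ℤ)} (hS : S ⊆ F) {p : ι}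
    {s : ℤ} (hs : s ≠ 0) (hp : ∀ v ∈ S, v p = s) (h4 : 4 ≤ #(S.image pts)) :
    ∃ c, Big F p c ∧ ∀ v ∈ S, v c ≠ 0 := by
  have hps : ∀ v ∈ S, p ∈ pts v := fun v hv => by simp [hp v hv, hs]
  have hinj : Set.InjOn (fun e : Finset ι => e.erase p) (S.image pts) := by
    intro e he f hf hef
    simp only [coe_image, Set.mem_image, mem_coe] at he hf
    obtain ⟨v, hv, rfl⟩ := he
    obtain ⟨w, hw, rfl⟩ := hf
    have := congrArg (insert p) hef
    simpa only [insert_erase (hps v hv), insert_erase (hps w hw)] using this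
  obtain ⟨c, hc⟩ := exists_common_point (𝒜 := (S.image pts).image (fun e => e.erase p))
    (by
      simp only [mem_image, exists_exists_and_eq_and, forall_exists_index, and_imp]
      rintro _ v hv rfl
      rw [card_erase_of_mem (hps v hv), hF.card_pts (hS hv)])
    (by
      simp only [mem_image, exists_exists_and_eq_and, forall_exists_index, and_imp]
      rintro _ v hv rfl _ w hw rfl
      obtain ⟨q, hq, h1, h2⟩ := hF.share v (hS hv) w (hS hw) p (by rw [hp v hv]; exact hs)
        (by rw [hp v hv, hp w hw])
      exact ⟨q, by simp [hq, h1], by simp [hq, h2]⟩)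
    (by rwa [card_image_of_injOn hinj])
  have hcS : ∀ v ∈ S, c ≠ p ∧ v c ≠ 0 := fun v hv => by
    simpa using hc _ (mem_image_of_mem _ (mem_image_of_mem _ hv))
  have hne : S.Nonempty := by
    rw [nonempty_iff_ne_empty]
    rintro rfl
    simp at h4
  obtain ⟨v₀, hv₀⟩ := hne
  refine ⟨c, ⟨(hcS v₀ hv₀).1.symm, h4.trans ?_⟩, fun v hv => (hcS v hv).2⟩
  have : S.image pts ⊆ (leaves F p c).image (fun x => {p, c, x}) := by
    intro e he
    obtain ⟨v, hv, rfl⟩ := mem_image.1 he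
    obtain ⟨x, hx1, hx2, hx⟩ := hF.third (hS hv) p c
    have hvp : v p ≠ 0 := by simpa using hps v hv
    refine mem_image.2 ⟨x, mem_leaves.2 ⟨hx1, hx2, v, hS hv, hvp, (hcS v hv).2, hx⟩, ?_⟩
    exact (hF.pts_eq (hS hv) (hcS v hv).1.symm hx1.symm hx2.symm hvp (hcS v hv).2 hx).symm
  exact (card_le_card this).trans card_image_le

/-- A tame family: two members with the same support are not antipodal, each support carries at
most two members, and there is no triangle of big pairs. -/
structure Tame (F : Finset (ι → ℤ)) : Prop where
  agree : ∀ v ∈ F, ∀ w ∈ F, pts v = pts w → ∃ p, v p ≠ 0 ∧ v p = w p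
  two : ∀ u ∈ F, ∀ v ∈ F, ∀ w ∈ F, pts v = pts u → pts w = pts u → u = v ∨ u = w ∨ v = w
  triangle : ∀ a b c, Big F a b → Big F a c → Big F b c → False

theorem Tame.mono {G : Finset (ι → ℤ)} (hF : Tame F) (h : G ⊆ F) : Tame G where
  agree v hv w hw := hF.agree v (h hv) w (h hw)
  two u hu v hv w hw := hF.two u (h hu) v (h hv) w (h hw)
  triangle a b c h1 h2 h3 := hF.triangle a b c (h1.mono h) (h2.mono h) (h3.mono h)

/-! ### The charges of a tame family -/

/-- The vector has a point other than `p` forming a big pair with `p`. -/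
def Touch (F : Finset (ι → ℤ)) (v : ι → ℤ) (p : ι) : Prop := ∃ q, v q ≠ 0 ∧ Big F p q

/-- The vector has two points forming a big pair with `p`. -/
def Centre (F : Finset (ι → ℤ)) (v : ι → ℤ) (p : ι) : Prop :=
  ∃ q r, q ≠ r ∧ v q ≠ 0 ∧ v r ≠ 0 ∧ Big F p q ∧ Big F p r

/-- The support of the vector contains a big pair. -/
def HasBig (F : Finset (ι → ℤ)) (v : ι → ℤ) : Prop := ∃ q r, v q ≠ 0 ∧ v r ≠ 0 ∧ Big F q r

/-- Another member of `F` has the same support as `v` and the same entry at `p`. -/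
def Dup (F : Finset (ι → ℤ)) (v : ι → ℤ) (p : ι) : Prop :=
  ∃ w ∈ F, w ≠ v ∧ pts w = pts v ∧ w p = v p

/-- Two points are tied if some point forms a big pair with both of them. -/
def Tied (F : Finset (ι → ℤ)) (q r : ι) : Prop := q ≠ r ∧ ∃ m, Big F q m ∧ Big F r m

/-- The charge which the vector `v` puts on the point `p` of its support, in units of one fifth:
everything goes to the centre of two big pairs or else to the apex over a big pair, and vectors
without a big pair charge their points almost evenly. -/
noncomputable def charge (F : Finset (ι → ℤ)) (v : ι → ℤ) (p : ι) : ℕ :=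
  if Centre F v p then 5 else if Touch F v p then 0 else if HasBig F v then 5 else
  if ∃ q r, q ≠ p ∧ r ≠ p ∧ v q ≠ 0 ∧ v r ≠ 0 ∧ Tied F q r then 0 else
  if ∃ q, v q ≠ 0 ∧ Tied F p q then 3 else
  if Dup F v p then 1 else 2

theorem Tied.symm {q r : ι} (h : Tied F q r) : Tied F r q :=
  let ⟨m, h1, h2⟩ := h.2
  ⟨h.1.symm, m, h2, h1⟩

/-- In a vector without big pairs, a point is tied to at most one other point. -/
theorem Tied.unique (hF : SignedTriples F) {v : ι → ℤ} (hv : v ∈ F) (hb : ¬ HasBig F v)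
    {p q r : ι} (hp : v p ≠ 0) (h1 : Tied F p q) (h2 : Tied F p r) (hqr : q ≠ r) : False := by
  obtain ⟨hpq, m, m1, m2⟩ := h1
  obtain ⟨hpr, n, n1, n2⟩ := h2
  by_cases hmn : m = n
  · subst hmn
    exact Big.le_two hF m1.symm m2.symm n2.symm hpq hpr hqr
  · rcases m1.cover hF n1 hmn hv hp with h | h
    · exact hb ⟨p, m, hp, h, m1⟩
    · exact hb ⟨p, n, hp, h, n1⟩

/-- At most one of three points has a copy, and at most one pair of them is tied. -/
theorem five_le_of_exclusive {s t u A B C : Prop} (h1 : s → t → False) (h2 : s → u → False)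
    (h3 : t → u → False) (d1 : A → B → False) (d2 : A → C → False) (d3 : B → C → False) :
    5 ≤ (if u then 0 else if s ∨ t then 3 else if A then 1 else 2) +
      (if t then 0 else if s ∨ u then 3 else if B then 1 else 2) +
      (if s then 0 else if t ∨ u then 3 else if C then 1 else 2) := by
  by_cases s <;> by_cases t <;> by_cases u <;> by_cases A <;> by_cases B <;> by_cases C <;>
    simp_all

/-- Every member of a tame family distributes charge at least `5`. -/
theorem le_sum_charge (hF : SignedTriples F) (hT : Tame F) {v : ι → ℤ} (hv : v ∈ F) :
    ∃ x y z, x ≠ y ∧ x ≠ z ∧ y ≠ z ∧ v x ≠ 0 ∧ v y ≠ 0 ∧ v z ≠ 0 ∧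
      5 ≤ charge F v x + charge F v y + charge F v z := by
  have key : ∀ x, v x ≠ 0 → 5 ≤ charge F v x → ∃ x y z, x ≠ y ∧ x ≠ z ∧ y ≠ z ∧ v x ≠ 0 ∧
      v y ≠ 0 ∧ v z ≠ 0 ∧ 5 ≤ charge F v x + charge F v y + charge F v z := by
    intro x hx h
    obtain ⟨y, z, hy, hz, hyz, vy, vz⟩ := hF.two_others hv x
    exact ⟨x, y, z, hy.symm, hz.symm, hyz, hx, vy, vz, by omega⟩
  by_cases hC : ∃ p, v p ≠ 0 ∧ Centre F v p
  · obtain ⟨p, hp, h⟩ := hC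
    exact key p hp (by simp [charge, h])
  by_cases hb : HasBig F v
  · have hb' := hb
    obtain ⟨q, r, hq, hr, hqr⟩ := hb
    obtain ⟨p, hpq, hpr, hp⟩ := hF.third hv q r
    refine key p hp ?_
    have h1 : ¬ Centre F v p := fun h => hC ⟨p, hp, h⟩
    have h2 : ¬ Touch F v p := by
      rintro ⟨t, ht, hpt⟩
      rcases hF.supp_or hv hqr.1 hpq.symm hpr.symm hq hr hp ht with rfl | rfl | rfl
      · exact hC ⟨t, ht, p, r, hpr, hp, hr, hpt.symm, hqr⟩
      · exact hC ⟨t, ht, p, q, hpq, hp, hq, hpt.symm, hqr.symm⟩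
      · exact hpt.1 rfl
    simp [charge, h1, h2, hb']
  have h1 : ∀ p, v p ≠ 0 → ¬ Centre F v p := fun p hp h => hC ⟨p, hp, h⟩
  have h2 : ∀ p, v p ≠ 0 → ¬ Touch F v p := fun p hp ⟨q, hq, h⟩ => hb ⟨p, q, hp, hq, h⟩
  obtain ⟨x, y, z, hxy, hxz, hyz, h⟩ := hF.three v hv
  have hx := (h x).2 (by simp)
  have hy := (h y).2 (by simp)
  have hz := (h z).2 (by simp)
  refine ⟨x, y, z, hxy, hxz, hyz, hx, hy, hz, ?_⟩
  have hch : ∀ p q r, v p ≠ 0 → v q ≠ 0 → v r ≠ 0 → p ≠ q → p ≠ r → q ≠ r → charge F v p =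
      if Tied F q r then 0 else if Tied F p q ∨ Tied F p r then 3 else
      if Dup F v p then 1 else 2 := by
    intro p q r hp hq hr hpq hpr hqr
    have e1 : (∃ q r, q ≠ p ∧ r ≠ p ∧ v q ≠ 0 ∧ v r ≠ 0 ∧ Tied F q r) ↔ Tied F q r := by
      constructor
      · rintro ⟨q', r', h3, h4, h5, h6, h7⟩
        have h8 := h7.1
        rcases hF.supp_or hv hpq hpr hqr hp hq hr h5 with rfl | rfl | rfl <;>
        rcases hF.supp_or hv hpq hpr hqr hp hq hr h6 with rfl | rfl | rfl <;>
        first | contradiction | exact h7 | exact h7.symm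
      · intro h
        exact ⟨q, r, hpq.symm, hpr.symm, hq, hr, h⟩
    have e2 : (∃ q, v q ≠ 0 ∧ Tied F p q) ↔ Tied F p q ∨ Tied F p r := by
      constructor
      · rintro ⟨q', h5, h7⟩
        have h8 := h7.1
        rcases hF.supp_or hv hpq hpr hqr hp hq hr h5 with rfl | rfl | rfl <;> tauto
      · rintro (h | h)
        exacts [⟨q, hq, h⟩, ⟨r, hr, h⟩]
    rw [charge, if_neg (h1 p hp), if_neg (h2 p hp), if_neg hb]
    simp only [e1, e2]
  rw [hch x y z hx hy hz hxy hxz hyz, hch y x z hy hx hz hxy.symm hyz hxz,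
    hch z x y hz hx hy hxz.symm hyz.symm hxy]
  have s1 : Tied F y x ↔ Tied F x y := ⟨Tied.symm, Tied.symm⟩
  have s2 : Tied F z x ↔ Tied F x z := ⟨Tied.symm, Tied.symm⟩
  have s3 : Tied F z y ↔ Tied F y z := ⟨Tied.symm, Tied.symm⟩
  have u1 : Tied F x y → Tied F x z → False := fun h h' => h.unique hF hv hb hx h' hyz
  have u2 : Tied F x y → Tied F y z → False := fun h h' => h.symm.unique hF hv hb hy h' hxz
  have u3 : Tied F x z → Tied F y z → False :=
    fun h h' => h.symm.unique hF hv hb hz h'.symm hxy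
  rw [s1, s2, s3]
  -- a second vector on the same support agrees with `v` at one point only
  have d : ∀ p q, v p ≠ 0 → v q ≠ 0 → p ≠ q → Dup F v p → Dup F v q → False := by
    rintro p q hp hq hpq ⟨w, hw, hwv, hwp, e⟩ ⟨w', hw', hwv', hwp', e'⟩
    rcases hT.two v hv w hw w' hw' hwp hwp' with h | h | h
    · exact hwv h.symm
    · exact hwv' h.symm
    · subst h
      exact hwv (hF.eq_of_pts hv hw hwp.symm hpq hp hq e.symm e'.symm).symm
  exact five_le_of_exclusive u1 u2 u3 (d x y hx hy hxy) (d x z hx hz hxz) (d y z hy hz hyz)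

end

section

/-! ### The charge received by a signed point -/

variable {ι : Type*} [Fintype ι] {F : Finset (ι → ℤ)}

/-- No two members with support `{a, b, x}`, where `a, b` is the only big pair, agree at `x`. -/
def NoDouble (F : Finset (ι → ℤ)) : Prop :=
  ∀ a b x, Big F a b → ¬ Big F a x → ¬ Big F b x → ∀ v ∈ F, ∀ w ∈ F, v a ≠ 0 → v b ≠ 0 → v x ≠ 0 →
    x ≠ a → x ≠ b → pts w = pts v → w x = v x → w = v

/-- The members of `F` with entry `s` at `p` in which `p` belongs to no big pair. -/
noncomputable def free (F : Finset (ι → ℤ)) (p : ι) (s : ℤ) : Finset (ι → ℤ) :=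
  {v ∈ F | v p = s ∧ ¬ Touch F v p}

theorem mem_free {p : ι} {s : ℤ} {v : ι → ℤ} :
    v ∈ free F p s ↔ v ∈ F ∧ v p = s ∧ ¬ Touch F v p := by
  simp [free]

/-- The members of `free F p s` containing a big pair. -/
noncomputable def freeBig (F : Finset (ι → ℤ)) (p : ι) (s : ℤ) : Finset (ι → ℤ) :=
  {v ∈ free F p s | HasBig F v}

/-- The members of `free F p s` containing no big pair. -/
noncomputable def freeSmall (F : Finset (ι → ℤ)) (p : ι) (s : ℤ) : Finset (ι → ℤ) :=
  {v ∈ free F p s | ¬ HasBig F v}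

theorem mem_freeBig {p : ι} {s : ℤ} {v : ι → ℤ} :
    v ∈ freeBig F p s ↔ (v ∈ F ∧ v p = s ∧ ¬ Touch F v p) ∧ HasBig F v := by
  simp [freeBig, mem_free]

theorem mem_freeSmall {p : ι} {s : ℤ} {v : ι → ℤ} :
    v ∈ freeSmall F p s ↔ (v ∈ F ∧ v p = s ∧ ¬ Touch F v p) ∧ ¬ HasBig F v := by
  simp [freeSmall, mem_free]

/-- Four supports would force a second common point, forming a big pair with `p`. -/
theorem card_free_edges (hF : SignedTriples F) (p : ι) {s : ℤ} (hs : s ≠ 0) :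
    #((free F p s).image pts) ≤ 3 := by
  by_contra! h
  obtain ⟨c, hc, hc'⟩ := exists_big_of_four hF (S := free F p s) (filter_subset _ _) hs
    (fun v hv => (mem_free.1 hv).2.1) h
  obtain ⟨e, he⟩ : ((free F p s).image pts).Nonempty := card_pos.1 (by omega)
  obtain ⟨v, hv, rfl⟩ := mem_image.1 he
  exact (mem_free.1 hv).2.2 ⟨c, hc' v hv, hc⟩

/-- If `p` is in no big pair of `v`, a big pair of `v` consists of the other two points. -/
theorem ne_of_not_touch {v : ι → ℤ} {p q r : ι} (hp : ¬ Touch F v p) (hq : v q ≠ 0) (hr : v r ≠ 0)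
    (h : Big F q r) : p ≠ q ∧ p ≠ r := by
  constructor
  · rintro rfl; exact hp ⟨r, hr, h⟩
  · rintro rfl; exact hp ⟨q, hq, h.symm⟩

/-- By `NoDouble`, a member of `freeBig F p s` is the only free member with its support. -/
theorem freeBig_inj (hD : NoDouble F) {p : ι} {s : ℤ} (hs : s ≠ 0) {v w : ι → ℤ}
    (hv : v ∈ freeBig F p s) (hw : w ∈ free F p s) (h : pts w = pts v) : w = v := by
  obtain ⟨⟨hv, hvs, hvt⟩, q, r, hq, hr, hqr⟩ := mem_freeBig.1 hv
  obtain ⟨hw, hws, -⟩ := mem_free.1 hw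
  obtain ⟨h1, h2⟩ := ne_of_not_touch hvt hq hr hqr
  refine hD q r p hqr (fun h => hvt ⟨q, hq, h.symm⟩) (fun h => hvt ⟨r, hr, h.symm⟩) v hv w hw hq hr
    (hvs ▸ hs) h1 h2 h (by rw [hvs, hws])

/-- Two members of `freeBig F p s` have supports `{p, x, y}` and `{p, x, z}` with big pairs
`x, y` and `x, z`; every further member of `free F p s` has support `{p, y, z}`. -/
theorem freeBig_pair (hF : SignedTriples F) (hD : NoDouble F) {p : ι} {s : ℤ} (hs : s ≠ 0)
    {v w : ι → ℤ} (hv : v ∈ freeBig F p s) (hw : w ∈ freeBig F p s) (hvw : v ≠ w) :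
    ∃ x y z, p ≠ y ∧ p ≠ z ∧ Big F x y ∧ Big F x z ∧ y ≠ z ∧
      ∀ u ∈ free F p s, u ≠ v → u ≠ w → u y ≠ 0 ∧ u z ≠ 0 := by
  have hv' := hv
  have hw' := hw
  obtain ⟨⟨hv, hvs, hvt⟩, q, r, hq, hr, hqr⟩ := mem_freeBig.1 hv
  obtain ⟨⟨hw, hws, hwt⟩, k, l, hk, hl, hkl⟩ := mem_freeBig.1 hw
  obtain ⟨h1, h2⟩ := ne_of_not_touch hvt hq hr hqr
  obtain ⟨h3, h4⟩ := ne_of_not_touch hwt hk hl hkl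
  have hpv : pts v ≠ pts w := fun h => hvw (freeBig_inj hD hs hw' (mem_filter.1 hv').1 h)
  have hvp : v p ≠ 0 := hvs ▸ hs
  have hwp : w p ≠ 0 := hws ▸ hs
  have key : ∀ x y z, p ≠ x → p ≠ y → p ≠ z → v x ≠ 0 → v y ≠ 0 → w x ≠ 0 → w z ≠ 0 → Big F x y →
      Big F x z → ∃ x y z, p ≠ y ∧ p ≠ z ∧ Big F x y ∧ Big F x z ∧ y ≠ z ∧
      ∀ u ∈ free F p s, u ≠ v → u ≠ w → u y ≠ 0 ∧ u z ≠ 0 := by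
    intro x y z px py pz vx vy wx wz hxy hxz
    have hyz : y ≠ z := by
      rintro rfl
      exact hpv (by rw [hF.pts_eq hv px py hxy.1 hvp vx vy, hF.pts_eq hw px py hxy.1 hwp wx wz])
    refine ⟨x, y, z, py, pz, hxy, hxz, hyz, fun u hu huv huw => ?_⟩
    obtain ⟨hu', hus, hut⟩ := mem_free.1 hu
    have hup : u p ≠ 0 := hus ▸ hs
    have hux : u x = 0 := by
      by_contra hux
      rcases hxy.cover hF hxz hyz hu' hux with h | h
      · exact huv (freeBig_inj hD hs hv' hu (by
          rw [hF.pts_eq hv px py hxy.1 hvp vx vy, hF.pts_eq hu' px py hxy.1 hup hux h]))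
      · exact huw (freeBig_inj hD hs hw' hu (by
          rw [hF.pts_eq hw px pz hxz.1 hwp wx wz, hF.pts_eq hu' px pz hxz.1 hup hux h]))
    have e1 := hF.meet hv hu' px py hxy.1 hvp vx vy (by rw [hvs, hus])
    have e2 := hF.meet hw hu' px pz hxz.1 hwp wx wz (by rw [hws, hus])
    tauto
  rcases hF.meet hv hw h1 h2 hqr.1 hvp hq hr (by rw [hvs, hws]) with h | h
  · rcases hF.supp_or hw h3 h4 hkl.1 hwp hk hl h with rfl | rfl | rfl
    · exact absurd rfl h1
    · exact key q r l h1 h2 h4 hq hr h hl hqr hkl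
    · exact key q r k h1 h2 h3 hq hr h hk hqr hkl.symm
  · rcases hF.supp_or hw h3 h4 hkl.1 hwp hk hl h with rfl | rfl | rfl
    · exact absurd rfl h2
    · exact key r q l h2 h1 h4 hr hq h hl hqr.symm hkl
    · exact key r q k h2 h1 h3 hr hq h hk hqr.symm hkl.symm

/-- By `freeBig_pair`, a third member of `freeBig F p s` would complete a triangle of big pairs. -/
theorem card_freeBig_le_two (hF : SignedTriples F) (hT : Tame F) (hD : NoDouble F) (p : ι) {s : ℤ}
    (hs : s ≠ 0) : #(freeBig F p s) ≤ 2 := by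
  by_contra! h
  obtain ⟨u, v, w, hu, hv, hw, huv, huw, hvw⟩ := two_lt_card_iff.1 h
  obtain ⟨x, y, z, hpy, hpz, hxy, hxz, hyz, h1⟩ := freeBig_pair hF hD hs hv hw hvw
  obtain ⟨h2, h3⟩ := h1 u (mem_filter.1 hu).1 huv huw
  obtain ⟨⟨hu, hus, hut⟩, k, l, hk, hl, hkl⟩ := mem_freeBig.1 hu
  obtain ⟨h4, h5⟩ := ne_of_not_touch hut hk hl hkl
  have hup : u p ≠ 0 := hus ▸ hs
  refine hT.triangle x y z hxy hxz ?_
  have hk' := (hF.supp_or hu hpy hpz hyz hup h2 h3 hk).resolve_left h4.symm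
  have hl' := (hF.supp_or hu hpy hpz hyz hup h2 h3 hl).resolve_left h5.symm
  have := hkl.1
  rcases hk' with rfl | rfl <;> rcases hl' with rfl | rfl
  exacts [absurd rfl this, hkl, hkl.symm, absurd rfl this]

/-- A vector containing the tied points `p, q` and no big pair has its entries at `p` and `q`
prescribed. -/
theorem Tied.eq_entry (hF : SignedTriples F) {v w : ι → ℤ} (hv : v ∈ F) (hw : w ∈ F)
    (hvw : pts w = pts v) (hb : ¬ HasBig F v) {p q : ι} (hp : v p ≠ 0) (hq : v q ≠ 0)
    (h : Tied F p q) : w p = v p := by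
  obtain ⟨hpq, m, hpm, hqm⟩ := h
  have hvm : v m = 0 := by
    by_contra h
    exact hb ⟨p, m, hp, h, hpm⟩
  obtain ⟨r, hr, hr', vr⟩ := hF.third hv p q
  obtain ⟨j, hjq, hjr, -, hjp, hjm, z, hz, zp, zm, zj⟩ := hpm.exists_leaf q r q
  have hvj : v j = 0 := by
    by_contra h
    rcases hF.supp_or hv hpq hr.symm hr'.symm hp hq vr h with rfl | rfl | rfl <;> contradiction
  have hw0 : ∀ {x}, v x = 0 → w x = 0 := fun {x} hx => by
    by_contra h
    exact ne_zero_of_pts hvw.symm h hx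
  rw [hF.opp hz hv hpm.1 hjp.symm hjm.symm zp zm zj hp hvm hvj,
    hF.opp hz hw hpm.1 hjp.symm hjm.symm zp zm zj (ne_zero_of_pts hvw hp) (hw0 hvm) (hw0 hvj)]

theorem charge_of_mem_freeBig {p : ι} {s : ℤ} {v : ι → ℤ} (hv : v ∈ freeBig F p s) :
    charge F v p = 5 := by
  obtain ⟨⟨hv, hvs, hvt⟩, hb⟩ := mem_freeBig.1 hv
  have : ¬ Centre F v p := fun ⟨q, r, _, h1, _, h2, _⟩ => hvt ⟨q, h1, h2⟩
  simp [charge, hvt, this, hb]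

theorem charge_of_mem_freeSmall {p : ι} {s : ℤ} {v : ι → ℤ} (hv : v ∈ freeSmall F p s) :
    charge F v p =
      if ∃ q r, q ≠ p ∧ r ≠ p ∧ v q ≠ 0 ∧ v r ≠ 0 ∧ Tied F q r then 0 else
      if ∃ q, v q ≠ 0 ∧ Tied F p q then 3 else if Dup F v p then 1 else 2 := by
  obtain ⟨⟨hv, hvs, hvt⟩, hb⟩ := mem_freeSmall.1 hv
  have : ¬ Centre F v p := fun ⟨q, r, _, h1, _, h2, _⟩ => hvt ⟨q, h1, h2⟩
  rw [charge, if_neg this, if_neg hvt, if_neg hb]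

/-- The members of `freeSmall F p s` with a given support charge at most `m` to `p`, where `m` is
`2` or, if `p` is tied to another point, `3`. -/
theorem sum_charge_edge_le (hF : SignedTriples F) (hT : Tame F) {p : ι} {s : ℤ} (hs : s ≠ 0)
    {m : ℕ} (e : Finset ι) (hm : 2 ≤ m)
    (hm' : ∀ v ∈ freeSmall F p s, pts v = e → ∀ q, v q ≠ 0 → Tied F p q → 3 ≤ m) :
    ∑ v ∈ freeSmall F p s with pts v = e, charge F v p ≤ m := by
  set T := {v ∈ freeSmall F p s | pts v = e} with hTdef
  have hmem : ∀ v ∈ T, v ∈ freeSmall F p s ∧ pts v = e := fun v hv => mem_filter.1 hv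
  have h1 : ∀ v ∈ T, charge F v p ≤ m := by
    intro v hv
    rw [charge_of_mem_freeSmall (hmem v hv).1]
    split_ifs with h2 h3
    · omega
    · obtain ⟨q, hq, hpq⟩ := h3
      exact hm' v (hmem v hv).1 (hmem v hv).2 q hq hpq
    · omega
    · omega
  have hc : #T ≤ 2 := by
    by_contra! h
    obtain ⟨u, v, w, hu, hv, hw, huv, huw, hvw⟩ := two_lt_card_iff.1 h
    have hFm : ∀ v ∈ T, v ∈ F := fun v hv => (mem_freeSmall.1 (hmem v hv).1).1.1
    rcases hT.two u (hFm u hu) v (hFm v hv) w (hFm w hw) (by rw [(hmem u hu).2, (hmem v hv).2])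
      (by rw [(hmem u hu).2, (hmem w hw).2]) with h | h | h <;> contradiction
  by_cases hc1 : #T ≤ 1
  · calc _ ≤ #T • m := sum_le_card_nsmul _ _ _ h1
      _ ≤ 1 • m := by gcongr
      _ = m := one_smul _ _
  · -- two members with the same support and the same entry at `p` charge at most `1` each
    have h2 : ∀ v ∈ T, charge F v p ≤ 1 := by
      intro v hv
      obtain ⟨w, hw, hwv⟩ := exists_mem_ne (s := T) (by omega) v
      obtain ⟨⟨hvF, hvs, hvt⟩, hvb⟩ := mem_freeSmall.1 (hmem v hv).1
      obtain ⟨⟨hwF, hws, hwt⟩, hwb⟩ := mem_freeSmall.1 (hmem w hw).1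
      have hpts : pts w = pts v := by rw [(hmem v hv).2, (hmem w hw).2]
      have hdup : Dup F v p := ⟨w, hwF, hwv, hpts, by rw [hvs, hws]⟩
      have hvp : v p ≠ 0 := hvs ▸ hs
      rw [charge_of_mem_freeSmall (hmem v hv).1]
      split_ifs with h3 h4
      · omega
      · obtain ⟨q, hq, hpq⟩ := h4
        exact absurd (hF.eq_of_pts hvF hwF hpts.symm hpq.1 hvp hq (by rw [hvs, hws])
          (hpq.symm.eq_entry hF hvF hwF hpts hvb hq hvp).symm).symm hwv
      · omega
    calc _ ≤ #T • 1 := sum_le_card_nsmul _ _ _ h2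
      _ ≤ m := by simp; omega

/-- Only free members charge a point which is nowhere a centre. -/
theorem pay_eq_add {p : ι} (hC : ∀ v ∈ F, ¬ Centre F v p) {s : ℤ} :
    pay (charge F) F (p, s) = 5 * #(freeBig F p s) + ∑ v ∈ freeSmall F p s, charge F v p := by
  have e1 : pay (charge F) F (p, s) = ∑ v ∈ free F p s, charge F v p := by
    refine (sum_subset (fun v hv => ?_) fun v hv hv' => ?_).symm
    · exact mem_filter.2 ⟨(mem_free.1 hv).1, (mem_free.1 hv).2.1⟩
    · have hv := mem_filter.1 hv
      have ht : Touch F v p := by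
        by_contra h
        exact hv' (mem_free.2 ⟨hv.1, hv.2, h⟩)
      simp [charge, hC v hv.1, ht]
  rw [e1, ← sum_filter_add_sum_filter_not (free F p s) (HasBig F)]
  congr 1
  rw [← freeBig, sum_congr rfl fun v hv => charge_of_mem_freeBig hv]
  simp [mul_comm]

/-- The members of `freeBig F p s` have different supports, and these are not supports of members of
`freeSmall F p s`. -/
theorem card_freeBig_add_card (hD : NoDouble F) (p : ι) {s : ℤ} (hs : s ≠ 0) :
    #(freeBig F p s) + #((freeSmall F p s).image pts) ≤ #((free F p s).image pts) := by
  rw [← card_image_of_injOn (f := pts) (s := freeBig F p s) fun v hv w hw h =>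
    freeBig_inj hD hs hw (mem_filter.1 hv).1 h, ← card_union_of_disjoint]
  · exact card_le_card (union_subset (image_subset_image (filter_subset _ _))
      (image_subset_image (filter_subset _ _)))
  · rw [disjoint_left]
    intro e he he'
    obtain ⟨v, hv, rfl⟩ := mem_image.1 he
    obtain ⟨w, hw, hwv⟩ := mem_image.1 he'
    obtain ⟨q, r, hq, hr, hqr⟩ := (mem_freeBig.1 hv).2
    exact (mem_freeSmall.1 hw).2 ⟨q, r, ne_zero_of_pts hwv hq, ne_zero_of_pts hwv hr, hqr⟩

theorem sum_freeSmall_le (hF : SignedTriples F) (hT : Tame F) {p : ι} {s : ℤ} (hs : s ≠ 0)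
    {m : ℕ} (hm : 2 ≤ m) (hm' : ∀ v ∈ freeSmall F p s, ∀ q, v q ≠ 0 → Tied F p q → 3 ≤ m) :
    ∑ v ∈ freeSmall F p s, charge F v p ≤ m * #((freeSmall F p s).image pts) := by
  rw [← sum_fiberwise_of_maps_to (g := pts) (t := (freeSmall F p s).image pts)
    (fun v hv => mem_image_of_mem _ hv), mul_comm, ← smul_eq_mul]
  refine sum_le_card_nsmul _ _ _ fun e _ => sum_charge_edge_le hF hT hs e hm fun v hv _ => hm' v hv

/-- The bound `2` per support, plus `1` for each support in which `p` is tied to another point. -/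
theorem sum_freeSmall_le_add (hF : SignedTriples F) (hT : Tame F) {p : ι} {s : ℤ} (hs : s ≠ 0) :
    ∑ v ∈ freeSmall F p s, charge F v p ≤ 2 * #((freeSmall F p s).image pts) +
      #{e ∈ (freeSmall F p s).image pts | ∃ q ∈ e, Tied F p q} := by
  rw [← sum_fiberwise_of_maps_to (g := pts) (t := (freeSmall F p s).image pts)
    (fun v hv => mem_image_of_mem _ hv), card_filter, mul_comm, ← smul_eq_mul, ← sum_const,
    ← sum_add_distrib]
  refine sum_le_sum fun e _ => sum_charge_edge_le hF hT hs e (by omega) fun v hv he q hq hpq => ?_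
  rw [if_pos ⟨q, by rw [← he, mem_pts]; exact hq, hpq⟩]

/-- The charge received by a signed point `(p, s)` which is nowhere the centre of two big pairs, in
terms of the number of members of `freeBig F p s`. -/
theorem pay_le (hF : SignedTriples F) (hT : Tame F) (hD : NoDouble F) {p : ι} {s : ℤ} (hs : s ≠ 0)
    (hC : ∀ v ∈ F, ¬ Centre F v p)
    {m : ℕ} (hm : 2 ≤ m) (hm' : ∀ v ∈ freeSmall F p s, ∀ q, v q ≠ 0 → Tied F p q → 3 ≤ m) :
    pay (charge F) F (p, s) + m * #(freeBig F p s) ≤ 5 * #(freeBig F p s) + 3 * m ∧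
      (#(freeBig F p s) = 2 → pay (charge F) F (p, s) ≤ 10) := by
  have h1 := pay_eq_add hC (s := s)
  have h2 := sum_freeSmall_le hF hT hs hm hm'
  have h3 := (card_freeBig_add_card hD p hs).trans (card_free_edges hF p hs)
  refine ⟨by rw [h1]; nlinarith, fun h4 => ?_⟩
  obtain ⟨v, w, hvw, h5⟩ := card_eq_two.1 h4
  have hv : v ∈ freeBig F p s := h5 ▸ mem_insert_self _ _
  have hw : w ∈ freeBig F p s := h5 ▸ mem_insert_of_mem (mem_singleton_self _)
  obtain ⟨x, y, z, hpy, hpz, hxy, hxz, hyz, h6⟩ := freeBig_pair hF hD hs hv hw hvw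
  suffices h : ∑ v ∈ freeSmall F p s, charge F v p = 0 by rw [h1, h4, h]
  refine sum_eq_zero fun u hu => ?_
  have hub := (mem_freeSmall.1 hu).2
  obtain ⟨h7, h8⟩ := h6 u (mem_filter.1 hu).1
    (by rintro rfl; exact hub (mem_freeBig.1 hv).2)
    (by rintro rfl; exact hub (mem_freeBig.1 hw).2)
  rw [charge_of_mem_freeSmall hu, if_pos]
  exact ⟨y, z, hpy.symm, hpz.symm, h7, h8, hyz, x, hxy.symm, hxz.symm⟩

theorem pay_le_five_mul (hF : SignedTriples F) (hT : Tame F) (hD : NoDouble F) {p : ι} {s : ℤ}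
    (hs : s ≠ 0) (hC : ∀ v ∈ F, ¬ Centre F v p) :
    pay (charge F) F (p, s) ≤ 5 * #((free F p s).image pts) := by
  have h1 := pay_eq_add hC (s := s)
  have h2 := sum_freeSmall_le hF hT (p := p) hs (m := 3) (by omega) (fun _ _ _ _ _ => le_rfl)
  have h3 := card_freeBig_add_card hD p hs
  omega

end

section

/-! ### The slack of a point -/

variable {ι : Type*} {F : Finset (ι → ℤ)} {Ω : Finset (ι × ℤ)}

theorem sign_ne_zero (hΩ : Uses F Ω) {h : ι × ℤ} (hh : h ∈ Ω) : h.2 ≠ 0 := by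
  rcases hΩ.sign h hh with h | h <;> simp [h]

theorem both_of_full (hΩ : Uses F Ω) (h : ∀ h ∈ Ω, (h.1, -h.2) ∈ Ω) {p : ι} {s : ℤ}
    (hp : (p, s) ∈ Ω) : (p, 1) ∈ Ω ∧ (p, -1) ∈ Ω := by
  have h1 := h _ hp
  rcases hΩ.sign _ hp with h2 | h2 <;> simp only at h2 <;> subst h2 <;> simp_all

variable [Fintype ι]

/-- The amount by which the charge received by the signed points of `Ω` at `p` falls short of `10`
for each of them. -/
noncomputable def slack (F : Finset (ι → ℤ)) (Ω : Finset (ι × ℤ)) (p : ι) : ℤ :=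
  ∑ h ∈ Ω with h.1 = p, (10 - (pay (charge F) F h : ℤ))

theorem sum_slack (F : Finset (ι → ℤ)) (Ω : Finset (ι × ℤ)) :
    ∑ p, slack F Ω p = 10 * #Ω - ∑ h ∈ Ω, (pay (charge F) F h : ℤ) := by
  have h := sum_fiberwise Ω Prod.fst fun h => 10 - (pay (charge F) F h : ℤ)
  rw [sum_sub_distrib, sum_const, nsmul_eq_mul, mul_comm] at h
  simp only [slack]
  convert h

/-- The slack bounds the size of the family. -/
theorem five_mul_card_add_slack_le (hF : SignedTriples F) (hT : Tame F) (hΩ : Uses F Ω) :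
    5 * (#F : ℤ) + ∑ p, slack F Ω p ≤ 10 * #Ω := by
  have h : 5 * #F ≤ ∑ h ∈ Ω, pay (charge F) F h :=
    mul_card_le_sum_pay hΩ (charge F) 5 fun v hv => le_sum_charge hF hT hv
  have h' : 5 * (#F : ℤ) ≤ ∑ h ∈ Ω, (pay (charge F) F h : ℤ) := by exact_mod_cast h
  rw [sum_slack]
  omega

theorem slack_of_both (hΩ : Uses F Ω) {p : ι} (h1 : (p, 1) ∈ Ω) (h2 : (p, -1) ∈ Ω) :
    slack F Ω p =
      20 - (pay (charge F) F (p, 1) + pay (charge F) F (p, -1) : ℤ) := by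
  have : {h ∈ Ω | h.1 = p} = {(p, 1), (p, -1)} := by
    ext ⟨q, s⟩
    simp only [mem_filter, mem_insert, mem_singleton, Prod.mk.injEq]
    constructor
    · rintro ⟨h3, rfl⟩
      have := hΩ.sign _ h3
      simp_all
    · rintro (⟨rfl, rfl⟩ | ⟨rfl, rfl⟩)
      exacts [⟨h1, rfl⟩, ⟨h2, rfl⟩]
  rw [slack, this, sum_pair (by simp)]
  ring

theorem slack_of_one (hΩ : Uses F Ω) {p : ι} {s : ℤ} (h1 : (p, s) ∈ Ω) (h2 : (p, -s) ∉ Ω) :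
    slack F Ω p = 10 - (pay (charge F) F (p, s) : ℤ) := by
  have : {h ∈ Ω | h.1 = p} = {(p, s)} := by
    ext ⟨q, t⟩
    simp only [mem_filter, mem_singleton, Prod.mk.injEq]
    constructor
    · rintro ⟨h3, rfl⟩
      refine ⟨rfl, ?_⟩
      rcases hΩ.sign _ h1 with h4 | h4 <;> rcases hΩ.sign _ h3 with h5 | h5 <;>
        simp only at h4 h5 <;> subst h4 h5 <;> simp_all
    · rintro ⟨rfl, rfl⟩
      exact ⟨h1, rfl⟩
  rw [slack, this, sum_singleton]

/-- If each signed point at `p` receives at most `10 - k`, the slack is at least `k` times their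
number. -/
theorem mul_le_slack {p : ι} {k : ℕ}
    (h : ∀ s, (p, s) ∈ Ω → pay (charge F) F (p, s) + k ≤ 10) :
    (k * #{h ∈ Ω | h.1 = p} : ℤ) ≤ slack F Ω p := by
  rw [slack, mul_comm, ← nsmul_eq_mul]
  refine card_nsmul_le_sum _ _ _ fun x hx => ?_
  obtain ⟨q, s⟩ := x
  obtain ⟨hΩ, hq⟩ := mem_filter.1 hx
  obtain rfl : q = p := hq
  have := h s hΩ
  omega

/-- The points lying in big pairs. -/
noncomputable def bigPts (F : Finset (ι → ℤ)) : Finset ι := {p | ∃ q, Big F p q}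

theorem mem_bigPts {p : ι} : p ∈ bigPts F ↔ ∃ q, Big F p q := by simp [bigPts]

theorem not_centre_of_notMem {p : ι} (hp : p ∉ bigPts F) : ∀ v ∈ F, ¬ Centre F v p :=
  fun _ _ ⟨q, _, _, _, _, h, _⟩ => hp (mem_bigPts.2 ⟨q, h⟩)

/-- The charge of a signed point outside all big pairs. -/
theorem pay_le_of_notMem (hF : SignedTriples F) (hT : Tame F) (hD : NoDouble F) {p : ι} {s : ℤ}
    (hs : s ≠ 0) (hp : p ∉ bigPts F) :
    pay (charge F) F (p, s) ≤ 10 ∧ pay (charge F) F (p, s) ≤ 6 + 3 * #(freeBig F p s) ∧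
      #(freeBig F p s) ≤ 2 := by
  have h1 := pay_le hF hT hD hs (not_centre_of_notMem hp) (le_refl 2)
    fun v _ q _ ⟨_, m, hm, _⟩ => absurd (mem_bigPts.2 ⟨m, hm⟩) hp
  have h2 := card_freeBig_le_two hF hT hD p hs
  omega

theorem slack_nonneg_of_notMem (hF : SignedTriples F) (hT : Tame F) (hD : NoDouble F)
    (hΩ : Uses F Ω) {p : ι} (hp : p ∉ bigPts F) : 0 ≤ slack F Ω p := by
  have := mul_le_slack (F := F) (Ω := Ω) (p := p) (k := 0) fun s hs =>
    (pay_le_of_notMem hF hT hD (sign_ne_zero hΩ hs) hp).1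
  simpa using this

/-- A signed point used by a vector containing `a, b`. -/
theorem Big.exists_mem (hΩ : Uses F Ω) {p a : ι} (h : Big F p a) : ∃ s, (p, s) ∈ Ω := by
  obtain ⟨j, -, -, -, -, -, v, hv, hp, -, -⟩ := h.exists_leaf p p p
  exact ⟨_, hΩ.mem v hv p hp⟩

/-! ### Points in two big pairs -/

/-- A point in two big pairs is used with both signs. -/
theorem Big.both (hF : SignedTriples F) (hΩ : Uses F Ω) {p a c : ι} (ha : Big F p a)
    (hc : Big F p c) (hac : a ≠ c) : (p, 1) ∈ Ω ∧ (p, -1) ∈ Ω := by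
  obtain ⟨j, j1, j2, j0, j3, j4, v, hv, vp, va, vj⟩ := ha.exists_leaf c c c
  obtain ⟨k, k1, k2, k0, k3, k4, w, hw, wp, wc, wk⟩ := hc.exists_leaf a a a
  have e := ha.opp hF hc hac hv hw vp va
    (hF.zero_of_ne hv ha.1 j3.symm j4.symm vp va vj hc.1.symm hac.symm j1.symm) wp wc
    (hF.zero_of_ne hw hc.1 k3.symm k4.symm wp wc wk ha.1.symm hac k1.symm)
  have h1 := hΩ.mem v hv p vp
  have h2 := hΩ.mem w hw p wp
  rcases hF.sign v hv p vp with h | h <;> rw [e, h] at h2 <;> rw [h] at h1 <;> simp_all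

theorem pay_add_pay (hF : SignedTriples F) (c : (ι → ℤ) → ι → ℕ) (p : ι) :
    pay c F (p, 1) + pay c F (p, -1) = ∑ v ∈ F with v p ≠ 0, c v p := by
  rw [pay, pay, ← sum_union]
  · refine sum_congr ?_ fun _ _ => rfl
    ext v
    simp only [mem_union, mem_filter, ← and_or_left]
    refine and_congr_right fun hv => ⟨by rintro (h | h) <;> simp [h], hF.sign v hv p⟩
  · rw [disjoint_left]
    intro v hv hv'
    have h1 := (mem_filter.1 hv).2
    have h2 := (mem_filter.1 hv').2
    simp only at h1 h2
    omega

/-- A point `p` in big pairs `p, a` and `p, c` is charged only by the at most two vectors with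
support `{p, a, c}`, at `5` each. -/
theorem slack_of_two_big (hF : SignedTriples F) (hT : Tame F) (hΩ : Uses F Ω) {p a c : ι}
    (ha : Big F p a) (hc : Big F p c) (hac : a ≠ c) : 10 ≤ slack F Ω p := by
  obtain ⟨h1, h2⟩ := ha.both hF hΩ hc hac
  rw [slack_of_both hΩ h1 h2]
  have h3 := pay_add_pay hF (charge F) p
  -- only the members with support `{p, a, c}` charge anything to `p`
  have h4 : ∑ v ∈ F with v p ≠ 0, charge F v p ≤
      #{v ∈ F | pts v = {p, a, c}} • 5 := by
    rw [← sum_const]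
    rw [← sum_filter_add_sum_filter_not {v ∈ F | v p ≠ 0} (fun v => pts v = {p, a, c})]
    rw [sum_eq_zero (s := {v ∈ {v ∈ F | v p ≠ 0} | ¬ pts v = {p, a, c}}), add_zero]
    · refine (sum_le_sum (g := fun _ => 5) fun v _ => ?_).trans
        (sum_le_sum_of_subset fun v hv => ?_)
      · rw [charge]
        split_ifs <;> omega
      · simp only [mem_filter] at hv ⊢
        exact ⟨hv.1.1, hv.2⟩
    · intro v hv
      simp only [mem_filter] at hv
      obtain ⟨⟨hv, hvp⟩, hne⟩ := hv
      have hC : ¬ Centre F v p := by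
        rintro ⟨q, r, hqr, hq, hr, h5, h6⟩
        have hq' : q = a ∨ q = c := by
          by_contra! h
          exact Big.le_two hF ha hc h5 hac h.1.symm h.2.symm
        have hr' : r = a ∨ r = c := by
          by_contra! h
          exact Big.le_two hF ha hc h6 hac h.1.symm h.2.symm
        have : v a ≠ 0 ∧ v c ≠ 0 := by
          rcases hq' with rfl | rfl <;> rcases hr' with rfl | rfl <;> tauto
        exact hne (hF.pts_eq hv ha.1 hc.1 hac hvp this.1 this.2)
      have hTo : Touch F v p := by
        rcases ha.cover hF hc hac hv hvp with h | h
        exacts [⟨a, h, ha⟩, ⟨c, h, hc⟩]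
      simp [charge, hC, hTo]
  have h5 : #{v ∈ F | pts v = {p, a, c}} ≤ 2 := by
    by_contra! h
    obtain ⟨u, v, w, hu, hv, hw, huv, huw, hvw⟩ := two_lt_card_iff.1 h
    simp only [mem_filter] at hu hv hw
    rcases hT.two u hu.1 v hv.1 w hw.1 (by rw [hu.2, hv.2]) (by rw [hu.2, hw.2]) with h | h | h <;>
      contradiction
  rw [← h3, smul_eq_mul] at h4
  omega

/-! ### Points in exactly one big pair -/

variable {p a : ι}

theorem not_centre_of_unique (h1 : ∀ c, Big F p c → c = a) : ∀ v ∈ F, ¬ Centre F v p :=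
  fun _ _ ⟨_, _, hqr, _, _, hq, hr⟩ => hqr ((h1 _ hq).trans (h1 _ hr).symm)

theorem touch_iff (ha : Big F p a) (h1 : ∀ c, Big F p c → c = a) {v : ι → ℤ} :
    Touch F v p ↔ v a ≠ 0 :=
  ⟨fun ⟨_, hq, h⟩ => h1 _ h ▸ hq, fun h => ⟨a, h, ha⟩⟩

theorem entry_of_leaf (hF : SignedTriples F) (ha : Big F p a) {v z : ι → ℤ} (hv : v ∈ F)
    (hz : z ∈ F) (vp : v p ≠ 0) (va : v a = 0) {j : ι} (jp : j ≠ p) (ja : j ≠ a) (zp : z p ≠ 0)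
    (za : z a ≠ 0) (zj : z j ≠ 0) (vj : v j = 0) : v p = - z p :=
  hF.opp hz hv ha.1 jp.symm ja.symm zp za zj vp va vj

/-- If the pair `p, a` is big, and `p` is used with both signs by vectors avoiding `a`, the leaves
of `p, a` are the points other than `p` of any two such vectors with opposite entries. -/
theorem leaves_subset_of_free (hF : SignedTriples F) (ha : Big F p a)
    (h1 : ∀ c, Big F p c → c = a) {s : ℤ} (hs : s ≠ 0) {v w : ι → ℤ} (hv : v ∈ free F p s)
    (hw : w ∈ free F p (-s)) : leaves F p a ⊆ (pts v).erase p ∪ (pts w).erase p := by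
  intro j hj
  obtain ⟨jp, ja, z, hz, zp, za, zj⟩ := mem_leaves.1 hj
  obtain ⟨hv, hvs, hvt⟩ := mem_free.1 hv
  obtain ⟨hw, hws, hwt⟩ := mem_free.1 hw
  rw [touch_iff ha h1, not_not] at hvt hwt
  by_contra h
  simp only [mem_union, mem_erase, mem_pts, ne_eq, jp, not_false_eq_true, true_and, not_or,
    not_not] at h
  have e1 := entry_of_leaf hF ha hv hz (hvs ▸ hs) hvt jp ja zp za zj h.1
  have e2 := entry_of_leaf hF ha hw hz (by rw [hws]; simpa using hs) hwt jp ja zp za zj h.2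
  omega

/-- At a point in exactly one big pair, either one of the two signed points is not used by free
vectors, or each of them is used by free vectors with a single support. -/
theorem free_eq_empty_or (hF : SignedTriples F) (ha : Big F p a) (h1 : ∀ c, Big F p c → c = a)
    {s : ℤ} (hs : s ≠ 0) : free F p (-s) = ∅ ∨ #((free F p s).image pts) ≤ 1 := by
  by_contra! h
  obtain ⟨⟨w, hw⟩, h2⟩ := h
  obtain ⟨e, he, f, hf, hef⟩ := one_lt_card.1 h2
  obtain ⟨v, hv, rfl⟩ := mem_image.1 he
  obtain ⟨u, hu, rfl⟩ := mem_image.1 hf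
  have card2 : ∀ {t : ℤ}, t ≠ 0 → ∀ v ∈ free F p t, #((pts v).erase p) = 2 := fun ht v hv => by
    obtain ⟨hv, hvs, hvt⟩ := mem_free.1 hv
    rw [card_erase_of_mem (by simp [hvs, ht]), hF.card_pts hv]
  have c1 := card2 hs v hv
  have c2 := card2 hs u hu
  have c3 := card2 (neg_ne_zero.2 hs) w hw
  have hL := ha.2
  have key : ∀ v ∈ free F p s, #((pts v).erase p) = 2 →
      (pts v).erase p = leaves F p a \ (pts w).erase p := by
    intro v hv c
    have hsub := leaves_subset_of_free hF ha h1 hs hv hw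
    have h3 : leaves F p a \ (pts w).erase p ⊆ (pts v).erase p := by
      intro x hx
      have := hsub (mem_sdiff.1 hx).1
      grind
    refine (eq_of_subset_of_card_le h3 ?_).symm
    have := le_card_sdiff ((pts w).erase p) (leaves F p a)
    omega
  apply hef
  rw [← insert_erase (s := pts v) (a := p), ← insert_erase (s := pts u) (a := p),
    key v hv c1, key u hu c2]
  · rw [mem_pts, (mem_free.1 hu).2.1]; exact hs
  · rw [mem_pts, (mem_free.1 hv).2.1]; exact hs

/-- A signed point without free members receives nothing. -/
theorem pay_eq_zero_of_free (hF : SignedTriples F) (hT : Tame F) (hD : NoDouble F)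
    (h1 : ∀ c, Big F p c → c = a) {s : ℤ} (hs : s ≠ 0) (h : free F p s = ∅) :
    pay (charge F) F (p, s) = 0 := by
  have := pay_le_five_mul hF hT hD hs (not_centre_of_unique h1)
  simpa [h] using this

/-- If `p` lies in exactly one big pair and is used with both signs, the bound for one of the two
signed points applies to both together. -/
theorem slack_of_one_big (hF : SignedTriples F) (hT : Tame F) (hD : NoDouble F) (hΩ : Uses F Ω)
    (ha : Big F p a) (h1 : ∀ c, Big F p c → c = a) {k : ℤ}
    (hpay : ∀ s : ℤ, s ≠ 0 → pay (charge F) F (p, s) + k ≤ 20)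
    (hpay' : ∀ s : ℤ, s ≠ 0 → #((free F p s).image pts) ≤ 1 →
      2 * (pay (charge F) F (p, s) : ℤ) + k ≤ 20)
    (h2 : (p, 1) ∈ Ω) (h3 : (p, -1) ∈ Ω) : k ≤ slack F Ω p := by
  rw [slack_of_both hΩ h2 h3]
  have e1 := free_eq_empty_or hF ha h1 (s := 1) (by omega)
  have e2 := free_eq_empty_or hF ha h1 (s := -1) (by omega)
  rw [neg_neg] at e2
  have b1 := hpay 1 (by omega)
  have b2 := hpay (-1) (by omega)
  rcases e1 with e1 | e1
  · have := pay_eq_zero_of_free hF hT hD h1 (by omega) e1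
    omega
  rcases e2 with e2 | e2
  · have := pay_eq_zero_of_free hF hT hD h1 (by omega) e2
    omega
  have c1 := hpay' 1 (by omega) e1
  have c2 := hpay' (-1) (by omega) e2
  omega

/-- If `p` belongs to exactly one big pair `p, a` and is used with one sign only, then all vectors
at `p` contain `a`. -/
theorem free_eq_empty (hF : SignedTriples F) (hΩ : Uses F Ω) (ha : Big F p a)
    (h1 : ∀ c, Big F p c → c = a) (h2 : ¬ ((p, 1) ∈ Ω ∧ (p, -1) ∈ Ω)) {s : ℤ} (hs : s ≠ 0) :
    free F p s = ∅ := by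
  by_contra h
  obtain ⟨v, hv⟩ := nonempty_iff_ne_empty.2 h
  obtain ⟨hv, hvs, hvt⟩ := mem_free.1 hv
  rw [touch_iff ha h1, not_not] at hvt
  obtain ⟨x, y, hx, hy, hxy, vx, vy⟩ := hF.two_others hv p
  obtain ⟨j, jx, jy, -, jp, ja, z, hz, zp, za, zj⟩ := ha.exists_leaf x y x
  have vp : v p ≠ 0 := hvs ▸ hs
  have vj : v j = 0 := by
    by_contra h
    rcases hF.supp_or hv hx.symm hy.symm hxy vp vx vy h with rfl | rfl | rfl <;> contradiction
  have e := entry_of_leaf hF ha hv hz vp hvt jp ja zp za zj vj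
  have m1 := hΩ.mem v hv p vp
  have m2 := hΩ.mem z hz p zp
  rw [e] at m1
  rcases hF.sign z hz p zp with h | h <;> rw [h] at m1 m2 <;> simp_all

/-- A point in exactly one big pair which is used with one sign only receives no charge. -/
theorem slack_of_one_sign (hF : SignedTriples F) (hT : Tame F) (hD : NoDouble F) (hΩ : Uses F Ω)
    (ha : Big F p a) (h1 : ∀ c, Big F p c → c = a) (h2 : ¬ ((p, 1) ∈ Ω ∧ (p, -1) ∈ Ω)) :
    slack F Ω p = 10 := by
  obtain ⟨s, hs⟩ := ha.exists_mem hΩ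
  have hs0 := sign_ne_zero hΩ hs
  rw [slack_of_one hΩ hs, pay_eq_zero_of_free hF hT hD h1 hs0 (free_eq_empty hF hΩ ha h1 h2 hs0)]
  · simp
  · intro h
    rcases hΩ.sign _ hs with h3 | h3 <;> simp only at h3 <;> subst h3 <;> simp_all

/-- A point in exactly one big pair which is used with both signs receives at most `11` in all, by
`pay_le` and `slack_of_one_big`; points in two big pairs have slack `10`. -/
theorem nine_le_slack (hF : SignedTriples F) (hT : Tame F) (hD : NoDouble F) (hΩ : Uses F Ω)
    (hp : p ∈ bigPts F) : 9 ≤ slack F Ω p := by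
  obtain ⟨a, ha⟩ := mem_bigPts.1 hp
  by_cases h1 : ∀ c, Big F p c → c = a
  · by_cases h2 : (p, 1) ∈ Ω ∧ (p, -1) ∈ Ω
    · have hC := not_centre_of_unique h1
      refine slack_of_one_big hF hT hD hΩ ha h1 (fun s hs => ?_) (fun s hs h => ?_)
        h2.1 h2.2
      · have h3 := pay_le hF hT hD hs hC (m := 3) (by omega) (fun _ _ _ _ _ => le_rfl)
        have h4 := card_freeBig_le_two hF hT hD p hs
        omega
      · have := pay_le_five_mul hF hT hD hs hC
        omega
    · rw [slack_of_one_sign hF hT hD hΩ ha h1 h2]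
      omega
  · push Not at h1
    obtain ⟨c, hc, hca⟩ := h1
    exact le_trans (by omega) (slack_of_two_big hF hT hΩ ha hc hca.symm)

theorem slack_nonneg (hF : SignedTriples F) (hT : Tame F) (hD : NoDouble F) (hΩ : Uses F Ω)
    (p : ι) : 0 ≤ slack F Ω p := by
  by_cases hp : p ∈ bigPts F
  · exact le_trans (by omega) (nine_le_slack hF hT hD hΩ hp)
  · exact slack_nonneg_of_notMem hF hT hD hΩ hp

end

section

/-! ### The total slack -/

variable {ι : Type*} [Fintype ι] {F : Finset (ι → ℤ)} {Ω : Finset (ι × ℤ)}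

theorem sum_slack_le (hF : SignedTriples F) (hT : Tame F) (hD : NoDouble F) (hΩ : Uses F Ω)
    (S : Finset ι) : ∑ p ∈ S, slack F Ω p ≤ ∑ p, slack F Ω p :=
  sum_le_sum_of_subset_of_nonneg (subset_univ _) fun p _ _ => slack_nonneg hF hT hD hΩ p

/-- The set of signed points is closed under negation, or contains no point with both signs. -/
def Balanced (Ω : Finset (ι × ℤ)) : Prop :=
  (∀ h ∈ Ω, (h.1, -h.2) ∈ Ω) ∨ ∀ h ∈ Ω, (h.1, -h.2) ∉ Ω

/-- A bound for a point in a single big pair none of whose free members contains a big pair. -/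
theorem slack_of_freeBig_empty (hF : SignedTriples F) (hT : Tame F) (hD : NoDouble F)
    (hΩ : Uses F Ω) {p a : ι} (ha : Big F p a) (h1 : ∀ c, Big F p c → c = a)
    (hb : ∀ s, freeBig F p s = ∅) (h2 : (p, 1) ∈ Ω) (h3 : (p, -1) ∈ Ω) {t : ℕ}
    (hE : ∀ s, s ≠ 0 → #{e ∈ (freeSmall F p s).image pts | ∃ q ∈ e, Tied F p q} ≤ t) :
    (14 : ℤ) - t ≤ slack F Ω p := by
  have hC := not_centre_of_unique h1
  refine slack_of_one_big hF hT hD hΩ ha h1 (fun s hs => ?_) (fun s hs h => ?_) h2 h3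
  all_goals
    have e1 := pay_eq_add hC (s := s)
    have e2 := sum_freeSmall_le_add hF hT (p := p) hs
    have e3 := card_freeBig_add_card hD p hs
    have e4 := card_free_edges hF p hs
    have e5 := hE s hs
    rw [hb s, card_empty] at e1 e3
  · omega
  · have e6 : #{e ∈ (freeSmall F p s).image pts | ∃ q ∈ e, Tied F p q} ≤
        #((freeSmall F p s).image pts) := card_filter_le _ _
    omega

/-! ### Families with a single big pair -/

section OnePair

variable {a b : ι}

theorem freeBig_eq_empty_of_one (h : ∀ x y, Big F x y → x = a ∧ y = b ∨ x = b ∧ y = a) (s : ℤ) :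
    freeBig F a s = ∅ := by
  rw [eq_empty_iff_forall_notMem]
  intro v hv
  obtain ⟨⟨hv, hvs, hvt⟩, q, r, hq, hr, hqr⟩ := mem_freeBig.1 hv
  obtain ⟨h1, h2⟩ := ne_of_not_touch hvt hq hr hqr
  rcases h q r hqr with h | h
  exacts [h1 h.1.symm, h2 h.2.symm]

/-- With a single big pair nothing is tied, so an end of the pair receives at most `2` for each
support of a free member. -/
theorem fourteen_le_slack (hF : SignedTriples F) (hT : Tame F) (hD : NoDouble F)
    (hΩ : Uses F Ω) (hab : Big F a b) (h : ∀ x y, Big F x y → x = a ∧ y = b ∨ x = b ∧ y = a)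
    (h2 : (a, 1) ∈ Ω) (h3 : (a, -1) ∈ Ω) : 14 ≤ slack F Ω a := by
  have hne := hab.1
  have := slack_of_freeBig_empty hF hT hD hΩ hab (fun c hc => by grind)
    (freeBig_eq_empty_of_one h) h2 h3 (t := 0) (fun s _ => by
      rw [Nat.le_zero, card_eq_zero, filter_eq_empty_iff]
      rintro e he ⟨q, hq, hqa, m, h4, h5⟩
      grind)
  simpa using this

/-- With a single big pair, at most one vector charges `5` to a given signed point off the pair. -/
theorem pay_leaf_le (hF : SignedTriples F) (hT : Tame F) (hD : NoDouble F)
    (h : ∀ x y, Big F x y → x = a ∧ y = b ∨ x = b ∧ y = a) {p : ι} {s : ℤ} (hs : s ≠ 0)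
    (hp : p ∉ bigPts F) : pay (charge F) F (p, s) ≤ 9 := by
  have h1 := pay_le_of_notMem hF hT hD hs hp
  suffices h2 : #(freeBig F p s) ≤ 1 by omega
  refine card_le_one.2 fun v hv w hw => ?_
  by_contra hvw
  obtain ⟨x, y, z, -, -, hxy, hxz, hyz, -⟩ := freeBig_pair hF hD hs hv hw hvw
  have := hxy.1
  grind

/-- If moreover all vectors meeting the only big pair contain it, then the vector charging `5` to a
signed point is the only free one there. -/
theorem pay_leaf_le_six (hF : SignedTriples F) (hT : Tame F) (hD : NoDouble F)
    (h : ∀ x y, Big F x y → x = a ∧ y = b ∨ x = b ∧ y = a)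
    (hab : ∀ v ∈ F, v a ≠ 0 ↔ v b ≠ 0) {p : ι} {s : ℤ} (hs : s ≠ 0) (hp : p ∉ bigPts F) :
    pay (charge F) F (p, s) ≤ 6 := by
  have h1 := pay_le_of_notMem hF hT hD hs hp
  by_cases h2 : freeBig F p s = ∅
  · rw [h2, card_empty] at h1
    omega
  obtain ⟨v, hv⟩ := nonempty_iff_ne_empty.2 h2
  obtain ⟨⟨hv, hvs, hvt⟩, q, r, hq, hr, hqr⟩ := mem_freeBig.1 hv
  obtain ⟨h3, h4⟩ := ne_of_not_touch hvt hq hr hqr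
  -- all members of `free F p s` have the support of `v`
  have h5 : (free F p s).image pts ⊆ {pts v} := by
    intro e he
    obtain ⟨w, hw, rfl⟩ := mem_image.1 he
    obtain ⟨hw, hws, hwt⟩ := mem_free.1 hw
    have h6 := hF.meet hv hw h3 h4 hqr.1 (hvs ▸ hs) hq hr (by rw [hvs, hws])
    have h7 := hab w hw
    have h8 : w q ≠ 0 ∧ w r ≠ 0 := by
      rcases h q r hqr with ⟨rfl, rfl⟩ | ⟨rfl, rfl⟩ <;> tauto
    rw [mem_singleton, hF.pts_eq hv h3 h4 hqr.1 (hvs ▸ hs) hq hr,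
      hF.pts_eq hw h3 h4 hqr.1 (hws ▸ hs) h8.1 h8.2]
  have h9 := card_le_card h5
  have h10 := pay_le_five_mul hF hT hD hs (not_centre_of_notMem hp)
  rw [card_singleton] at h9
  omega

/-- The ends of the pair contribute `10` each, or `14` if used with both signs. The at least four
leaves contribute `1` for each signed point, or `4` each if no end is used with both signs. -/
theorem sum_slack_of_one_pair (hF : SignedTriples F) (hT : Tame F) (hD : NoDouble F)
    (hΩ : Uses F Ω) (hab : Big F a b) (h : ∀ x y, Big F x y → x = a ∧ y = b ∨ x = b ∧ y = a) :
    26 ≤ ∑ p, slack F Ω p ∧ (Balanced Ω → 36 ≤ ∑ p, slack F Ω p) := by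
  have h' : ∀ x y, Big F x y → x = b ∧ y = a ∨ x = a ∧ y = b := fun x y hxy => (h x y hxy).symm
  have hne := hab.1
  have ha1 : ∀ c, Big F a c → c = b := fun c hc => by grind
  have hb1 : ∀ c, Big F b c → c = a := fun c hc => by grind
  have hleaf : ∀ j ∈ leaves F a b, j ∉ bigPts F := by
    intro j hj hjb
    obtain ⟨x, hx⟩ := mem_bigPts.1 hjb
    obtain ⟨h1, h2, -⟩ := mem_leaves.1 hj
    rcases h j x hx with h | h
    exacts [h1 h.1, h2 h.1]
  have hhalf : ∀ j ∈ leaves F a b, ∃ s, (j, s) ∈ Ω := by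
    intro j hj
    obtain ⟨-, -, z, hz, -, -, zj⟩ := mem_leaves.1 hj
    exact ⟨_, hΩ.mem z hz j zj⟩
  have hsum := sum_slack_le hF hT hD hΩ (insert a (insert b (leaves F a b)))
  rw [sum_insert (by simp [hne, mem_leaves]), sum_insert (by simp [mem_leaves])] at hsum
  have hbound : ∀ k : ℤ, (∀ j ∈ leaves F a b, k ≤ slack F Ω j) → 0 ≤ k →
      4 * k ≤ ∑ j ∈ leaves F a b, slack F Ω j := by
    intro k hk hk0
    have h1 := card_nsmul_le_sum (leaves F a b) (slack F Ω) k hk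
    have h2 : (4 : ℤ) ≤ #(leaves F a b) := by exact_mod_cast hab.2
    rw [nsmul_eq_mul] at h1
    nlinarith
  have hone : ∀ j ∈ leaves F a b, 1 ≤ slack F Ω j := by
    intro j hj
    obtain ⟨s, hs⟩ := hhalf j hj
    have h1 := mul_le_slack (F := F) (Ω := Ω) (p := j) (k := 1) fun s hs => by
      have := pay_leaf_le hF hT hD h (s := s) (sign_ne_zero hΩ hs) (hleaf j hj)
      omega
    have h2 : 0 < #{h ∈ Ω | h.1 = j} := card_pos.2 ⟨(j, s), mem_filter.2 ⟨hs, rfl⟩⟩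
    omega
  have h4 := hbound 1 hone (by omega)
  by_cases sa : (a, 1) ∈ Ω ∧ (a, -1) ∈ Ω
  · have h5 := fourteen_le_slack hF hT hD hΩ hab h sa.1 sa.2
    have h6 : 10 ≤ slack F Ω b := by
      by_cases sb : (b, 1) ∈ Ω ∧ (b, -1) ∈ Ω
      · have := fourteen_le_slack hF hT hD hΩ hab.symm h' sb.1 sb.2
        omega
      · rw [slack_of_one_sign hF hT hD hΩ hab.symm hb1 sb]
    refine ⟨by omega, ?_⟩
    rintro (hfull | hone)
    · obtain ⟨s, hs⟩ := hab.symm.exists_mem hΩ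
      have hs' := hfull _ hs
      have sb : (b, 1) ∈ Ω ∧ (b, -1) ∈ Ω := by
        rcases hΩ.sign _ hs with h | h <;> simp only at h <;> subst h <;> simp_all
      have h6 := fourteen_le_slack hF hT hD hΩ hab.symm h' sb.1 sb.2
      have h7 := hbound 2 (fun j hj => ?_) (by omega)
      · omega
      obtain ⟨s, hs⟩ := hhalf j hj
      have h1 := mul_le_slack (F := F) (Ω := Ω) (p := j) (k := 1) fun s hs => by
        have := pay_leaf_le hF hT hD h (s := s) (sign_ne_zero hΩ hs) (hleaf j hj)
        omega
      have h2 : 1 < #{h ∈ Ω | h.1 = j} := by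
        refine one_lt_card.2 ⟨(j, s), mem_filter.2 ⟨hs, rfl⟩, (j, -s),
          mem_filter.2 ⟨hfull _ hs, rfl⟩, ?_⟩
        have := sign_ne_zero hΩ hs
        simp only [ne_eq, Prod.mk.injEq, true_and]
        simp only at this
        omega
      omega
    · exact absurd sa.2 (hone _ sa.1)
  · have h5 := slack_of_one_sign hF hT hD hΩ hab ha1 sa
    by_cases sb : (b, 1) ∈ Ω ∧ (b, -1) ∈ Ω
    · have h6 := fourteen_le_slack hF hT hD hΩ hab.symm h' sb.1 sb.2
      refine ⟨by omega, ?_⟩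
      rintro (hfull | hone)
      · obtain ⟨s, hs⟩ := hab.exists_mem hΩ
        have hs' := hfull _ hs
        exfalso
        apply sa
        rcases hΩ.sign _ hs with h | h <;> simp only at h <;> subst h <;> simp_all
      · exact absurd sb.2 (hone _ sb.1)
    · have h6 := slack_of_one_sign hF hT hD hΩ hab.symm hb1 sb
      have hiff : ∀ v ∈ F, v a ≠ 0 ↔ v b ≠ 0 := by
        intro v hv
        constructor
        · intro hva
          by_contra hvb
          have := free_eq_empty hF hΩ hab ha1 sa hva
          exact notMem_empty v (this ▸ mem_free.2 ⟨hv, rfl, fun ht => (touch_iff hab ha1).1 ht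
            hvb⟩)
        · intro hvb
          by_contra hva
          have := free_eq_empty hF hΩ hab.symm hb1 sb hvb
          exact notMem_empty v (this ▸ mem_free.2 ⟨hv, rfl, fun ht =>
            (touch_iff hab.symm hb1).1 ht hva⟩)
      have h7 := hbound 4 (fun j hj => ?_) (by omega)
      · exact ⟨by omega, fun _ => by omega⟩
      obtain ⟨s, hs⟩ := hhalf j hj
      have h1 := mul_le_slack (F := F) (Ω := Ω) (p := j) (k := 4) fun s hs => by
        have := pay_leaf_le_six hF hT hD h hiff (s := s) (sign_ne_zero hΩ hs) (hleaf j hj)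
        omega
      have h2 : 0 < #{h ∈ Ω | h.1 = j} := card_pos.2 ⟨(j, s), mem_filter.2 ⟨hs, rfl⟩⟩
      omega

end OnePair

/-! ### Families with exactly two big pairs, sharing a point -/

section TwoPairs

variable {a b c : ι}

theorem freeBig_eq_empty_of_two (hab : Big F a b)
    (h : ∀ x y, Big F x y → x = b ∨ y = b) (s : ℤ) :
    freeBig F a s = ∅ := by
  rw [eq_empty_iff_forall_notMem]
  intro v hv
  obtain ⟨⟨hv, hvs, hvt⟩, q, r, hq, hr, hqr⟩ := mem_freeBig.1 hv
  rcases h q r hqr with rfl | rfl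
  exacts [hvt ⟨q, hq, hab⟩, hvt ⟨r, hr, hab⟩]

/-- The slack at an end `a` of two big pairs `a, b` and `b, c`: the charges above `2` come from
vectors through the tied points `a, c`. -/
theorem slack_of_end (hF : SignedTriples F) (hT : Tame F) (hD : NoDouble F) (hΩ : Uses F Ω)
    (hab : Big F a b) (hac : a ≠ c) (ha : ∀ x, Big F a x → x = b)
    (hb : ∀ x, Big F b x → x = a ∨ x = c)
    (h : ∀ x y, Big F x y → x = b ∨ y = b) (h2 : (a, 1) ∈ Ω) (h3 : (a, -1) ∈ Ω) :
    11 ≤ slack F Ω a ∧ (#((leaves F a c).erase b) ≤ 1 → 13 ≤ slack F Ω a) := by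
  have key : ∀ s, s ≠ 0 → #{e ∈ (freeSmall F a s).image pts | ∃ q ∈ e, Tied F a q} ≤
      #((leaves F a c).erase b) := by
    intro s hs
    refine le_trans (card_le_card ?_) (card_image_le (f := fun x => {a, c, x}))
    intro e he
    obtain ⟨he, q, hq, haq, m, h4, h5⟩ := mem_filter.1 he
    obtain ⟨v, hv, rfl⟩ := mem_image.1 he
    obtain ⟨⟨hv, hvs, hvt⟩, -⟩ := mem_freeSmall.1 hv
    obtain rfl := ha m h4
    rw [touch_iff h4 ha] at hvt
    obtain rfl : q = c := (hb q h5.symm).resolve_left haq.symm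
    obtain ⟨x, hx1, hx2, hx⟩ := hF.third hv a q
    have hva : v a ≠ 0 := hvs ▸ hs
    refine mem_image.2 ⟨x, mem_erase.2 ⟨?_, mem_leaves.2 ⟨hx1, hx2, v, hv, hva, mem_pts.1 hq, hx⟩⟩,
      (hF.pts_eq hv haq hx1.symm hx2.symm hva (mem_pts.1 hq) hx).symm⟩
    rintro rfl
    exact hvt hx
  have hbig := freeBig_eq_empty_of_two hab h
  have h4 : (14 : ℤ) - (3 : ℕ) ≤ slack F Ω a :=
    slack_of_freeBig_empty hF hT hD hΩ hab ha hbig h2 h3 fun s hs =>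
      (card_filter_le _ _).trans ((card_le_card (image_subset_image (filter_subset _ _))).trans
        (card_free_edges hF a hs))
  refine ⟨h4, fun h5 => ?_⟩
  have h6 : (14 : ℤ) - (1 : ℕ) ≤ slack F Ω a :=
    slack_of_freeBig_empty hF hT hD hΩ hab ha hbig h2 h3 fun s hs => (key s hs).trans h5
  exact h6

/-- If `a, c` belong to the supports `{a, c, x}` and `{a, c, y}`, and `b` forms big pairs with `a`
and `c`, then `{a, b, x}` is the support of at most one vector. -/
theorem card_support_le_one (hF : SignedTriples F) (hab : Big F a b) (hcb : Big F c b)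
    (hac : a ≠ c) {x y : ι} (hx : x ∈ (leaves F a c).erase b) (hy : y ∈ (leaves F a c).erase b)
    (hxy : x ≠ y) : #{v ∈ F | pts v = {a, b, x}} ≤ 1 := by
  simp only [mem_erase, mem_leaves] at hx hy
  obtain ⟨hxb, hxa, hxc, -⟩ := hx
  obtain ⟨hyb, hya, hyc, z, hz, za, zc, zy⟩ := hy
  obtain ⟨k, k1, -, -, k2, k3, w, hw, wc, wb, wk⟩ := hcb.exists_leaf a a a
  have key : ∀ v ∈ F, pts v = {a, b, x} → v a = - z a ∧ v b = - w b := by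
    intro v hv hp
    have m : ∀ q, v q ≠ 0 ↔ q = a ∨ q = b ∨ q = x := fun q => by rw [← mem_pts, hp]; simp
    have va := (m a).2 (by simp)
    have vb := (m b).2 (by simp)
    have vc : v c = 0 := by
      by_contra h
      have := (m c).1 h
      have := hcb.1
      tauto
    have vy : v y = 0 := by
      by_contra h
      have := (m y).1 h
      tauto
    refine ⟨hF.opp hz hv hac hya.symm hyc.symm za zc zy va vc vy, ?_⟩
    exact hcb.symm.opp hF hab.symm hac.symm hw hv wb wc
      (hF.zero_of_ne hw hcb.1 k2.symm k3.symm wc wb wk hac hab.1 k1.symm) vb va vc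
  refine card_le_one.2 fun v hv w hw => ?_
  obtain ⟨hv, hvp⟩ := mem_filter.1 hv
  obtain ⟨hw, hwp⟩ := mem_filter.1 hw
  have h1 := key v hv hvp
  have h2 := key w hw hwp
  refine hF.eq_of_pts hv hw (hvp.trans hwp.symm) hab.1 ?_ ?_ (h1.1.trans h2.1.symm)
    (h1.2.trans h2.2.symm)
  · rw [← mem_pts, hvp]; simp
  · rw [← mem_pts, hvp]; simp

/-- If there are two vectors through the tied points `a, c` with different third points, these third
points have slack themselves, as at most two vectors charge `5` to them. -/
theorem two_le_slack (hF : SignedTriples F) (hT : Tame F) (hD : NoDouble F) (hΩ : Uses F Ω)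
    (hab : Big F a b) (hcb : Big F c b) (hac : a ≠ c) (hb : ∀ x, Big F b x → x = a ∨ x = c)
    (h : ∀ x y, Big F x y → x = b ∨ y = b) {x y : ι} (hx : x ∈ (leaves F a c).erase b)
    (hy : y ∈ (leaves F a c).erase b) (hxy : x ≠ y) (h2 : (x, 1) ∈ Ω) (h3 : (x, -1) ∈ Ω) :
    2 ≤ slack F Ω x := by
  have c1 := card_support_le_one hF hab hcb hac hx hy hxy
  have c2 := card_support_le_one hF hcb hab hac.symm (leaves_comm F a c ▸ hx)
    (leaves_comm F a c ▸ hy) hxy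
  simp only [mem_erase, mem_leaves] at hx
  have hxB : x ∉ bigPts F := by
    intro hxB
    obtain ⟨q, hq⟩ := mem_bigPts.1 hxB
    rcases h x q hq with h | rfl
    · exact hx.1 h
    · rcases hb x hq.symm with h | h
      exacts [hx.2.1 h, hx.2.2.1 h]
  have c3 : freeBig F x 1 ∪ freeBig F x (-1) ⊆
      {v ∈ F | pts v = {a, b, x}} ∪ {v ∈ F | pts v = {c, b, x}} := by
    have : ∀ s : ℤ, s ≠ 0 → freeBig F x s ⊆
        {v ∈ F | pts v = {a, b, x}} ∪ {v ∈ F | pts v = {c, b, x}} := by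
      intro s hs v hv
      obtain ⟨⟨hv, hvs, hvt⟩, q, r, hq, hr, hqr⟩ := mem_freeBig.1 hv
      have hvx : v x ≠ 0 := hvs ▸ hs
      have hbig : v b ≠ 0 ∧ (v a ≠ 0 ∨ v c ≠ 0) := by
        rcases h q r hqr with rfl | rfl
        · rcases hb r hqr with rfl | rfl <;> tauto
        · rcases hb q hqr.symm with rfl | rfl <;> tauto
      rw [mem_union, mem_filter, mem_filter]
      rcases hbig with ⟨hb, ha | hc⟩
      · exact Or.inl ⟨hv, hF.pts_eq hv hab.1 hx.2.1.symm hx.1.symm ha hb hvx⟩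
      · exact Or.inr ⟨hv, hF.pts_eq hv hcb.1 hx.2.2.1.symm hx.1.symm hc hb hvx⟩
    exact union_subset (this 1 (by omega)) (this (-1) (by omega))
  have c4 := (card_le_card c3).trans (card_union_le _ _)
  rw [card_union_of_disjoint] at c4
  · have e1 := pay_le_of_notMem hF hT hD (s := 1) (by omega) hxB
    have e2 := pay_le_of_notMem hF hT hD (s := -1) (by omega) hxB
    rw [slack_of_both hΩ h2 h3]
    omega
  · rw [disjoint_left]
    intro v hv hv'
    have e1 := (mem_freeBig.1 hv).1.2.1
    have e2 := (mem_freeBig.1 hv').1.2.1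
    omega

/-- The three points of two big pairs `a, b` and `b, c` have slack at least `9 + 10 + 9`; in the
balanced case the ends have slack `13`, or `11` and then two further points have slack `2`. -/
theorem sum_slack_of_two_pairs (hF : SignedTriples F) (hT : Tame F) (hD : NoDouble F)
    (hΩ : Uses F Ω) (hab : Big F a b) (hcb : Big F c b) (hac : a ≠ c)
    (hB : ∀ x ∈ bigPts F, x = a ∨ x = b ∨ x = c) :
    26 ≤ ∑ p, slack F Ω p ∧ (Balanced Ω → 36 ≤ ∑ p, slack F Ω p) := by
  have hac' : ¬ Big F a c := fun h => hT.triangle a b c hab h hcb.symm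
  have ha : ∀ x, Big F a x → x = b := by
    intro x hx
    rcases hB x (mem_bigPts.2 ⟨a, hx.symm⟩) with rfl | rfl | rfl
    exacts [absurd rfl hx.1, rfl, absurd hx hac']
  have hc : ∀ x, Big F c x → x = b := by
    intro x hx
    rcases hB x (mem_bigPts.2 ⟨c, hx.symm⟩) with rfl | rfl | rfl
    exacts [absurd hx.symm hac', rfl, absurd rfl hx.1]
  have hb : ∀ x, Big F b x → x = a ∨ x = c := by
    intro x hx
    have := hx.1
    have := hB x (mem_bigPts.2 ⟨b, hx.symm⟩)
    tauto
  have h : ∀ x y, Big F x y → x = b ∨ y = b := by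
    intro x y hxy
    rcases hB x (mem_bigPts.2 ⟨y, hxy⟩) with rfl | rfl | rfl
    exacts [Or.inr (ha y hxy), Or.inl rfl, Or.inr (hc y hxy)]
  have hab' := hab.1
  have hcb' := hcb.1
  have s1 := nine_le_slack hF hT hD hΩ (mem_bigPts.2 ⟨b, hab⟩)
  have s2 := nine_le_slack hF hT hD hΩ (mem_bigPts.2 ⟨b, hcb⟩)
  have s3 := slack_of_two_big hF hT hΩ hab.symm hcb.symm hac
  have hsum := sum_slack_le hF hT hD hΩ {a, b, c}
  rw [sum_insert (by simp [hab', hac]), sum_insert (by simp [hcb'.symm]), sum_singleton] at hsum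
  refine ⟨by omega, ?_⟩
  rintro (hfull | hone)
  · obtain ⟨sa, hsa⟩ := hab.exists_mem hΩ
    obtain ⟨sc, hsc⟩ := hcb.exists_mem hΩ
    have ba := both_of_full hΩ hfull hsa
    have bc := both_of_full hΩ hfull hsc
    have t1 := slack_of_end hF hT hD hΩ hab hac ha hb h ba.1 ba.2
    have t2 := slack_of_end hF hT hD hΩ hcb hac.symm hc (fun x hx => (hb x hx).symm) h bc.1 bc.2
    rw [leaves_comm F c a] at t2
    by_cases hq : #((leaves F a c).erase b) ≤ 1
    · have := t1.2 hq
      have := t2.2 hq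
      omega
    · -- two further points with slack
      obtain ⟨x, hx, y, hy, hxy⟩ := one_lt_card.1 (not_le.1 hq)
      have hboth : ∀ x ∈ (leaves F a c).erase b, (x, 1) ∈ Ω ∧ (x, -1) ∈ Ω := by
        intro x hx
        simp only [mem_erase, mem_leaves] at hx
        obtain ⟨-, -, -, v, hv, -, -, hvx⟩ := hx
        exact both_of_full hΩ hfull (hΩ.mem v hv x hvx)
      have u1 := two_le_slack hF hT hD hΩ hab hcb hac hb h hx hy hxy (hboth x hx).1 (hboth x hx).2
      have u2 := two_le_slack hF hT hD hΩ hab hcb hac hb h hy hx hxy.symm (hboth y hy).1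
        (hboth y hy).2
      have hsum := sum_slack_le hF hT hD hΩ {x, y, a, b, c}
      simp only [mem_erase, mem_leaves] at hx hy
      rw [sum_insert (by simp [hxy, hx.1, hx.2.1, hx.2.2.1]),
        sum_insert (by simp [hy.1, hy.2.1, hy.2.2.1]), sum_insert (by simp [hab', hac]),
        sum_insert (by simp [hcb'.symm]), sum_singleton] at hsum
      have := t1.1
      have := t2.1
      omega
  · have := hab.symm.both hF hΩ hcb.symm hac
    exact absurd this.2 (hone _ this.1)

end TwoPairs

/-- The total slack of a tame family with a big pair in which no apex carries two vectors. -/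
theorem sum_slack_of_noDouble (hF : SignedTriples F) (hT : Tame F) (hD : NoDouble F)
    (hΩ : Uses F Ω) {a b : ι} (hab : Big F a b) :
    26 ≤ ∑ p, slack F Ω p ∧ (Balanced Ω → 36 ≤ ∑ p, slack F Ω p) := by
  have ha : a ∈ bigPts F := mem_bigPts.2 ⟨b, hab⟩
  have hb : b ∈ bigPts F := mem_bigPts.2 ⟨a, hab.symm⟩
  by_cases h4 : 4 ≤ #(bigPts F)
  · have h1 : #(bigPts F) • (9 : ℤ) ≤ ∑ p ∈ bigPts F, slack F Ω p :=
      card_nsmul_le_sum _ _ _ fun p hp => nine_le_slack hF hT hD hΩ hp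
    have h2 := sum_slack_le hF hT hD hΩ (bigPts F)
    rw [nsmul_eq_mul] at h1
    exact ⟨by omega, fun _ => by omega⟩
  by_cases h : ∀ c ∈ bigPts F, c = a ∨ c = b
  · refine sum_slack_of_one_pair hF hT hD hΩ hab fun x y hxy => ?_
    have := hxy.1
    have h1 := h x (mem_bigPts.2 ⟨y, hxy⟩)
    have h2 := h y (mem_bigPts.2 ⟨x, hxy.symm⟩)
    grind
  push Not at h
  obtain ⟨c, hc, hca, hcb⟩ := h
  have hB : ∀ x ∈ bigPts F, x = a ∨ x = b ∨ x = c := by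
    intro x hx
    by_contra! hne
    have h3 : {x, a, b, c} ⊆ bigPts F := by grind
    have h5 := card_le_card h3
    rw [card_insert_of_notMem (by simp [hne]), card_insert_of_notMem (by simp [hab.1, hca.symm]),
      card_insert_of_notMem (by simp [hcb.symm]), card_singleton] at h5
    omega
  obtain ⟨d, hd⟩ := mem_bigPts.1 hc
  rcases hB d (mem_bigPts.2 ⟨c, hd.symm⟩) with rfl | rfl | rfl
  · exact sum_slack_of_two_pairs hF hT hD hΩ hab.symm hd hcb.symm fun x hx => by
      have := hB x hx
      tauto
  · exact sum_slack_of_two_pairs hF hT hD hΩ hab hd hca.symm hB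
  · exact absurd rfl hd.1

/-! ### Tame families without big pairs -/

/-- Without big pairs, each signed point receives at most `2` for each of at most three supports. -/
theorem five_mul_card_le (hF : SignedTriples F) (hT : Tame F) (hΩ : Uses F Ω)
    (hB : ∀ a b, ¬ Big F a b) : 5 * #F ≤ 6 * #Ω := by
  refine (mul_card_le_sum_pay hΩ (charge F) 5 fun v hv => le_sum_charge hF hT hv).trans ?_
  rw [mul_comm, ← smul_eq_mul]
  refine sum_le_card_nsmul _ _ _ fun ⟨p, s⟩ hh => ?_
  have h1 := pay_le_of_notMem hF hT (fun a b _ h => absurd h (hB a b)) (sign_ne_zero hΩ hh)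
    (p := p) fun hp => by
      obtain ⟨q, hq⟩ := mem_bigPts.1 hp
      exact hB p q hq
  have h2 : freeBig F p s = ∅ := by
    rw [eq_empty_iff_forall_notMem]
    intro v hv
    obtain ⟨q, r, -, -, h⟩ := (mem_freeBig.1 hv).2
    exact hB q r h
  simp only [h2, card_empty] at h1
  omega

/-- If every point is used with one sign only, different members have different supports, so at most
three of them contain a given point. -/
theorem card_le_card_of_oneSigned (hF : SignedTriples F) (hΩ : Uses F Ω)
    (hB : ∀ a b, ¬ Big F a b) (h1 : ∀ h ∈ Ω, (h.1, -h.2) ∉ Ω) : #F ≤ #Ω := by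
  have h := mul_card_le_sum_pay hΩ (fun _ _ => 1) 3 fun v hv => by
    obtain ⟨a, b, c, h1, h2, h3, h⟩ := hF.three v hv
    exact ⟨a, b, c, h1, h2, h3, by simp [h], by simp [h], by simp [h], le_rfl⟩
  suffices ∑ h ∈ Ω, pay (fun _ _ => 1) F h ≤ #Ω • 3 by
    rw [smul_eq_mul] at this
    omega
  refine sum_le_card_nsmul _ _ _ fun ⟨p, s⟩ hh => ?_
  rw [pay, sum_const, smul_eq_mul, mul_one]
  by_contra! hc
  obtain ⟨c, hc, -⟩ := exists_big_of_four hF (S := {v ∈ F | v p = s}) (filter_subset _ _)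
    (sign_ne_zero hΩ hh) (fun v hv => (mem_filter.1 hv).2) (by
      rwa [card_image_of_injOn]
      intro v hv w hw hvw
      obtain ⟨hv, -⟩ := mem_filter.1 (mem_coe.1 hv)
      obtain ⟨hw, -⟩ := mem_filter.1 (mem_coe.1 hw)
      ext q
      by_cases hq : v q = 0
      · by_contra hne
        exact ne_zero_of_pts hvw (fun h => hne (hq.trans h.symm)) hq
      · by_contra hne
        have hq' := ne_zero_of_pts hvw.symm hq
        have := h1 _ (hΩ.mem v hv q hq)
        simp only at this
        rw [← hF.neg_of_ne hv hw hq hq' hne] at this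
        exact this (hΩ.mem w hw q hq'))
  exact hB p c hc

end

section

/-! ### Removing a big pair with a doubled apex -/

variable {ι : Type*} {F : Finset (ι → ℤ)} {Ω : Finset (ι × ℤ)}

namespace Doubled

variable {a b : ι}

/-- The members containing `a` but not `b`. -/
noncomputable def side (F : Finset (ι → ℤ)) (a b : ι) : Finset (ι → ℤ) :=
  {u ∈ F | u a ≠ 0 ∧ u b = 0}

theorem mem_side {u : ι → ℤ} : u ∈ side F a b ↔ u ∈ F ∧ u a ≠ 0 ∧ u b = 0 := by simp [side]

/-- The members containing both `a` and `b`. -/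
noncomputable def spine (F : Finset (ι → ℤ)) (a b : ι) : Finset (ι → ℤ) :=
  {u ∈ F | u a ≠ 0 ∧ u b ≠ 0}

theorem mem_spine {u : ι → ℤ} : u ∈ spine F a b ↔ u ∈ F ∧ u a ≠ 0 ∧ u b ≠ 0 := by simp [spine]

/-- The signed points used by the members containing `a` and `b`, other than those at `a, b`. -/
noncomputable def signedLeaves (F : Finset (ι → ℤ)) (Ω : Finset (ι × ℤ)) (a b : ι) :
    Finset (ι × ℤ) :=
  {h ∈ Ω | h.1 ≠ a ∧ h.1 ≠ b ∧ ∃ u ∈ spine F a b, u h.1 = h.2}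

theorem mem_signedLeaves {h : ι × ℤ} : h ∈ signedLeaves F Ω a b ↔
    h ∈ Ω ∧ h.1 ≠ a ∧ h.1 ≠ b ∧ ∃ u ∈ spine F a b, u h.1 = h.2 := by simp [signedLeaves]

/-- The members containing neither `a` nor `b`. -/
noncomputable def rest (F : Finset (ι → ℤ)) (a b : ι) : Finset (ι → ℤ) :=
  {u ∈ F | u a = 0 ∧ u b = 0}

theorem mem_rest {u : ι → ℤ} : u ∈ rest F a b ↔ u ∈ F ∧ u a = 0 ∧ u b = 0 := by simp [rest]

theorem card_eq_add : #F = #(spine F a b) + (#(side F a b) + #(side F b a)) + #(rest F a b) := by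
  have e1 := card_filter_add_card_filter_not (s := F) (fun u => u a = 0)
  have e2 := card_filter_add_card_filter_not (s := {u ∈ F | u a = 0}) (fun u => u b = 0)
  have e3 := card_filter_add_card_filter_not (s := {u ∈ F | ¬ u a = 0}) (fun u => u b = 0)
  simp only [filter_filter] at e2 e3
  have e4 : side F b a = {u ∈ F | u a = 0 ∧ ¬ u b = 0} := by
    simp only [side, and_comm, ne_eq]
  rw [spine, side, e4, rest]
  simp only [ne_eq]
  omega

/-- A leaf vector of the pair `a, b` away from a member containing `a` but not `b` determines the
entry of the latter at `a`. -/
theorem entry_eq (hF : SignedTriples F) {u z : ι → ℤ} (hz : z ∈ F) {j : ι} (hab : a ≠ b)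
    (ja : j ≠ a) (jb : j ≠ b) (za : z a ≠ 0) (zb : z b ≠ 0) (zj : z j ≠ 0)
    (hu : u ∈ side F a b) (uj : u j = 0) : u a = - z a :=
  hF.opp hz (mem_side.1 hu).1 hab ja.symm jb.symm za zb zj (mem_side.1 hu).2.1
    (mem_side.1 hu).2.2 uj

theorem exists_signedLeaf (hF : SignedTriples F) (hΩ : Uses F Ω) {u : ι → ℤ}
    (hu : u ∈ spine F a b) : ∃ h ∈ signedLeaves F Ω a b,
      u ∈ ({u ∈ spine F a b | u h.1 = h.2} : Finset (ι → ℤ)) := by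
  obtain ⟨j, ja, jb, uj⟩ := hF.third (mem_spine.1 hu).1 a b
  exact ⟨(j, u j), mem_signedLeaves.2 ⟨hΩ.mem u (mem_spine.1 hu).1 j uj, ja, jb, u, hu, rfl⟩,
    mem_filter.2 ⟨hu, rfl⟩⟩

/-- The signed points of `Ω` not at `a, b` and not used by the members containing `a, b`. -/
noncomputable def restPts (F : Finset (ι → ℤ)) (Ω : Finset (ι × ℤ)) (a b : ι) : Finset (ι × ℤ) :=
  {h ∈ Ω | h.1 ≠ a ∧ h.1 ≠ b ∧ h ∉ signedLeaves F Ω a b}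

theorem uses_rest (hF : SignedTriples F) (hΩ : Uses F Ω) (hab : a ≠ b) :
    Uses (rest F a b) (restPts F Ω a b) where
  mem u hu p hp := by
    obtain ⟨hu, ua, ub⟩ := mem_rest.1 hu
    have pa : p ≠ a := by rintro rfl; exact hp ua
    have pb : p ≠ b := by rintro rfl; exact hp ub
    refine mem_filter.2 ⟨hΩ.mem u hu p hp, pa, pb, fun h => ?_⟩
    obtain ⟨-, -, -, z, hz, e⟩ := mem_signedLeaves.1 h
    obtain ⟨hz, za, zb⟩ := mem_spine.1 hz
    simp only at e
    rcases hF.meet hz hu pa pb hab (e ▸ hp) za zb e.symm with h | h <;> contradiction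
  sign h hh := hΩ.sign h (mem_filter.1 hh).1

end Doubled

variable [Fintype ι]

/-- If every element of `S` belongs to some `T i`, and these sets have at most two elements. -/
theorem card_le_card_add_card_filter {α β : Type*} {S : Finset α} {I : Finset β}
    {T : β → Finset α} (h : ∀ x ∈ S, ∃ i ∈ I, x ∈ T i) (h2 : ∀ i ∈ I, #(T i) ≤ 2) :
    #S ≤ #I + #{i ∈ I | 2 ≤ #(T i)} := by
  have h1 : S ⊆ I.biUnion T := fun x hx => mem_biUnion.2 (h x hx)
  refine ((card_le_card h1).trans card_biUnion_le).trans ?_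
  rw [card_filter, card_eq_sum_ones, ← sum_add_distrib]
  refine sum_le_sum fun i hi => ?_
  have := h2 i hi
  split_ifs <;> omega

/-- The counting behind `card_sides_le`: `C` and `D` are the sets of tips in `Y` and `Z` which carry
two vectors. -/
theorem card_add_card_le_four {α : Type*} {Y Z C D : Finset α} (hY : #Y ≤ 2) (hZ : #Z ≤ 2)
    (hC : C ⊆ Y) (hD : D ⊆ Z) (hCZ : ∀ y ∈ C, Z ⊆ {y}) (hDY : ∀ z ∈ D, Y ⊆ {z}) :
    #Y + #C + (#Z + #D) ≤ 4 := by
  have key : ∀ {Y Z C D : Finset α}, #Y ≤ 2 → #Z ≤ 2 → C ⊆ Y → D ⊆ Z → (∀ y ∈ C, Z ⊆ {y}) →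
      (∀ z ∈ D, Y ⊆ {z}) → C.Nonempty → #Y + #C + (#Z + #D) ≤ 4 := by
    intro Y Z C D hY hZ hC hD hCZ hDY ⟨y, hy⟩
    have h1 := card_le_card hC
    have h2 := card_le_card hD
    have h3 := card_le_card (hCZ y hy)
    rw [card_singleton] at h3
    rcases Z.eq_empty_or_nonempty with rfl | ⟨z, hz⟩
    · rw [card_empty] at h2 ⊢
      omega
    · have h4 : C ⊆ {z} := fun c hc => by
        have := hCZ c hc hz
        rw [mem_singleton] at this ⊢
        exact this.symm
      have h5 := card_le_card h4
      rw [card_singleton] at h5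
      rcases D.eq_empty_or_nonempty with rfl | ⟨d, hd⟩
      · rw [card_empty]
        omega
      · have h6 := card_le_card (hDY d hd)
        rw [card_singleton] at h6
        omega
  rcases C.eq_empty_or_nonempty with rfl | h
  · rcases D.eq_empty_or_nonempty with rfl | h
    · simp only [card_empty]
      omega
    · have := key hZ hY hD hC hDY hCZ h
      omega
  · exact key hY hZ hC hD hCZ hDY h

/-- The pair `a, b` is big, and there are two vectors with support `{a, b, x}` which agree at `x`,
a point forming no big pair with `a` or `b`. -/
structure Doubled (F : Finset (ι → ℤ)) (a b x : ι) : Prop where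
  big : Big F a b
  not_left : ¬ Big F a x
  not_right : ¬ Big F b x
  ne_left : x ≠ a
  ne_right : x ≠ b
  exists_two : ∃ v ∈ F, ∃ w ∈ F, v a ≠ 0 ∧ v b ≠ 0 ∧ v x ≠ 0 ∧ pts w = pts v ∧ w x = v x ∧ w ≠ v

namespace Doubled

variable {a b x : ι}

theorem symm (h : Doubled F a b x) : Doubled F b a x where
  big := h.big.symm
  not_left := h.not_right
  not_right := h.not_left
  ne_left := h.ne_right
  ne_right := h.ne_left
  exists_two := by
    obtain ⟨v, hv, w, hw, h1, h2, h3⟩ := h.exists_two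
    exact ⟨v, hv, w, hw, h2, h1, h3⟩

/-- The two vectors over a doubled apex `x` have opposite entries at `a`. -/
theorem exists_neg (hF : SignedTriples F) (h : Doubled F a b x) :
    ∃ v ∈ F, ∃ w ∈ F, v a ≠ 0 ∧ v b ≠ 0 ∧ v x ≠ 0 ∧ w x ≠ 0 ∧ w b ≠ 0 ∧ w a = - v a := by
  obtain ⟨v, hv, w, hw, va, vb, vx, hp, e, hne⟩ := h.exists_two
  refine ⟨v, hv, w, hw, va, vb, vx, e ▸ vx, ne_zero_of_pts hp vb,
    hF.neg_of_ne hv hw va (ne_zero_of_pts hp va) fun h1 => hne ?_⟩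
  exact hF.eq_of_pts hw hv hp h.ne_left.symm (ne_zero_of_pts hp va) (e ▸ vx) h1.symm e

theorem both (hF : SignedTriples F) (hΩ : Uses F Ω) (h : Doubled F a b x) :
    (a, 1) ∈ Ω ∧ (a, -1) ∈ Ω := by
  obtain ⟨v, hv, w, hw, va, vb, vx, wx, wb, e⟩ := h.exists_neg hF
  have h1 := hΩ.mem v hv a va
  have h2 := hΩ.mem w hw a (by rw [e]; exact neg_ne_zero.2 va)
  rcases hF.sign v hv a va with h | h <;> rw [e, h] at h2 <;> rw [h] at h1 <;> simp_all

/-- Every member containing `a` but not `b` contains `x`. -/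
theorem apex_mem (hF : SignedTriples F) (h : Doubled F a b x) {u : ι → ℤ} (hu : u ∈ F)
    (ua : u a ≠ 0) (ub : u b = 0) : u x ≠ 0 := by
  intro ux
  obtain ⟨v, hv, w, hw, va, vb, vx, wx, wb, e⟩ := h.exists_neg hF
  have e1 := hF.opp hv hu h.big.1 h.ne_left.symm h.ne_right.symm va vb vx ua ub ux
  have e2 := hF.opp hw hu h.big.1 h.ne_left.symm h.ne_right.symm (e ▸ neg_ne_zero.2 va) wb wx
    ua ub ux
  omega

/-- The third points of the members containing `a` and `x` but not `b`. -/
noncomputable def tips (F : Finset (ι → ℤ)) (a b x : ι) : Finset ι :=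
  {y | y ≠ a ∧ y ≠ b ∧ y ≠ x ∧ ∃ u ∈ F, u a ≠ 0 ∧ u x ≠ 0 ∧ u y ≠ 0}

theorem mem_tips {y : ι} :
    y ∈ tips F a b x ↔ y ≠ a ∧ y ≠ b ∧ y ≠ x ∧ ∃ u ∈ F, u a ≠ 0 ∧ u x ≠ 0 ∧ u y ≠ 0 := by
  simp [tips]

/-- Three tips together with the leaf `b` would make the pair `a, x` big. -/
theorem card_tips_le (h : Doubled F a b x) : #(tips F a b x) ≤ 2 := by
  have h1 : insert b (tips F a b x) ⊆ leaves F a x := by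
    intro y hy
    rw [mem_insert, mem_tips] at hy
    rw [mem_leaves]
    rcases hy with rfl | hy
    · obtain ⟨v, hv, w, hw, va, vb, vx, -⟩ := h.exists_two
      exact ⟨h.big.1.symm, h.ne_right.symm, v, hv, va, vx, vb⟩
    · exact ⟨hy.1, hy.2.2.1, hy.2.2.2⟩
  have h2 := card_le_card h1
  rw [card_insert_of_notMem (by simp [mem_tips])] at h2
  by_contra! h3
  exact h.not_left ⟨h.ne_left.symm, by omega⟩

theorem side_pts (hF : SignedTriples F) (h : Doubled F a b x) {u : ι → ℤ}
    (hu : u ∈ side F a b) {y : ι}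
    (ya : y ≠ a) (yx : y ≠ x) (uy : u y ≠ 0) : pts u = {a, x, y} := by
  obtain ⟨hu, ua, ub⟩ := mem_side.1 hu
  exact hF.pts_eq hu h.ne_left.symm ya.symm yx.symm ua (h.apex_mem hF hu ua ub) uy

theorem exists_tip (hF : SignedTriples F) (h : Doubled F a b x) {u : ι → ℤ} (hu : u ∈ side F a b) :
    ∃ y ∈ tips F a b x, u ∈ ({u ∈ side F a b | u y ≠ 0} : Finset (ι → ℤ)) := by
  have hu' := hu
  obtain ⟨hu, ua, ub⟩ := mem_side.1 hu
  obtain ⟨y, ya, yx, uy⟩ := hF.third hu a x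
  refine ⟨y, mem_tips.2 ⟨ya, ?_, yx, u, hu, ua, h.apex_mem hF hu ua ub, uy⟩, mem_filter.2 ⟨hu', uy⟩⟩
  rintro rfl
  exact uy ub

theorem card_tip_le (hF : SignedTriples F) (hT : Tame F) (h : Doubled F a b x) {y : ι}
    (hy : y ∈ tips F a b x) : #{u ∈ side F a b | u y ≠ 0} ≤ 2 := by
  obtain ⟨ya, yb, yx, -⟩ := mem_tips.1 hy
  by_contra! hc
  obtain ⟨u, v, w, hu, hv, hw, huv, huw, hvw⟩ := two_lt_card_iff.1 hc
  simp only [mem_filter] at hu hv hw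
  have pu := h.side_pts hF hu.1 ya yx hu.2
  have pv := h.side_pts hF hv.1 ya yx hv.2
  have pw := h.side_pts hF hw.1 ya yx hw.2
  rcases hT.two u (mem_side.1 hu.1).1 v (mem_side.1 hv.1).1 w (mem_side.1 hw.1).1
    (by rw [pu, pv]) (by rw [pu, pw]) with h | h | h <;> contradiction

/-- If two vectors have support `{a, x, y}`, then `y` is the only possible third point of a vector
containing `b` and `x`. -/
theorem tips_subset (hF : SignedTriples F) (h : Doubled F a b x) {y : ι}
    (hy : y ∈ tips F a b x) (hc : 2 ≤ #{u ∈ side F a b | u y ≠ 0}) : tips F b a x ⊆ {y} := by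
  intro t ht
  rw [mem_singleton]
  by_contra hty
  obtain ⟨ya, yb, yx, -⟩ := mem_tips.1 hy
  obtain ⟨tb, ta, tx, w, hw, wb, wx, wt⟩ := mem_tips.1 ht
  obtain ⟨u, hu, u', hu', hne⟩ := one_lt_card.1 hc
  simp only [mem_filter] at hu hu'
  have pu := h.side_pts hF hu.1 ya yx hu.2
  have pu' := h.side_pts hF hu'.1 ya yx hu'.2
  obtain ⟨j, jx, jy, -, ja, jb, z, hz, za, zb, zj⟩ := h.big.exists_leaf x y x
  have hzero : ∀ {u : ι → ℤ}, pts u = {a, x, y} → ∀ q, q ≠ a → q ≠ x → q ≠ y → u q = 0 := by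
    intro u pu q h1 h2 h3
    by_contra h
    rw [← ne_eq, ← mem_pts, pu] at h
    simp [h1, h2, h3] at h
  have e1 := entry_eq hF hz h.big.1 ja jb za zb zj hu.1 (hzero pu j ja jx jy)
  have e2 := entry_eq hF hz h.big.1 ja jb za zb zj hu'.1 (hzero pu' j ja jx jy)
  have m : ∀ {u : ι → ℤ}, u ∈ side F a b → pts u = {a, x, y} → u x = - w x := by
    intro u hu pu
    refine hF.opp hw (mem_side.1 hu).1 h.ne_right tx.symm tb.symm wx wb wt ?_ (mem_side.1 hu).2.2
      (hzero pu t ta tx hty)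
    rw [← mem_pts, pu]
    simp
  exact hne (hF.eq_of_pts (mem_side.1 hu.1).1 (mem_side.1 hu'.1).1 (pu.trans pu'.symm)
    h.ne_left.symm (mem_side.1 hu.1).2.1 (by rw [← mem_pts, pu]; simp) (e1.trans e2.symm)
    ((m hu.1 pu).trans (m hu'.1 pu').symm))

/-- At most four members meet the pair `a, b` in a single point. -/
theorem card_sides_le (hF : SignedTriples F) (hT : Tame F) (h : Doubled F a b x) :
    #(side F a b) + #(side F b a) ≤ 4 := by
  have h1 := card_le_card_add_card_filter (fun u hu => h.exists_tip hF hu)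
    fun y hy => h.card_tip_le hF hT hy
  have h2 := card_le_card_add_card_filter (fun u hu => h.symm.exists_tip hF hu)
    fun y hy => h.symm.card_tip_le hF hT hy
  have h3 := card_add_card_le_four h.card_tips_le h.symm.card_tips_le
    (filter_subset (fun y => 2 ≤ #{u ∈ side F a b | u y ≠ 0}) (tips F a b x))
    (filter_subset (fun y => 2 ≤ #{u ∈ side F b a | u y ≠ 0}) (tips F b a x))
    (fun y hy => h.tips_subset hF (mem_filter.1 hy).1 (mem_filter.1 hy).2)
    (fun y hy => h.symm.tips_subset hF (mem_filter.1 hy).1 (mem_filter.1 hy).2)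
  omega

theorem spine_pts (hF : SignedTriples F) (hab : a ≠ b) {u : ι → ℤ} (hu : u ∈ spine F a b) {j : ι}
    (ja : j ≠ a) (jb : j ≠ b) (uj : u j ≠ 0) : pts u = {a, b, j} :=
  hF.pts_eq (mem_spine.1 hu).1 hab ja.symm jb.symm (mem_spine.1 hu).2.1 (mem_spine.1 hu).2.2 uj

theorem four_le_card_signedLeaves (hΩ : Uses F Ω) (h : Big F a b) :
    4 ≤ #(signedLeaves F Ω a b) := by
  refine h.2.trans ((card_le_card fun j hj => ?_).trans (card_image_le (f := Prod.fst)))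
  obtain ⟨ja, jb, u, hu, ua, ub, uj⟩ := mem_leaves.1 hj
  exact mem_image.2 ⟨(j, u j), mem_signedLeaves.2 ⟨hΩ.mem u hu j uj, ja, jb, u,
    mem_spine.2 ⟨hu, ua, ub⟩, rfl⟩, rfl⟩

theorem card_signedLeaf_le (hF : SignedTriples F) (hT : Tame F) (hΩ : Uses F Ω) (hab : a ≠ b)
    {h : ι × ℤ} (hh : h ∈ signedLeaves F Ω a b) : #{u ∈ spine F a b | u h.1 = h.2} ≤ 2 := by
  obtain ⟨h0, ha, hb, -⟩ := mem_signedLeaves.1 hh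
  have h0 := sign_ne_zero hΩ h0
  by_contra! hc
  obtain ⟨u, v, w, hu, hv, hw, huv, huw, hvw⟩ := two_lt_card_iff.1 hc
  simp only [mem_filter] at hu hv hw
  have pu := spine_pts hF hab hu.1 ha hb (hu.2 ▸ h0)
  have pv := spine_pts hF hab hv.1 ha hb (hv.2 ▸ h0)
  have pw := spine_pts hF hab hw.1 ha hb (hw.2 ▸ h0)
  rcases hT.two u (mem_spine.1 hu.1).1 v (mem_spine.1 hv.1).1 w (mem_spine.1 hw.1).1
    (by rw [pu, pv]) (by rw [pu, pw]) with h | h | h <;> contradiction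

/-- Each signed leaf belongs to at most two vectors containing `a` and `b`. -/
theorem card_spine_le (hF : SignedTriples F) (hT : Tame F) (hΩ : Uses F Ω) (hab : a ≠ b) :
    #(spine F a b) ≤ 2 * #(signedLeaves F Ω a b) := by
  have h1 := card_le_card_add_card_filter (fun u hu => exists_signedLeaf hF hΩ hu)
    fun h hh => card_signedLeaf_le hF hT hΩ hab hh
  have h2 := card_filter_le (signedLeaves F Ω a b)
    (fun h => 2 ≤ #{u ∈ spine F a b | u h.1 = h.2})
  omega

/-- If some member contains `a` but not `b`, most signed leaves belong to a single vector
containing `a` and `b`. -/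
theorem card_spine_le_of_side (hF : SignedTriples F) (hT : Tame F) (hΩ : Uses F Ω)
    (hab : a ≠ b) (h : (side F a b).Nonempty) :
    #(spine F a b) ≤ #(signedLeaves F Ω a b) + 2 := by
  refine (card_le_card_add_card_filter (fun u hu => exists_signedLeaf hF hΩ hu)
    fun h hh => card_signedLeaf_le hF hT hΩ hab hh).trans (Nat.add_le_add_left ?_ _)
  obtain ⟨u, hu⟩ := h
  obtain ⟨x, y, xa, ya, hxy, ux, uy⟩ := hF.two_others (mem_side.1 hu).1 a
  -- a doubled signed leaf lies over `x` or `y`, with one sign over each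
  have h1 : ∀ h ∈ {h ∈ signedLeaves F Ω a b | 2 ≤ #{u ∈ spine F a b | u h.1 = h.2}},
      h.1 ∈ ({x, y} : Finset ι) := by
    intro h hh
    obtain ⟨hh, hc⟩ := mem_filter.1 hh
    obtain ⟨h0, ha, hb, -⟩ := mem_signedLeaves.1 hh
    have h0 := sign_ne_zero hΩ h0
    by_contra hxy'
    simp only [mem_insert, mem_singleton, not_or] at hxy'
    obtain ⟨v, hv, w, hw, hvw⟩ := one_lt_card.1 hc
    simp only [mem_filter] at hv hw
    have uh := hF.zero_of_ne (mem_side.1 hu).1 xa.symm ya.symm hxy (mem_side.1 hu).2.1 ux uy ha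
      hxy'.1 hxy'.2
    have e1 := entry_eq hF (mem_spine.1 hv.1).1 hab ha hb (mem_spine.1 hv.1).2.1
      (mem_spine.1 hv.1).2.2 (hv.2 ▸ h0) hu uh
    have e2 := entry_eq hF (mem_spine.1 hw.1).1 hab ha hb (mem_spine.1 hw.1).2.1
      (mem_spine.1 hw.1).2.2 (hw.2 ▸ h0) hu uh
    exact hvw (hF.eq_of_pts (mem_spine.1 hv.1).1 (mem_spine.1 hw.1).1
      ((spine_pts hF hab hv.1 ha hb (hv.2 ▸ h0)).trans
        (spine_pts hF hab hw.1 ha hb (hw.2 ▸ h0)).symm)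
      ha.symm (mem_spine.1 hv.1).2.1 (hv.2 ▸ h0) (by omega) (by rw [hv.2, hw.2]))
  refine (card_le_card_of_injOn Prod.fst h1 ?_).trans card_le_two
  rintro h hh k hk hhk
  obtain ⟨hh, hc⟩ := mem_filter.1 hh
  obtain ⟨hk, hd⟩ := mem_filter.1 hk
  obtain ⟨h0, ha, hb, -⟩ := mem_signedLeaves.1 hh
  obtain ⟨k0, -, -, w, hw, hwk⟩ := mem_signedLeaves.1 hk
  have h0 := sign_ne_zero hΩ h0
  have k0 := sign_ne_zero hΩ k0
  obtain ⟨v, hv, v', hv', hvv⟩ := one_lt_card.1 hc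
  simp only [mem_filter] at hv hv'
  have pv := spine_pts hF hab hv.1 ha hb (hv.2 ▸ h0)
  have pv' := spine_pts hF hab hv'.1 ha hb (hv'.2 ▸ h0)
  have pw := spine_pts hF hab hw ha hb (hhk ▸ hwk ▸ k0)
  refine Prod.ext hhk ?_
  rcases hT.two v (mem_spine.1 hv.1).1 v' (mem_spine.1 hv'.1).1 w (mem_spine.1 hw).1
    (by rw [pv, pv']) (by rw [pv, pw]) with h | h | h
  · exact absurd h hvv
  · rw [← hv.2, ← hwk, ← hhk, h]
  · rw [← hv'.2, ← hwk, ← hhk, h]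

/-- A doubled pair splits `Ω` into the four signed points at `a, b`, the signed leaves and the rest.
-/
theorem card_signed_eq (hF : SignedTriples F) (hΩ : Uses F Ω) (h : Doubled F a b x) :
    4 + #(signedLeaves F Ω a b) + #(restPts F Ω a b) = #Ω := by
  have h1 := h.both hF hΩ
  have h2 := h.symm.both hF hΩ
  have hab := h.big.1
  have e1 : {h ∈ Ω | h.1 = a ∨ h.1 = b} = {(a, 1), (a, -1), (b, 1), (b, -1)} := by
    ext ⟨q, s⟩
    simp only [mem_filter, mem_insert, mem_singleton, Prod.mk.injEq]
    constructor
    · rintro ⟨h3, h4⟩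
      have := hΩ.sign _ h3
      simp only at this
      tauto
    · rintro (⟨rfl, rfl⟩ | ⟨rfl, rfl⟩ | ⟨rfl, rfl⟩ | ⟨rfl, rfl⟩) <;> simp_all
  have e2 := card_filter_add_card_filter_not (s := Ω) (fun h => h.1 = a ∨ h.1 = b)
  have e3 := card_filter_add_card_filter_not (s := {h ∈ Ω | ¬ (h.1 = a ∨ h.1 = b)})
    (fun h => h ∈ signedLeaves F Ω a b)
  have e4 : {h ∈ {h ∈ Ω | ¬ (h.1 = a ∨ h.1 = b)} | h ∈ signedLeaves F Ω a b} =
      signedLeaves F Ω a b := by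
    ext h
    simp only [mem_filter, mem_signedLeaves]
    tauto
  have e5 : {h ∈ {h ∈ Ω | ¬ (h.1 = a ∨ h.1 = b)} | h ∉ signedLeaves F Ω a b} =
      restPts F Ω a b := by
    ext h
    simp only [mem_filter, restPts]
    tauto
  rw [e4, e5] at e3
  rw [e1, card_insert_of_notMem (by simp [hab]), card_insert_of_notMem (by simp [hab]),
    card_insert_of_notMem (by simp), card_singleton] at e2
  omega

end Doubled

open Doubled in
/-- A tame family with a big pair, on the set `Ω` of signed points, has at most `2 * #Ω - 6`
members, and at most `2 * #Ω - 8` if `Ω` is balanced. -/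
theorem Tame.card_add_le (hF : SignedTriples F) (hT : Tame F) (hΩ : Uses F Ω) {a b : ι}
    (hab : Big F a b) : #F + 6 ≤ 2 * #Ω ∧ (Balanced Ω → #F + 8 ≤ 2 * #Ω) := by
  induction hn : #F using Nat.strong_induction_on generalizing F Ω a b with
  | _ n ih =>
  subst hn
  by_cases hD : NoDouble F
  · have h1 := sum_slack_of_noDouble hF hT hD hΩ hab
    have h2 := five_mul_card_add_slack_le hF hT hΩ
    refine ⟨by omega, fun h => ?_⟩
    have := h1.2 h
    omega
  clear hab
  simp only [NoDouble, not_forall] at hD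
  obtain ⟨a, b, x, hab, hax, hbx, v, hv, w, hw, va, vb, vx, xa, xb, hp, e, hne⟩ := hD
  have h : Doubled F a b x := ⟨hab, hax, hbx, xa, xb, v, hv, w, hw, va, vb, vx, hp, e, hne⟩
  have c1 := h.card_signed_eq hF hΩ
  have c2 := h.card_sides_le hF hT
  have c3 := card_spine_le hF hT hΩ hab.1
  have c4 := four_le_card_signedLeaves hΩ hab
  have c5 := card_eq_add (F := F) (a := a) (b := b)
  have c6 : 0 < #(side F a b) + #(side F b a) →
      #(spine F a b) ≤ #(signedLeaves F Ω a b) + 2 := by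
    intro h0
    rcases (side F a b).eq_empty_or_nonempty with h1 | h1
    · rcases (side F b a).eq_empty_or_nonempty with h2 | h2
      · simp [h1, h2] at h0
      · have e1 := card_spine_le_of_side hF hT hΩ hab.1.symm h2
        have e2 : spine F b a = spine F a b := by simp only [spine, and_comm]
        have e3 : signedLeaves F Ω b a = signedLeaves F Ω a b := by
          ext h
          simp only [mem_signedLeaves, e2]
          tauto
        rwa [e2, e3] at e1
    · exact card_spine_le_of_side hF hT hΩ hab.1 h1
  have hsub : rest F a b ⊆ F := filter_subset _ _
  have hF' := hF.mono hsub
  have hT' := hT.mono hsub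
  have hΩ' := uses_rest hF hΩ hab.1
  -- the members avoiding `a, b` form a tame family on the remaining signed points
  have c7 : #(rest F a b) + 6 ≤ 2 * #(restPts F Ω a b) ∨
      5 * #(rest F a b) ≤ 6 * #(restPts F Ω a b) := by
    by_cases hB : ∃ c d, Big (rest F a b) c d
    · obtain ⟨c, d, hcd⟩ := hB
      have hlt : #(rest F a b) < #F :=
        card_lt_card ⟨hsub, fun h => va (mem_rest.1 (h hv)).2.1⟩
      exact Or.inl (ih _ hlt hF' hT' hΩ' hcd rfl).1
    · push Not at hB
      exact Or.inr (five_mul_card_le hF' hT' hΩ' hB)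
  refine ⟨by omega, ?_⟩
  rintro (hfull | hone)
  · -- there are at least six points, used with both signs
    have c8 : 12 ≤ #Ω := by
      have h1 : (insert a (insert b (leaves F a b))).product {1, -1} ⊆ Ω := by
        rintro ⟨p, s⟩ hps
        obtain ⟨hp, hs⟩ := mem_product.1 hps
        have h2 : (p, 1) ∈ Ω ∧ (p, -1) ∈ Ω := by
          simp only [mem_insert, mem_leaves] at hp
          rcases hp with rfl | rfl | ⟨-, -, u, hu, -, -, up⟩
          · exact h.both hF hΩ
          · exact h.symm.both hF hΩ
          · exact both_of_full hΩ hfull (hΩ.mem u hu p up)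
        simp only [mem_insert, mem_singleton] at hs
        rcases hs with rfl | rfl
        exacts [h2.1, h2.2]
      have h2 := card_le_card h1
      have h3 := hab.2
      rw [product_eq_sprod, card_product, card_insert_of_notMem (by simp [mem_leaves, hab.1]),
        card_insert_of_notMem (by simp [mem_leaves]), card_pair (by omega)] at h2
      omega
    omega
  · have := h.both hF hΩ
    exact absurd this.2 (hone _ this.1)

end

section

/-! ### Counting the vectors at a hub -/

variable {ι : Type*} {F : Finset (ι → ℤ)}

theorem sum_fin_three (f : Fin 3 → ℕ) {i j k : Fin 3} (hij : i ≠ j) (hik : i ≠ k) (hjk : j ≠ k) :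
    ∑ e, f e = f i + f j + f k := by
  rw [Fin.sum_univ_three]
  fin_cases i <;> fin_cases j <;> fin_cases k <;> simp_all <;> omega

theorem exists_third (i j : Fin 3) (hij : i ≠ j) : ∃ k, i ≠ k ∧ j ≠ k := by
  revert i j
  decide

theorem exists_two_others (i : Fin 3) : ∃ j k, i ≠ j ∧ i ≠ k ∧ j ≠ k := by
  revert i
  decide

/-- The counting problem behind the bound for a hub. Here `n w e` is the number of vectors formed
by a leaf `w` and the two hub points other than the one labelled `e`, and `g w` is the number of
signs used at `w`; the presence of other kinds of vectors at other leaves restricts `n w e`. -/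
theorem sum_leaves_le {W : Finset ι} (hW : 2 ≤ #W) {n : ι → Fin 3 → ℕ} {g : ι → ℕ}
    (hg : ∀ w ∈ W, g w = 1 ∨ g w = 2) (h1 : ∀ w ∈ W, ∀ e, n w e ≤ 2 * g w)
    (h2 : ∀ w ∈ W, ∀ e, ∀ w' ∈ W, ∀ e', w' ≠ w → e' ≠ e → 0 < n w' e' → n w e ≤ g w)
    (h3 : ∀ w ∈ W, ∀ e, ∀ w' ∈ W, ∀ e', ∀ w'' ∈ W, ∀ e'', w' ≠ w → w'' ≠ w → e' ≠ e → e'' ≠ e →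
      e' ≠ e'' → 0 < n w' e' → 0 < n w'' e'' → n w e ≤ 1)
    (h4 : ∀ w ∈ W, ∃ e, 0 < n w e) :
    (∑ w ∈ W, ∑ e, n w e : ℤ) ≤ 2 * #{w ∈ W | g w = 1} + 4 * #{w ∈ W | g w = 2} +
      max (#{w ∈ W | g w = 1} : ℤ) (6 - #{w ∈ W | g w = 1} - 2 * #{w ∈ W | g w = 2}) := by
  set A := #{w ∈ W | g w = 1} with hA
  set B := #{w ∈ W | g w = 2} with hB
  have hAB : A + B = #W := by
    rw [hA, hB, ← card_filter_add_card_filter_not (s := W) (fun w => g w = 1)]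
    congr 2
    exact filter_congr fun w hw => by have := hg w hw; omega
  have hG : ∑ w ∈ W, g w = A + 2 * B := by
    rw [hA, hB, card_filter, card_filter, mul_sum, ← sum_add_distrib]
    refine sum_congr rfl fun w hw => ?_
    rcases hg w hw with h | h <;> simp [h]
  -- `O w e` means that the label `e` occurs at a leaf other than `w`
  let O : ι → Fin 3 → Prop := fun w e => ∃ w' ∈ W, w' ≠ w ∧ 0 < n w' e
  have o2 : ∀ w ∈ W, ∀ e e', O w e' → e' ≠ e → n w e ≤ g w := by
    rintro w hw e e' ⟨w', hw', hne, hn⟩ he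
    exact h2 w hw e w' hw' e' hne he hn
  have o3 : ∀ w ∈ W, ∀ e e' e'', O w e' → O w e'' → e' ≠ e → e'' ≠ e → e' ≠ e'' → n w e ≤ 1 := by
    rintro w hw e e' e'' ⟨w', hw', hne, hn⟩ ⟨w'', hw'', hne', hn'⟩ he he' hee
    exact h3 w hw e w' hw' e' w'' hw'' e'' hne hne' he he' hee hn hn'
  by_cases hI : ∃ w ∈ W, ∀ e e', O w e → O w e' → e = e'
  · -- all other leaves carry the same single label `e`
    obtain ⟨w, hw, hO⟩ := hI
    obtain ⟨u, hu, huw⟩ := exists_mem_ne (s := W) (by omega) w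
    obtain ⟨e, he⟩ := h4 u hu
    have hOe : O w e := ⟨u, hu, huw, he⟩
    have hz : ∀ w' ∈ W, w' ≠ w → ∀ e', e' ≠ e → n w' e' = 0 := by
      intro w' hw' hne e' he'
      by_contra h
      exact he' (hO e' e ⟨w', hw', hne, Nat.pos_of_ne_zero h⟩ hOe)
    obtain ⟨i, j, hei, hej, hij⟩ := exists_two_others e
    have hs : ∀ w', ∑ e, n w' e = n w' e + n w' i + n w' j := fun w' =>
      sum_fin_three _ hei hej hij
    by_cases hsame : n w i = 0 ∧ n w j = 0
    · have : ∑ w ∈ W, ∑ e, n w e ≤ 2 * ∑ w ∈ W, g w := by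
        rw [mul_sum]
        refine sum_le_sum fun w' hw' => ?_
        rw [hs]
        have e1 := h1 w' hw' e
        by_cases hww : w' = w
        · subst hww
          omega
        · have e2 := hz w' hw' hww i hei.symm
          have e3 := hz w' hw' hww j hej.symm
          omega
      zify at this hG
      omega
    · have hw4 : ∑ e, n w e ≤ 4 * g w := by
        rw [hs]
        have e1 := h1 w hw e
        have e2 := o2 w hw i e hOe hei
        have e3 := o2 w hw j e hOe hej
        omega
      have hrest : ∑ w' ∈ W.erase w, ∑ e, n w' e ≤ ∑ w' ∈ W.erase w, g w' := by
        refine sum_le_sum fun w' hw' => ?_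
        obtain ⟨hne, hw'⟩ := mem_erase.1 hw'
        rw [hs]
        have e2 := hz w' hw' hne i hei.symm
        have e3 := hz w' hw' hne j hej.symm
        have e4 : n w' e ≤ g w' := by
          by_cases hi : n w i = 0
          · exact o2 w' hw' e j ⟨w, hw, hne.symm, by omega⟩ hej.symm
          · exact o2 w' hw' e i ⟨w, hw, hne.symm, by omega⟩ hei.symm
        omega
      have t1 := add_sum_erase W (fun w => ∑ e, n w e) hw
      have t2 := add_sum_erase W g hw
      have t3 := hg w hw
      have t4 : ∑ w ∈ W, ∑ e, n w e ≤ 6 + (A + 2 * B) := by omega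
      zify at t4
      omega
  · push Not at hI
    have hex : ∀ w ∈ W, ∃ i j k, i ≠ j ∧ i ≠ k ∧ j ≠ k ∧ O w i ∧ O w j ∧ n w i ≤ g w ∧
        n w j ≤ g w ∧ n w k ≤ 1 := by
      intro w hw
      obtain ⟨i, j, hi, hj, hij⟩ := hI w hw
      obtain ⟨k, hik, hjk⟩ := exists_third i j hij
      exact ⟨i, j, k, hij, hik, hjk, hi, hj, o2 w hw i j hj hij.symm, o2 w hw j i hi hij,
        o3 w hw k i j hi hj hik hjk hij⟩
    -- a two-signed leaf with at least five vectors carries all three labels, so other leaves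
    -- have at most `2`
    by_cases hII : ∃ w ∈ W, g w = 2 ∧ 5 ≤ ∑ e, n w e
    · obtain ⟨w, hw, hgw, h5⟩ := hII
      obtain ⟨i, j, k, hij, hik, hjk, hi, hj, ni, nj, nk⟩ := hex w hw
      rw [sum_fin_three _ hij hik hjk] at h5
      have hrest : ∑ w' ∈ W.erase w, ∑ e, n w' e ≤ ∑ w' ∈ W.erase w, 2 := by
        refine sum_le_sum fun w' hw' => ?_
        obtain ⟨hne, hw'⟩ := mem_erase.1 hw'
        rw [sum_fin_three _ hij hik hjk]
        have oi : O w' i := ⟨w, hw, hne.symm, by omega⟩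
        have oj : O w' j := ⟨w, hw, hne.symm, by omega⟩
        have ok : O w' k := ⟨w, hw, hne.symm, by omega⟩
        have e1 := o3 w' hw' i j k oj ok hij.symm hik.symm hjk
        have e2 := o3 w' hw' j i k oi ok hij hjk.symm hik
        have e3 : n w' k = 0 := by
          by_contra h
          have := o3 w hw i j k hj ⟨w', hw', hne, by omega⟩ hij.symm hik.symm hjk
          omega
        omega
      have t1 := add_sum_erase W (fun w => ∑ e, n w e) hw
      rw [sum_const, card_erase_of_mem hw, smul_eq_mul] at hrest
      have hBpos : 0 < B := card_pos.2 ⟨w, mem_filter.2 ⟨hw, hgw⟩⟩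
      rw [sum_fin_three _ hij hik hjk] at t1
      have t4 : ∑ w ∈ W, ∑ e, n w e ≤ 3 + 2 * (A + B) := by omega
      zify at t4
      omega
    · push Not at hII
      have : ∑ w ∈ W, ∑ e, n w e ≤ ∑ w ∈ W, (2 * g w + if g w = 1 then 1 else 0) := by
        refine sum_le_sum fun w hw => ?_
        obtain ⟨i, j, k, hij, hik, hjk, hi, hj, ni, nj, nk⟩ := hex w hw
        rcases hg w hw with h | h
        · rw [sum_fin_three _ hij hik hjk, if_pos h]
          omega
        · have := hII w hw h
          rw [if_neg (by omega)]
          omega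
      rw [sum_add_distrib, ← mul_sum, hG, ← card_filter, ← hA] at this
      zify at this
      omega

/-- A hub: three points such that no member of `F` contains exactly one of them, and each of them
is used with both signs. -/
structure Hub (F : Finset (ι → ℤ)) (t : Fin 3 → ι) : Prop where
  inj : Function.Injective t
  two : ∀ v ∈ F, ∀ i, v (t i) ≠ 0 → ∃ j, j ≠ i ∧ v (t j) ≠ 0
  pos : ∀ i, ∃ v ∈ F, v (t i) = 1
  neg : ∀ i, ∃ v ∈ F, v (t i) = -1

/-- The members of `F` meeting the hub. -/
noncomputable def hubVecs (F : Finset (ι → ℤ)) (t : Fin 3 → ι) : Finset (ι → ℤ) :=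
  {v ∈ F | ∃ i, v (t i) ≠ 0}

theorem mem_hubVecs {t : Fin 3 → ι} {v : ι → ℤ} : v ∈ hubVecs F t ↔ v ∈ F ∧ ∃ i, v (t i) ≠ 0 := by
  simp [hubVecs]

/-- The signs used at the point `w` by vectors meeting the hub. -/
noncomputable def hubSigns (F : Finset (ι → ℤ)) (t : Fin 3 → ι) (w : ι) : Finset ℤ :=
  {v ∈ hubVecs F t | v w ≠ 0}.image fun v => v w

theorem mem_hubSigns {t : Fin 3 → ι} {w : ι} {s : ℤ} :
    s ∈ hubSigns F t w ↔ s ≠ 0 ∧ ∃ v ∈ hubVecs F t, v w = s := by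
  simp only [hubSigns, mem_image, mem_filter]
  constructor
  · rintro ⟨v, ⟨hv, hw⟩, rfl⟩
    exact ⟨hw, v, hv, rfl⟩
  · rintro ⟨hs, v, hv, rfl⟩
    exact ⟨v, ⟨hv, hs⟩, rfl⟩

theorem card_hubSigns_le (hF : SignedTriples F) (t : Fin 3 → ι) (w : ι) :
    #(hubSigns F t w) ≤ 2 := by
  refine (card_le_card fun s hs => ?_).trans (card_le_two (a := (1 : ℤ)) (b := -1))
  obtain ⟨hs, v, hv, rfl⟩ := mem_hubSigns.1 hs
  simpa using hF.sign v (mem_hubVecs.1 hv).1 w hs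

/-- The vectors through `w` and the two points of the hub other than `t e`. -/
noncomputable def leafVecs (F : Finset (ι → ℤ)) (t : Fin 3 → ι) (w : ι) (e : Fin 3) :
    Finset (ι → ℤ) :=
  {v ∈ F | v w ≠ 0 ∧ ∀ i, v (t i) ≠ 0 ↔ i ≠ e}

theorem mem_leafVecs {t : Fin 3 → ι} {w : ι} {e : Fin 3} {v : ι → ℤ} :
    v ∈ leafVecs F t w e ↔ v ∈ F ∧ v w ≠ 0 ∧ ∀ i, v (t i) ≠ 0 ↔ i ≠ e := by simp [leafVecs]

theorem leafVecs_mem_hubSigns {t : Fin 3 → ι} {w : ι} {e : Fin 3} {v : ι → ℤ}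
    (hv : v ∈ leafVecs F t w e) : v w ∈ hubSigns F t w := by
  obtain ⟨hv, hw, h⟩ := mem_leafVecs.1 hv
  obtain ⟨i, -, hi, -, -⟩ := exists_two_others e
  exact mem_hubSigns.2 ⟨hw, v, mem_hubVecs.2 ⟨hv, i, (h i).2 hi.symm⟩, rfl⟩

/-- Vectors with the same leaf and the same two hub points which agree at two points are equal. -/
theorem leafVecs_eq (hF : SignedTriples F) {t : Fin 3 → ι} (ht : t.Injective) {w : ι}
    (hw : ∀ i, w ≠ t i) {e i j : Fin 3} (hi : i ≠ e) (hj : j ≠ e) (hij : i ≠ j) {v v' : ι → ℤ}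
    (hv : v ∈ leafVecs F t w e) (hv' : v' ∈ leafVecs F t w e) (h1 : v (t i) = v' (t i))
    (h2 : v w = v' w ∨ v (t j) = v' (t j)) : v = v' := by
  obtain ⟨hv, vw, h⟩ := mem_leafVecs.1 hv
  obtain ⟨hv', vw', h'⟩ := mem_leafVecs.1 hv'
  rcases h2 with h2 | h2
  · exact hF.eq_of_two hv hv' (hw i).symm (ht.ne hij) (hw j) ((h i).2 hi) vw ((h j).2 hj)
      ((h' j).2 hj) h1 h2
  · exact hF.eq_of_two hv hv' (ht.ne hij) (hw i).symm (hw j).symm ((h i).2 hi) ((h j).2 hj) vw vw'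
      h1 h2

theorem card_leafVecs_le (hF : SignedTriples F) {t : Fin 3 → ι} (ht : t.Injective) {w : ι}
    (hw : ∀ i, w ≠ t i) (e : Fin 3) : #(leafVecs F t w e) ≤ 2 * #(hubSigns F t w) := by
  obtain ⟨i, j, hi, hj, hij⟩ := exists_two_others e
  have h := card_le_card_of_injOn (s := leafVecs F t w e)
    (t := ({1, -1} : Finset ℤ) ×ˢ hubSigns F t w) (fun v => (v (t i), v w))
    (fun v hv => by
      obtain ⟨hvF, vw, h⟩ := mem_leafVecs.1 hv
      simp only [coe_product, Set.mem_prod, mem_coe]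
      exact ⟨by simpa using hF.sign v hvF (t i) ((h i).2 hi.symm), leafVecs_mem_hubSigns hv⟩)
    (fun v hv v' hv' h => by
      simp only [Prod.mk.injEq] at h
      exact leafVecs_eq hF ht hw hi.symm hj.symm hij hv hv' h.1 (Or.inl h.2))
  rwa [card_product, card_pair (by omega)] at h

/-- Vectors with different leaves sharing a single hub point have opposite entries there. -/
theorem leafVecs_neg (hF : SignedTriples F) {t : Fin 3 → ι} (ht : t.Injective) {w w' : ι}
    (hw : ∀ i, w ≠ t i) (hw' : ∀ i, w' ≠ t i) (hww : w' ≠ w) {e e' i : Fin 3} (he : e' ≠ e)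
    (hi : i ≠ e) (hi' : i ≠ e') {v v' : ι → ℤ} (hv : v ∈ leafVecs F t w e)
    (hv' : v' ∈ leafVecs F t w' e') : v (t i) = - v' (t i) := by
  obtain ⟨hv, vw, h⟩ := mem_leafVecs.1 hv
  obtain ⟨hv', vw', h'⟩ := mem_leafVecs.1 hv'
  refine hF.opp hv' hv (ht.ne hi) (hw' i).symm (hw' e).symm ((h' i).2 hi') ((h' e).2 he.symm) vw'
    ((h i).2 hi) ?_ ?_
  · by_contra h0
    exact (h e).1 h0 rfl
  · exact hF.zero_of_ne hv (ht.ne (hi'.symm)) (hw e').symm (hw i).symm ((h e').2 he) ((h i).2 hi) vw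
      (hw' e') (hw' i) hww

/-- A vector through another leaf `w'` and another pair of hub points prescribes the entry at the
common hub point, so that the sign at `w` determines the vector. -/
theorem card_leafVecs_le_card_hubSigns (hF : SignedTriples F) {t : Fin 3 → ι} (ht : t.Injective)
    {w w' : ι} (hw : ∀ i, w ≠ t i) (hw' : ∀ i, w' ≠ t i) (hww : w' ≠ w) {e e' : Fin 3} (he : e' ≠ e)
    (hne : 0 < #(leafVecs F t w' e')) : #(leafVecs F t w e) ≤ #(hubSigns F t w) := by
  obtain ⟨i, hi', hi⟩ := exists_third e' e he
  obtain ⟨u, hu⟩ := card_pos.1 hne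
  refine card_le_card_of_injOn (fun v => v w) (fun v hv => leafVecs_mem_hubSigns hv)
    fun v hv v' hv' h => ?_
  refine leafVecs_eq hF ht hw hi.symm he hi'.symm hv hv' ?_ (Or.inl h)
  rw [leafVecs_neg hF ht hw hw' hww he hi.symm hi'.symm hv hu,
    leafVecs_neg hF ht hw hw' hww he hi.symm hi'.symm hv' hu]

/-- Vectors of both other kinds at leaves other than `w` prescribe both entries at the hub. -/
theorem card_leafVecs_le_one_of_two (hF : SignedTriples F) {t : Fin 3 → ι} (ht : t.Injective)
    {w w' w'' : ι} (hw : ∀ i, w ≠ t i) (hw' : ∀ i, w' ≠ t i) (hw'' : ∀ i, w'' ≠ t i) (hww : w' ≠ w)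
    (hww' : w'' ≠ w) {e e' e'' : Fin 3} (he : e' ≠ e) (he' : e'' ≠ e) (hee : e' ≠ e'')
    (hne : 0 < #(leafVecs F t w' e')) (hne' : 0 < #(leafVecs F t w'' e'')) :
    #(leafVecs F t w e) ≤ 1 := by
  obtain ⟨u, hu⟩ := card_pos.1 hne
  obtain ⟨u', hu'⟩ := card_pos.1 hne'
  refine card_le_one.2 fun v hv v' hv' => ?_
  refine leafVecs_eq hF ht hw he' he hee.symm hv hv' ?_ (Or.inr ?_)
  · rw [leafVecs_neg hF ht hw hw' hww he he' hee.symm hv hu,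
      leafVecs_neg hF ht hw hw' hww he he' hee.symm hv' hu]
  · rw [leafVecs_neg hF ht hw hw'' hww' he' he hee hv hu',
      leafVecs_neg hF ht hw hw'' hww' he' he hee hv' hu']

theorem Hub.mem_leafVecs (hF : SignedTriples F) {t : Fin 3 → ι} (ht : Hub F t) {v : ι → ℤ}
    (hv : v ∈ hubVecs F t) {w : ι} (hw : ∀ i, w ≠ t i) (hvw : v w ≠ 0) :
    ∃ e, v ∈ leafVecs F t w e := by
  obtain ⟨hv, i, hi⟩ := mem_hubVecs.1 hv
  obtain ⟨j, hji, hj⟩ := ht.two v hv i hi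
  obtain ⟨e, hie, hje⟩ := exists_third i j hji.symm
  refine ⟨e, TernaryTriples.mem_leafVecs.2 ⟨hv, hvw, fun k => ?_⟩⟩
  have hz := hF.zero_of_ne hv (ht.inj.ne hji.symm) (hw i).symm (hw j).symm hi hj hvw
    (ht.inj.ne hie.symm) (ht.inj.ne hje.symm) (hw e).symm
  constructor
  · rintro h rfl
    exact h hz
  · intro h
    have : k = i ∨ k = j := by omega
    rcases this with rfl | rfl <;> assumption

/-- At most four vectors have a given support, as they are determined by two of their entries. -/
theorem card_core_le (hF : SignedTriples F) {t : Fin 3 → ι} (ht : t.Injective) :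
    #{v ∈ F | ∀ i, v (t i) ≠ 0} ≤ 4 := by
  refine (card_le_card_of_injOn (t := ({1, -1} : Finset ℤ) ×ˢ ({1, -1} : Finset ℤ))
    (fun v => (v (t 0), v (t 1))) (fun v hv => ?_) (fun v hv v' hv' h => ?_)).trans (by simp)
  · obtain ⟨hv, h⟩ := mem_filter.1 (mem_coe.1 hv)
    simpa using ⟨hF.sign v hv (t 0) (h 0), hF.sign v hv (t 1) (h 1)⟩
  · obtain ⟨hv, h1⟩ := mem_filter.1 (mem_coe.1 hv)
    obtain ⟨hv', h2⟩ := mem_filter.1 (mem_coe.1 hv')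
    simp only [Prod.mk.injEq] at h
    exact hF.eq_of_two hv hv' (ht.ne (by decide : (0 : Fin 3) ≠ 1))
      (ht.ne (by decide : (0 : Fin 3) ≠ 2)) (ht.ne (by decide : (1 : Fin 3) ≠ 2)) (h1 0) (h1 1)
      (h1 2) (h2 2) h.1 h.2

variable [Fintype ι]

/-- The points outside the hub which are used by vectors meeting the hub. -/
noncomputable def hubLeaves (F : Finset (ι → ℤ)) (t : Fin 3 → ι) : Finset ι :=
  {w | (∀ i, w ≠ t i) ∧ ∃ v ∈ hubVecs F t, v w ≠ 0}

theorem mem_hubLeaves {t : Fin 3 → ι} {w : ι} :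
    w ∈ hubLeaves F t ↔ (∀ i, w ≠ t i) ∧ ∃ v ∈ hubVecs F t, v w ≠ 0 := by simp [hubLeaves]

theorem Hub.card_le_add (hF : SignedTriples F) {t : Fin 3 → ι} (ht : Hub F t) :
    #(hubVecs F t) ≤ 4 + ∑ w ∈ hubLeaves F t, ∑ e, #(leafVecs F t w e) := by
  have h : hubVecs F t ⊆ {v ∈ F | ∀ i, v (t i) ≠ 0} ∪
      (hubLeaves F t).biUnion fun w => univ.biUnion fun e => leafVecs F t w e := by
    intro v hv
    rw [mem_union]
    by_cases hall : ∀ i, v (t i) ≠ 0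
    · exact Or.inl (mem_filter.2 ⟨(mem_hubVecs.1 hv).1, hall⟩)
    right
    push Not at hall
    obtain ⟨e, he⟩ := hall
    obtain ⟨hvF, i, hi⟩ := mem_hubVecs.1 hv
    obtain ⟨j, hji, hj⟩ := ht.two v hvF i hi
    obtain ⟨w, hwi, hwj, hw⟩ := hF.third hvF (t i) (t j)
    have hwt : ∀ k, w ≠ t k := by
      intro k
      have hie : i ≠ e := by rintro rfl; exact hi he
      have hje : j ≠ e := by rintro rfl; exact hj he
      have : k = i ∨ k = j ∨ k = e := by omega
      rcases this with rfl | rfl | rfl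
      · exact hwi
      · exact hwj
      · rintro rfl
        exact hw he
    obtain ⟨e', he'⟩ := ht.mem_leafVecs hF hv hwt hw
    exact mem_biUnion.2 ⟨w, mem_hubLeaves.2 ⟨hwt, v, hv, hw⟩, mem_biUnion.2 ⟨e', mem_univ _, he'⟩⟩
  refine (card_le_card h).trans ((card_union_le _ _).trans (Nat.add_le_add (card_core_le hF ht.inj)
    (card_biUnion_le.trans (sum_le_sum fun w _ => card_biUnion_le))))

/-- The leaves used with one sign only by the vectors meeting the hub. -/
noncomputable def oneLeaves (F : Finset (ι → ℤ)) (t : Fin 3 → ι) : Finset ι :=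
  {w ∈ hubLeaves F t | #(hubSigns F t w) = 1}

/-- The leaves used with both signs by the vectors meeting the hub. -/
noncomputable def twoLeaves (F : Finset (ι → ℤ)) (t : Fin 3 → ι) : Finset ι :=
  {w ∈ hubLeaves F t | #(hubSigns F t w) = 2}

theorem card_hubSigns (hF : SignedTriples F) {t : Fin 3 → ι} {w : ι} (hw : w ∈ hubLeaves F t) :
    #(hubSigns F t w) = 1 ∨ #(hubSigns F t w) = 2 := by
  have h1 := card_hubSigns_le hF t w
  obtain ⟨-, v, hv, hvw⟩ := mem_hubLeaves.1 hw
  have h2 : 0 < #(hubSigns F t w) := card_pos.2 ⟨v w, mem_hubSigns.2 ⟨hvw, v, hv, rfl⟩⟩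
  omega

theorem card_one_add_card_two (hF : SignedTriples F) (t : Fin 3 → ι) :
    #(oneLeaves F t) + #(twoLeaves F t) = #(hubLeaves F t) := by
  rw [oneLeaves, twoLeaves,
    ← card_filter_add_card_filter_not (s := hubLeaves F t) (fun w => #(hubSigns F t w) = 1)]
  congr 2
  exact filter_congr fun w hw => by have := card_hubSigns hF hw; omega

/-- The number of vectors meeting a hub, in terms of the numbers of its leaves. -/
theorem Hub.card_le (hF : SignedTriples F) {t : Fin 3 → ι} (ht : Hub F t) :
    (#(hubLeaves F t) ≤ 1 → #(hubVecs F t) ≤ 4 + 6 * #(oneLeaves F t) + 12 * #(twoLeaves F t)) ∧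
    (2 ≤ #(hubLeaves F t) → (#(hubVecs F t) : ℤ) ≤ 4 + 2 * #(oneLeaves F t) +
      4 * #(twoLeaves F t) +
      max (#(oneLeaves F t) : ℤ) (6 - #(oneLeaves F t) - 2 * #(twoLeaves F t))) := by
  have h0 := ht.card_le_add hF
  have hW : ∀ w ∈ hubLeaves F t, ∀ i, w ≠ t i := fun w hw => (mem_hubLeaves.1 hw).1
  have h1 : ∀ w ∈ hubLeaves F t, ∀ e, #(leafVecs F t w e) ≤ 2 * #(hubSigns F t w) :=
    fun w hw e => card_leafVecs_le hF ht.inj (hW w hw) e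
  constructor
  · intro hle
    have hs : ∑ w ∈ hubLeaves F t, ∑ e, #(leafVecs F t w e) ≤
        ∑ w ∈ hubLeaves F t, 6 * #(hubSigns F t w) := by
      refine sum_le_sum fun w hw => ?_
      rw [Fin.sum_univ_three]
      have := h1 w hw 0
      have := h1 w hw 1
      have := h1 w hw 2
      omega
    have hG : ∑ w ∈ hubLeaves F t, #(hubSigns F t w) =
        #(oneLeaves F t) + 2 * #(twoLeaves F t) := by
      rw [oneLeaves, twoLeaves, card_filter, card_filter, mul_sum, ← sum_add_distrib]
      refine sum_congr rfl fun w hw => ?_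
      rcases card_hubSigns hF hw with h | h <;> simp [h]
    rw [← mul_sum, hG] at hs
    omega
  · intro hle
    have := sum_leaves_le hle (n := fun w e => #(leafVecs F t w e))
      (g := fun w => #(hubSigns F t w)) (fun w hw => card_hubSigns hF hw) h1
      (fun w hw e w' hw' e' hww hee hn =>
        card_leafVecs_le_card_hubSigns hF ht.inj (hW w hw) (hW w' hw') hww hee hn)
      (fun w hw e w' hw' e' w'' hw'' e'' hww hww' he he' hee hn hn' =>
        card_leafVecs_le_one_of_two hF ht.inj (hW w hw) (hW w' hw') (hW w'' hw'') hww hww' he he'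
          hee hn hn')
      (fun w hw => by
        obtain ⟨hwt, v, hv, hvw⟩ := mem_hubLeaves.1 hw
        obtain ⟨e, he⟩ := ht.mem_leafVecs hF hv hwt hvw
        exact ⟨e, card_pos.2 ⟨v, he⟩⟩)
    zify at h0
    simp only [oneLeaves, twoLeaves]
    omega

end

section

/-! ### Families without hubs are tame -/

variable {ι : Type*} {F : Finset (ι → ℤ)}

/-- Three points form a hub if every member containing one of them contains another one, and each of
them is used with both signs. -/
theorem hub_of_points {a b c : ι} (hab : a ≠ b) (hac : a ≠ c) (hbc : b ≠ c)
    (ha : ∀ v ∈ F, v a ≠ 0 → v b ≠ 0 ∨ v c ≠ 0) (hb : ∀ v ∈ F, v b ≠ 0 → v a ≠ 0 ∨ v c ≠ 0)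
    (hc : ∀ v ∈ F, v c ≠ 0 → v a ≠ 0 ∨ v b ≠ 0)
    (hs : ∀ p, p = a ∨ p = b ∨ p = c → (∃ v ∈ F, v p = 1) ∧ ∃ v ∈ F, v p = -1) :
    Hub F ![a, b, c] where
  inj := by
    intro i j hij
    fin_cases i <;> fin_cases j <;> simp_all
  two := by
    intro v hv i hi
    fin_cases i
    · rcases ha v hv hi with h | h
      exacts [⟨1, by decide, h⟩, ⟨2, by decide, h⟩]
    · rcases hb v hv hi with h | h
      exacts [⟨0, by decide, h⟩, ⟨2, by decide, h⟩]
    · rcases hc v hv hi with h | h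
      exacts [⟨0, by decide, h⟩, ⟨1, by decide, h⟩]
  pos := by
    intro i
    fin_cases i
    exacts [(hs a (by simp)).1, (hs b (by simp)).1, (hs c (by simp)).1]
  neg := by
    intro i
    fin_cases i
    exacts [(hs a (by simp)).2, (hs b (by simp)).2, (hs c (by simp)).2]

theorem SignedTriples.both_of_ne (hF : SignedTriples F) {v w : ι → ℤ} (hv : v ∈ F) (hw : w ∈ F)
    {p : ι} (h1 : v p ≠ 0) (h2 : w p ≠ 0) (h : v p ≠ w p) :
    (∃ v ∈ F, v p = 1) ∧ ∃ v ∈ F, v p = -1 := by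
  have h3 := hF.neg_of_ne hv hw h1 h2 h
  rcases hF.sign v hv p h1 with h4 | h4
  · exact ⟨⟨v, hv, h4⟩, w, hw, by omega⟩
  · exact ⟨⟨w, hw, by omega⟩, v, hv, h4⟩

/-- Both signs occur at the points of a hub. -/
theorem Hub.card_hubSigns_point (hF : SignedTriples F) {t : Fin 3 → ι} (ht : Hub F t) (i : Fin 3) :
    #(hubSigns F t (t i)) = 2 := by
  refine le_antisymm (card_hubSigns_le hF t _) ?_
  rw [← card_pair (by omega : (1 : ℤ) ≠ -1)]
  refine card_le_card ?_
  intro s hs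
  obtain ⟨v, hv, hv1⟩ := ht.pos i
  obtain ⟨w, hw, hw1⟩ := ht.neg i
  rw [mem_insert, mem_singleton] at hs
  rcases hs with rfl | rfl
  · exact mem_hubSigns.2 ⟨by omega, v, mem_hubVecs.2 ⟨hv, i, by omega⟩, hv1⟩
  · exact mem_hubSigns.2 ⟨by omega, w, mem_hubVecs.2 ⟨hw, i, by omega⟩, hw1⟩

/-- A vector meeting a hub has at most one point outside it. -/
theorem Hub.eq_of_leaf (hF : SignedTriples F) {t : Fin 3 → ι} (ht : Hub F t) {v : ι → ℤ}
    (hv : v ∈ hubVecs F t) {p q : ι} (hp : ∀ i, p ≠ t i) (hq : ∀ i, q ≠ t i) (vp : v p ≠ 0)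
    (vq : v q ≠ 0) : p = q := by
  obtain ⟨hv, i, hi⟩ := mem_hubVecs.1 hv
  obtain ⟨j, hji, hj⟩ := ht.two v hv i hi
  have := hF.supp_or hv (ht.inj.ne hji.symm) (hp i).symm (hp j).symm hi hj vp vq
  have := hq i
  have := hq j
  tauto

/-- A vector meeting a hub avoids all hubs disjoint from it. -/
theorem Hub.eq_zero (hF : SignedTriples F) {t t' : Fin 3 → ι} (ht : Hub F t) (ht' : Hub F t')
    (hd : ∀ i j, t i ≠ t' j) {v : ι → ℤ} (hv : v ∈ hubVecs F t) (j : Fin 3) : v (t' j) = 0 := by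
  by_contra h
  obtain ⟨k, hkj, hk⟩ := ht'.two v (mem_hubVecs.1 hv).1 j h
  exact hkj (ht'.inj (ht.eq_of_leaf hF hv (fun i => (hd i k).symm) (fun i => (hd i j).symm) hk h))

/-- A family of pairwise disjoint hubs. -/
structure DisjointHubs (F : Finset (ι → ℤ)) (H : Finset (Fin 3 → ι)) : Prop where
  hub : ∀ t ∈ H, Hub F t
  disj : ∀ t ∈ H, ∀ t' ∈ H, t ≠ t' → ∀ i j, t i ≠ t' j

/-- The members of `F` avoiding all hubs of `H`. -/
noncomputable def outside (F : Finset (ι → ℤ)) (H : Finset (Fin 3 → ι)) : Finset (ι → ℤ) :=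
  {v ∈ F | ∀ t ∈ H, ∀ i, v (t i) = 0}

theorem mem_outside {H : Finset (Fin 3 → ι)} {v : ι → ℤ} :
    v ∈ outside F H ↔ v ∈ F ∧ ∀ t ∈ H, ∀ i, v (t i) = 0 := by simp [outside]

variable [Fintype ι]

/-- A support each of whose points takes both signs among the vectors with that support is a
hub. -/
theorem exists_hub_of_support (hF : SignedTriples F) {v : ι → ℤ} (hv : v ∈ F)
    (h : ∀ p, v p ≠ 0 → ∃ u ∈ F, ∃ w ∈ F, pts u = pts v ∧ pts w = pts v ∧ u p ≠ w p) :
    ∃ t, Hub F t := by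
  obtain ⟨a, b, c, hab, hac, hbc, hs⟩ := hF.three v hv
  have ha : v a ≠ 0 := (hs a).2 (by simp)
  have hb : v b ≠ 0 := (hs b).2 (by simp)
  have hc : v c ≠ 0 := (hs c).2 (by simp)
  have key : ∀ p q r, p ≠ q → p ≠ r → q ≠ r → v p ≠ 0 → v q ≠ 0 → v r ≠ 0 → ∀ z ∈ F, z p ≠ 0 →
      z q ≠ 0 ∨ z r ≠ 0 := by
    intro p q r hpq hpr hqr hp hq hr z hz hzp
    by_contra! hne
    obtain ⟨u, hu, w, hw, pu, pw, huw⟩ := h p hp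
    have e1 := hF.opp hu hz hpq hpr hqr (ne_zero_of_pts pu hp) (ne_zero_of_pts pu hq)
      (ne_zero_of_pts pu hr) hzp hne.1 hne.2
    have e2 := hF.opp hw hz hpq hpr hqr (ne_zero_of_pts pw hp) (ne_zero_of_pts pw hq)
      (ne_zero_of_pts pw hr) hzp hne.1 hne.2
    omega
  refine ⟨_, hub_of_points hab hac hbc (key a b c hab hac hbc ha hb hc)
    (key b a c hab.symm hbc hac hb ha hc) (key c a b hac.symm hbc.symm hab hc ha hb)
    fun p hp => ?_⟩
  have hvp := (hs p).2 hp
  obtain ⟨u, hu, w, hw, pu, pw, huw⟩ := h p hvp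
  exact hF.both_of_ne hu hw (ne_zero_of_pts pu hvp) (ne_zero_of_pts pw hvp) huw

/-- Without hubs a family is tame: two antipodal vectors, three vectors with the same support and a
triangle of big pairs all lead to a hub. -/
theorem tame_of_no_hub (hF : SignedTriples F) (hH : ∀ t, ¬ Hub F t) : Tame F where
  agree := by
    intro v hv w hw hvw
    by_contra! h
    obtain ⟨t, ht⟩ := exists_hub_of_support hF hv fun p hp => ⟨v, hv, w, hw, rfl, hvw.symm, h p hp⟩
    exact hH t ht
  two := by
    intro u hu v hv w hw hvu hwu
    by_contra! hne
    obtain ⟨huv, huw, hvw⟩ := hne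
    obtain ⟨t, ht⟩ := exists_hub_of_support hF hu fun p hp => by
      by_contra! hall
      have e1 : u p = v p := hall u hu v hv rfl hvu
      have e2 : u p = w p := hall u hu w hw rfl hwu
      obtain ⟨q, -, hq, -, -, hq0, -⟩ := hF.two_others hu p
      -- at a second point `q` two of the three vectors agree as well
      have n1 : u q ≠ v q := fun h => huv (hF.eq_of_pts hu hv hvu.symm (by tauto) hp hq0 e1 h)
      have n2 : u q ≠ w q := fun h => huw (hF.eq_of_pts hu hw hwu.symm (by tauto) hp hq0 e2 h)
      have m1 := hF.neg_of_ne hu hv hq0 (ne_zero_of_pts hvu hq0) n1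
      have m2 := hF.neg_of_ne hu hw hq0 (ne_zero_of_pts hwu hq0) n2
      exact hvw (hF.eq_of_pts hv hw (hvu.trans hwu.symm) (by tauto) (ne_zero_of_pts hvu hp)
        (ne_zero_of_pts hvu hq0) (e1.symm.trans e2) (m1.trans m2.symm))
    exact hH t ht
  triangle := by
    intro a b c hab hac hbc
    refine hH _ (hub_of_points hab.1 hac.1 hbc.1
      (fun v hv h => hab.cover hF hac hbc.1 hv h)
      (fun v hv h => hab.symm.cover hF hbc hac.1 hv h)
      (fun v hv h => hac.symm.cover hF hbc.symm hab.1 hv h) ?_)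
    have key : ∀ p a c, Big F p a → Big F p c → a ≠ c →
        (∃ v ∈ F, v p = 1) ∧ ∃ v ∈ F, v p = -1 := by
      intro p a c ha hc hac
      obtain ⟨j, j1, -, -, j3, j4, v, hv, vp, va, vj⟩ := ha.exists_leaf c c c
      obtain ⟨k, k1, -, -, k3, k4, w, hw, wp, wc, wk⟩ := hc.exists_leaf a a a
      have e := ha.opp hF hc hac hv hw vp va
        (hF.zero_of_ne hv ha.1 j3.symm j4.symm vp va vj hc.1.symm hac.symm j1.symm) wp wc
        (hF.zero_of_ne hw hc.1 k3.symm k4.symm wp wc wk ha.1.symm hac k1.symm)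
      exact hF.both_of_ne hv hw vp wp (by omega)
    rintro p (rfl | rfl | rfl)
    exacts [key _ _ _ hab hac hbc.1, key _ _ _ hab.symm hbc hac.1,
      key _ _ _ hac.symm hbc.symm hab.1]

/-! ### Disjoint hubs -/

/-- The signed points used by the vectors meeting the hub. -/
noncomputable def hubPts (F : Finset (ι → ℤ)) (t : Fin 3 → ι) : Finset (ι × ℤ) :=
  univ.biUnion fun w => (hubSigns F t w).image (Prod.mk w)

theorem mem_hubPts {t : Fin 3 → ι} {h : ι × ℤ} : h ∈ hubPts F t ↔ h.2 ∈ hubSigns F t h.1 := by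
  obtain ⟨p, s⟩ := h
  simp [hubPts]

/-- The signed points at a hub: both signs at its three points, and those at its leaves. -/
theorem Hub.le_card_hubPts (hF : SignedTriples F) {t : Fin 3 → ι} (ht : Hub F t) :
    6 + #(oneLeaves F t) + 2 * #(twoLeaves F t) ≤ #(hubPts F t) := by
  have h1 : #(hubPts F t) = ∑ w, #(hubSigns F t w) := by
    rw [hubPts, card_biUnion]
    · exact sum_congr rfl fun w _ => card_image_of_injective _ (Prod.mk_right_injective w)
    · intro w _ w' _ hww
      rw [Function.onFun, disjoint_left]
      intro h hh hh'
      obtain ⟨s, -, rfl⟩ := mem_image.1 hh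
      obtain ⟨s', -, h⟩ := mem_image.1 hh'
      exact hww (Prod.ext_iff.1 h).1.symm
  have h2 : Disjoint (univ.image t) (hubLeaves F t) := by
    rw [disjoint_left]
    intro p hp hp'
    obtain ⟨i, -, rfl⟩ := mem_image.1 hp
    exact (mem_hubLeaves.1 hp').1 i rfl
  have h3 := sum_le_sum_of_subset (f := fun w => #(hubSigns F t w))
    (subset_univ (univ.image t ∪ hubLeaves F t))
  rw [sum_union h2, sum_image ht.inj.injOn, Fin.sum_univ_three, ht.card_hubSigns_point hF,
    ht.card_hubSigns_point hF, ht.card_hubSigns_point hF] at h3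
  have hG : ∑ w ∈ hubLeaves F t, #(hubSigns F t w) =
      #(oneLeaves F t) + 2 * #(twoLeaves F t) := by
    rw [oneLeaves, twoLeaves, card_filter, card_filter, mul_sum, ← sum_add_distrib]
    refine sum_congr rfl fun w hw => ?_
    rcases card_hubSigns hF hw with h | h <;> simp [h]
  omega

/-- Disjoint hubs use disjoint sets of signed points: vectors meeting different hubs in the same
signed point would share a second leaf. -/
theorem Hub.disjoint (hF : SignedTriples F) {t t' : Fin 3 → ι} (ht : Hub F t) (ht' : Hub F t')
    (hd : ∀ i j, t i ≠ t' j) : Disjoint (hubPts F t) (hubPts F t') := by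
  rw [disjoint_left]
  rintro ⟨p, s⟩ h h'
  obtain ⟨hs, v, hv, hvp⟩ := mem_hubSigns.1 (mem_hubPts.1 h)
  obtain ⟨-, w, hw, hwp⟩ := mem_hubSigns.1 (mem_hubPts.1 h')
  simp only at hvp hwp hs
  obtain ⟨q, hqp, vq, wq⟩ := hF.share v (mem_hubVecs.1 hv).1 w (mem_hubVecs.1 hw).1 p
    (by omega) (by omega)
  have key : ∀ x, w x ≠ 0 → ∀ i, x ≠ t i := by
    rintro x hx i rfl
    exact hx (ht'.eq_zero hF ht (fun i j => (hd j i).symm) hw i)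
  exact hqp (ht.eq_of_leaf hF hv (key q wq) (key p (by omega)) vq (by omega))

/-- A signed point used by a vector avoiding the hub is not used by a vector meeting it. -/
theorem outside_notMem (hF : SignedTriples F) {H : Finset (Fin 3 → ι)} (hH : DisjointHubs F H)
    {v : ι → ℤ} (hv : v ∈ outside F H) {t : Fin 3 → ι} (ht : t ∈ H) {p : ι} (hp : v p ≠ 0) :
    (p, v p) ∉ hubPts F t := by
  intro h
  obtain ⟨-, w, hw, hwp⟩ := mem_hubSigns.1 (mem_hubPts.1 h)
  obtain ⟨hv, h0⟩ := mem_outside.1 hv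
  simp only at hwp
  obtain ⟨q, hqp, wq, vq⟩ := hF.share w (mem_hubVecs.1 hw).1 v hv p (by omega) hwp
  have key : ∀ x, v x ≠ 0 → ∀ i, x ≠ t i := by
    rintro x hx i rfl
    exact hx (h0 t ht i)
  exact hqp ((hH.hub t ht).eq_of_leaf hF hw (key q vq) (key p hp) wq (by omega))

/-- Outside a maximal family of disjoint hubs there is no hub. -/
theorem exists_disjointHubs (hF : SignedTriples F) :
    ∃ H, DisjointHubs F H ∧ ∀ t, ¬ Hub (outside F H) t := by
  obtain ⟨H, hH, hmax⟩ := exists_max_image {H : Finset (Fin 3 → ι) | DisjointHubs F H} card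
    ⟨∅, mem_filter.2 ⟨mem_univ _, by simp, by simp⟩⟩
  have hH := (mem_filter.1 hH).2
  refine ⟨H, hH, fun t ht => ?_⟩
  have hd : ∀ t' ∈ H, ∀ i j, t i ≠ t' j := by
    intro t' ht' i j hij
    obtain ⟨v, hv, hv1⟩ := ht.pos i
    have := (mem_outside.1 hv).2 t' ht' j
    rw [← hij] at this
    omega
  have htF : Hub F t := by
    refine ⟨ht.inj, fun v hv i hi => ?_, fun i => ?_, fun i => ?_⟩
    · -- a vector meeting a hub of `H` uses no signed point used outside the hubs
      refine ht.two v (mem_outside.2 ⟨hv, fun t' ht' j => ?_⟩) i hi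
      by_contra h
      have hs : ∃ u ∈ outside F H, u (t i) = v (t i) := by
        rcases hF.sign v hv (t i) hi with h | h <;> rw [h]
        exacts [ht.pos i, ht.neg i]
      obtain ⟨u, hu, hui⟩ := hs
      refine outside_notMem hF hH hu ht' (p := t i) (by rwa [hui]) (mem_hubPts.2 ?_)
      exact mem_hubSigns.2 ⟨by simpa [hui] using hi, v, mem_hubVecs.2 ⟨hv, j, h⟩, hui.symm⟩
    · obtain ⟨v, hv, h⟩ := ht.pos i
      exact ⟨v, (mem_outside.1 hv).1, h⟩
    · obtain ⟨v, hv, h⟩ := ht.neg i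
      exact ⟨v, (mem_outside.1 hv).1, h⟩
  have hnot : t ∉ H := fun h => hd t h 0 0 rfl
  have hins : DisjointHubs F (insert t H) := by
    constructor
    · intro t' ht'
      rcases mem_insert.1 ht' with rfl | h
      exacts [htF, hH.hub t' h]
    · intro t₁ h₁ t₂ h₂ hne i j
      rcases mem_insert.1 h₁ with e₁ | h₁ <;> rcases mem_insert.1 h₂ with e₂ | h₂
      · exact absurd (e₁.trans e₂.symm) hne
      · exact e₁ ▸ hd t₂ h₂ i j
      · exact e₂ ▸ (hd t₁ h₁ j i).symm
      · exact hH.disj t₁ h₁ t₂ h₂ hne i j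
  have := hmax _ (mem_filter.2 ⟨mem_univ _, hins⟩)
  rw [card_insert_of_notMem hnot] at this
  omega

end

section

/-! ### The upper bound -/

variable {ι : Type*} {F : Finset (ι → ℤ)} {P : Finset ι}

theorem mem_hubSigns_of_card (hF : SignedTriples F) {t : Fin 3 → ι} {p : ι} {s : ℤ}
    (h2 : #(hubSigns F t p) = 2) (hs : s = 1 ∨ s = -1) : s ∈ hubSigns F t p := by
  have hsub : hubSigns F t p ⊆ {1, -1} := by
    intro x hx
    obtain ⟨hx0, v, hv, rfl⟩ := mem_hubSigns.1 hx
    simpa using hF.sign v (mem_hubVecs.1 hv).1 p hx0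
  rw [eq_of_subset_of_card_le hsub (by rw [h2]; exact card_le_two)]
  simpa using hs

variable [Fintype ι]

theorem hubPts_subset (hF : SignedTriples F) (hP : ∀ v ∈ F, ∀ p, v p ≠ 0 → p ∈ P)
    (t : Fin 3 → ι) : hubPts F t ⊆ P ×ˢ {1, -1} := by
  rintro ⟨p, s⟩ h
  obtain ⟨hs, v, hv, h⟩ := mem_hubSigns.1 (mem_hubPts.1 h)
  obtain rfl : v p = s := h
  have hv := (mem_hubVecs.1 hv).1
  rw [mem_product]
  exact ⟨hP v hv p hs, by simpa using hF.sign v hv p hs⟩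

/-- The signed points of `P` not used by vectors meeting the hubs of `H`. -/
noncomputable def freePts (F : Finset (ι → ℤ)) (P : Finset ι) (H : Finset (Fin 3 → ι)) :
    Finset (ι × ℤ) :=
  (P ×ˢ {1, -1}) \ H.biUnion (hubPts F)

theorem mem_freePts {H : Finset (Fin 3 → ι)} {h : ι × ℤ} : h ∈ freePts F P H ↔
    (h.1 ∈ P ∧ (h.2 = 1 ∨ h.2 = -1)) ∧ ∀ t ∈ H, h.2 ∉ hubSigns F t h.1 := by
  simp [freePts, mem_product, mem_hubPts]

/-- The members avoiding all hubs only use free signed points. -/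
theorem uses_outside (hF : SignedTriples F) (hP : ∀ v ∈ F, ∀ p, v p ≠ 0 → p ∈ P)
    {H : Finset (Fin 3 → ι)} (hH : DisjointHubs F H) : Uses (outside F H) (freePts F P H) where
  mem v hv p hp := by
    have hvF := (mem_outside.1 hv).1
    refine mem_freePts.2 ⟨⟨hP v hvF p hp, hF.sign v hvF p hp⟩, fun t ht h => ?_⟩
    exact outside_notMem hF hH hv ht hp (mem_hubPts.2 h)
  sign h hh := (mem_freePts.1 hh).1.2

/-- The signed points at the hubs and the free ones are among the `2 * #P` signed points of `P`. -/
theorem sum_card_hubPts_add (hF : SignedTriples F) (hP : ∀ v ∈ F, ∀ p, v p ≠ 0 → p ∈ P)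
    {H : Finset (Fin 3 → ι)} (hH : DisjointHubs F H) :
    ∑ t ∈ H, (6 + #(oneLeaves F t) + 2 * #(twoLeaves F t)) + #(freePts F P H) ≤ 2 * #P := by
  have h1 : #(P ×ˢ ({1, -1} : Finset ℤ)) = 2 * #P := by
    rw [card_product, card_pair (by omega), mul_comm]
  have h2 : H.biUnion (hubPts F) ⊆ P ×ˢ {1, -1} :=
    biUnion_subset.2 fun t _ => hubPts_subset hF hP t
  have h3 : #(H.biUnion (hubPts F)) = ∑ t ∈ H, #(hubPts F t) :=
    card_biUnion fun t ht t' ht' hne =>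
      (hH.hub t ht).disjoint hF (hH.hub t' ht') (hH.disj t ht t' ht' hne)
  have h4 := sum_le_sum fun t ht => (hH.hub t ht).le_card_hubPts hF
  have h5 := card_sdiff_add_card_eq_card h2
  rw [← freePts] at h5
  omega

theorem card_le_sum_add_outside (H : Finset (Fin 3 → ι)) :
    #F ≤ ∑ t ∈ H, #(hubVecs F t) + #(outside F H) := by
  have h : F ⊆ H.biUnion (hubVecs F) ∪ outside F H := by
    intro v hv
    rw [mem_union, mem_biUnion, mem_outside]
    by_cases h : ∀ t ∈ H, ∀ i, v (t i) = 0
    · exact Or.inr ⟨hv, h⟩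
    · push Not at h
      obtain ⟨t, ht, i, hi⟩ := h
      exact Or.inl ⟨t, ht, mem_hubVecs.2 ⟨hv, i, hi⟩⟩
  exact (card_le_card h).trans ((card_union_le _ _).trans (Nat.add_le_add_right card_biUnion_le _))

/-- The leaves of a hub lie outside all hubs of a disjoint family. -/
theorem card_hubLeaves_add (hF : SignedTriples F) (hP : ∀ v ∈ F, ∀ p, v p ≠ 0 → p ∈ P)
    {H : Finset (Fin 3 → ι)} (hH : DisjointHubs F H) {t : Fin 3 → ι} (ht : t ∈ H) :
    #(oneLeaves F t) + #(twoLeaves F t) + 3 * #H ≤ #P := by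
  rw [card_one_add_card_two hF t]
  have h1 : #(H.biUnion fun t => univ.image t) = 3 * #H := by
    rw [card_biUnion]
    · rw [sum_congr rfl fun t ht => card_image_of_injective univ (hH.hub t ht).inj]
      simp [mul_comm]
    · intro t ht t' ht' hne
      rw [Function.onFun, disjoint_left]
      intro p hp hp'
      obtain ⟨i, -, rfl⟩ := mem_image.1 hp
      obtain ⟨j, -, h⟩ := mem_image.1 hp'
      exact hH.disj t ht t' ht' hne i j h.symm
  have h2 : Disjoint (hubLeaves F t) (H.biUnion fun t => univ.image t) := by
    rw [disjoint_left]
    intro p hp hp'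
    obtain ⟨t', ht', hp'⟩ := mem_biUnion.1 hp'
    obtain ⟨i, -, rfl⟩ := mem_image.1 hp'
    obtain ⟨h3, v, hv, hvp⟩ := mem_hubLeaves.1 hp
    by_cases htt : t = t'
    · exact h3 i (by rw [htt])
    · exact hvp ((hH.hub t ht).eq_zero hF (hH.hub t' ht') (hH.disj t ht t' ht' htt) hv i)
  rw [← h1, ← card_union_of_disjoint h2]
  refine card_le_card (union_subset (fun p hp => ?_) (biUnion_subset.2 fun t' ht' p hp => ?_))
  · obtain ⟨-, v, hv, hvp⟩ := mem_hubLeaves.1 hp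
    exact hP v (mem_hubVecs.1 hv).1 p hvp
  · obtain ⟨i, -, rfl⟩ := mem_image.1 hp
    obtain ⟨v, hv, hv1⟩ := (hH.hub t' ht').pos i
    exact hP v hv _ (by omega)

/-- The bounds for a tame family in a form convenient for arithmetic. -/
theorem Tame.card_bound (hF : SignedTriples F) (hT : Tame F) {Ω : Finset (ι × ℤ)}
    (hΩ : Uses F Ω) : (#F + 6 ≤ 2 * #Ω ∧ (Balanced Ω → #F + 8 ≤ 2 * #Ω)) ∨
      (5 * #F ≤ 6 * #Ω ∧ ((∀ h ∈ Ω, (h.1, -h.2) ∉ Ω) → #F ≤ #Ω)) := by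
  by_cases hB : ∃ a b, Big F a b
  · obtain ⟨a, b, hab⟩ := hB
    exact Or.inl (Tame.card_add_le hF hT hΩ hab)
  · push Not at hB
    exact Or.inr ⟨five_mul_card_le hF hT hΩ hB, card_le_card_of_oneSigned hF hΩ hB⟩

/-- If all leaves of the only hub are two-signed, the free signed points are closed under negation.
-/
theorem neg_mem_freePts (hF : SignedTriples F) {t : Fin 3 → ι} (ht : Hub F t)
    (h0 : oneLeaves F t = ∅) {h : ι × ℤ} (hh : h ∈ freePts F P {t}) :
    (h.1, -h.2) ∈ freePts F P {t} := by
  obtain ⟨p, s⟩ := h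
  simp only [mem_freePts, mem_singleton, forall_eq] at hh ⊢
  obtain ⟨⟨hp, hs⟩, hn⟩ := hh
  refine ⟨⟨hp, by omega⟩, fun hm => hn ?_⟩
  have hcard : #(hubSigns F t p) = 2 := by
    by_cases hpt : ∀ i, p ≠ t i
    · obtain ⟨hs', v, hv, hvp⟩ := mem_hubSigns.1 hm
      have hpl : p ∈ hubLeaves F t := mem_hubLeaves.2 ⟨hpt, v, hv, by omega⟩
      refine (card_hubSigns hF hpl).resolve_left fun h => ?_
      have : p ∈ oneLeaves F t := mem_filter.2 ⟨hpl, h⟩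
      simp [h0] at this
    · push Not at hpt
      obtain ⟨i, rfl⟩ := hpt
      exact ht.card_hubSigns_point hF i
  exact mem_hubSigns_of_card hF hcard hs

/-- If every point of `P` is in the only hub or a leaf of it, no point is free with both signs. -/
theorem neg_notMem_freePts (hF : SignedTriples F) (hP : ∀ v ∈ F, ∀ p, v p ≠ 0 → p ∈ P)
    {t : Fin 3 → ι} (ht : Hub F t) (h0 : #P ≤ #(oneLeaves F t) + #(twoLeaves F t) + 3)
    {h : ι × ℤ} (hh : h ∈ freePts F P {t}) : (h.1, -h.2) ∉ freePts F P {t} := by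
  obtain ⟨p, s⟩ := h
  simp only [mem_freePts, mem_singleton, forall_eq] at hh ⊢
  obtain ⟨⟨hp, hs⟩, hn⟩ := hh
  rintro ⟨-, hn'⟩
  rw [card_one_add_card_two hF] at h0
  -- every point of `P` outside the hub is a leaf
  have hsub : hubLeaves F t ∪ univ.image t ⊆ P := by
    intro q hq
    rcases mem_union.1 hq with hq | hq
    · obtain ⟨-, v, hv, hvq⟩ := mem_hubLeaves.1 hq
      exact hP v (mem_hubVecs.1 hv).1 q hvq
    · obtain ⟨i, -, rfl⟩ := mem_image.1 hq
      obtain ⟨v, hv, hv1⟩ := ht.pos i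
      exact hP v hv _ (by omega)
  have hdisj : Disjoint (hubLeaves F t) (univ.image t) := by
    rw [disjoint_left]
    intro q hq hq'
    obtain ⟨i, -, rfl⟩ := mem_image.1 hq'
    exact (mem_hubLeaves.1 hq).1 i rfl
  have heq := eq_of_subset_of_card_le hsub (by
    rw [card_union_of_disjoint hdisj, card_image_of_injective _ ht.inj, card_univ,
      Fintype.card_fin]
    exact h0)
  have hne : (hubSigns F t p).Nonempty := by
    rw [← heq] at hp
    rcases mem_union.1 hp with hp | hp
    · obtain ⟨-, v, hv, hvp⟩ := mem_hubLeaves.1 hp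
      exact ⟨v p, mem_hubSigns.2 ⟨hvp, v, hv, rfl⟩⟩
    · obtain ⟨i, -, rfl⟩ := mem_image.1 hp
      obtain ⟨v, hv, hv1⟩ := ht.pos i
      exact ⟨1, mem_hubSigns.2 ⟨by omega, v, mem_hubVecs.2 ⟨hv, i, by omega⟩, hv1⟩⟩
  obtain ⟨x, hx⟩ := hne
  obtain ⟨hx0, v, hv, rfl⟩ := mem_hubSigns.1 hx
  have : v p = s ∨ v p = -s := by
    have := hF.sign v (mem_hubVecs.1 hv).1 p hx0
    omega
  rcases this with h | h <;> rw [h] at hx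
  exacts [hn hx, hn' hx]

theorem constC_cases (n : ℕ) : (n % 4 = 0 ∧ constC n = 0) ∨ (n % 4 = 1 ∧ constC n = 1) ∨
    (2 ≤ n % 4 ∧ constC n = 2) := by
  unfold constC
  split_ifs <;> omega

/-- The arithmetic for a family with a single hub in its maximal family of disjoint hubs. Here
`V` vectors meet the hub, which has `x` one-signed and `y` two-signed leaves, and `R` vectors
avoiding the hub use at most `ω` signed points. -/
theorem one_hub_arith {n x y V R ω : ℕ} (hn : 4 ≤ n) (hxy : x + y + 3 ≤ n)
    (hω : 6 + x + 2 * y + ω ≤ 2 * n) (hblock : ¬ (x = 0 ∧ y = 1))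
    (hV1 : x + y ≤ 1 → V ≤ 4 + 6 * x + 12 * y)
    (hV2 : 2 ≤ x + y → (V : ℤ) ≤ 4 + 2 * x + 4 * y + max (x : ℤ) (6 - x - 2 * y))
    (hR : (R + 6 ≤ 2 * ω ∧ (x = 0 ∨ n ≤ x + y + 3 → R + 8 ≤ 2 * ω)) ∨
      (5 * R ≤ 6 * ω ∧ (n ≤ x + y + 3 → R ≤ ω))) :
    (V + R : ℤ) ≤ max (6 * (n : ℤ) - 28) (4 * n - 4 * constC n) := by
  have hc := constC_cases n
  obtain ⟨m, rfl⟩ : ∃ m, n = 3 + m + y := ⟨n - 3 - y, by omega⟩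
  rw [le_max_iff]
  by_cases hp : x + y ≤ 1
  · have := hV1 hp
    have hy : y = 0 := by omega
    subst hy
    rcases hR with ⟨h1, h2⟩ | ⟨h1, h2⟩ <;> omega
  · have := hV2 (by omega)
    rcases le_total (x : ℤ) (6 - x - 2 * y) with hx | hx <;>
    [rw [max_eq_right hx] at this; rw [max_eq_left hx] at this] <;>
    rcases hR with ⟨h1, h2⟩ | ⟨h1, h2⟩ <;> omega

/-- The deficit `12 + 2 x + 4 y - V` of a hub with `x` one-signed and `y` two-signed leaves. -/
theorem Hub.deficit (hF : SignedTriples F) {t : Fin 3 → ι} (ht : Hub F t)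
    (hblock : ¬ (#(oneLeaves F t) = 0 ∧ #(twoLeaves F t) = 1)) :
    (8 : ℤ) - max (#(oneLeaves F t) : ℤ) 4 ≤
      2 * (6 + #(oneLeaves F t) + 2 * #(twoLeaves F t)) - #(hubVecs F t) := by
  obtain ⟨h1, h2⟩ := ht.card_le hF
  have h3 := card_one_add_card_two hF t
  generalize #(oneLeaves F t) = x at *
  generalize #(twoLeaves F t) = y at *
  by_cases hle : #(hubLeaves F t) ≤ 1
  · have := h1 hle
    have := le_max_right (x : ℤ) 4
    omega
  · have := h2 (by omega)
    rcases le_total (x : ℤ) (6 - x - 2 * y) with hx | hx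
    · rw [max_eq_right hx] at this
      have := le_max_right (x : ℤ) 4
      omega
    · rw [max_eq_left hx] at this
      have := le_max_left (x : ℤ) 4
      omega

/-- The bound for at least two disjoint hubs. As the vectors off the hubs number at most twice the
free signed points, `#F` is at most `4 * #P` minus the sum of the deficits of the hubs. -/
theorem card_le_of_two_hubs (hF : SignedTriples F) (hP : ∀ v ∈ F, ∀ p, v p ≠ 0 → p ∈ P)
    (hblock : ∀ t, Hub F t → ¬ (#(oneLeaves F t) = 0 ∧ #(twoLeaves F t) = 1))
    {H : Finset (Fin 3 → ι)} (hH : DisjointHubs F H) (h2 : 2 ≤ #H)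
    (hR : #(outside F H) ≤ 2 * #(freePts F P H)) :
    (#F : ℤ) ≤ 4 * #P - 8 ∨ (#F : ℤ) ≤ 6 * #P - 28 := by
  have e1 := sum_card_hubPts_add hF hP hH
  have e2 := card_le_sum_add_outside (F := F) H
  have e3 := sum_le_sum fun t ht => (hH.hub t ht).deficit hF (hblock t (hH.hub t ht))
  rw [sum_sub_distrib (s := H) (fun t => 2 * (6 + (#(oneLeaves F t) : ℤ) + 2 * #(twoLeaves F t))),
    ← mul_sum] at e3
  have e4 : ∀ t ∈ H, (#(oneLeaves F t) : ℤ) + 3 * #H ≤ #P := fun t ht => by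
    have := card_hubLeaves_add hF hP hH ht
    omega
  zify at e1 e2
  by_cases h4 : ∀ t ∈ H, #(oneLeaves F t) ≤ 4
  · -- each hub has deficit at least `4`
    left
    have e5 : (#H • 4 : ℤ) ≤ ∑ t ∈ H, ((8 : ℤ) - max (#(oneLeaves F t) : ℤ) 4) :=
      card_nsmul_le_sum _ _ _ fun t ht => by
        rw [max_eq_right (by exact_mod_cast h4 t ht)]
        omega
    rw [nsmul_eq_mul] at e5
    omega
  · right
    push Not at h4
    obtain ⟨t, ht, ht4⟩ := h4
    have e5 := e4 t ht
    by_cases h3 : #H = 2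
    · -- both hubs have at most `#P - 6` leaves, hence deficit at least `14 - #P`
      have e6 : (#H • (8 - (#P - 6)) : ℤ) ≤
          ∑ t ∈ H, ((8 : ℤ) - max (#(oneLeaves F t) : ℤ) 4) :=
        card_nsmul_le_sum _ _ _ fun t ht => by
          have := e4 t ht
          have := max_le (a := (#(oneLeaves F t) : ℤ)) (b := 4) (c := #P - 6) (by omega) (by omega)
          omega
      rw [h3, nsmul_eq_mul] at e6
      omega
    · -- with at least three hubs, bound the number of one-signed leaves by counting signed points
      have e6 : ∑ t ∈ H, (4 - (#(oneLeaves F t) : ℤ)) ≤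
          ∑ t ∈ H, ((8 : ℤ) - max (#(oneLeaves F t) : ℤ) 4) :=
        sum_le_sum fun t _ => by
          have := max_le (a := (#(oneLeaves F t) : ℤ)) (b := 4) (c := #(oneLeaves F t) + 4)
            (by omega) (by omega)
          omega
      have e7 : ∑ t ∈ H, (6 + (#(oneLeaves F t) : ℤ)) ≤
          ∑ t ∈ H, (6 + (#(oneLeaves F t) : ℤ) + 2 * #(twoLeaves F t)) :=
        sum_le_sum fun t _ => by omega
      rw [sum_sub_distrib, sum_const, nsmul_eq_mul] at e6
      rw [sum_add_distrib, sum_const, nsmul_eq_mul] at e7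
      omega

/-- The upper bound for families in which no hub has as its only leaf a two-signed one. -/
theorem card_le_of_no_block (hF : SignedTriples F) (hP : ∀ v ∈ F, ∀ p, v p ≠ 0 → p ∈ P)
    (hn : 4 ≤ #P) (hblock : ∀ t, Hub F t → ¬ (#(oneLeaves F t) = 0 ∧ #(twoLeaves F t) = 1)) :
    (#F : ℤ) ≤ max (6 * (#P : ℤ) - 28) (4 * #P - 4 * constC #P) := by
  obtain ⟨H, hH, hmax⟩ := exists_disjointHubs hF
  have hsub : outside F H ⊆ F := fun v hv => (mem_outside.1 hv).1
  have hR := (tame_of_no_hub (hF.mono hsub) hmax).card_bound (hF.mono hsub) (uses_outside hF hP hH)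
  have hc := constC_cases #P
  have e1 := sum_card_hubPts_add hF hP hH
  have e2 := card_le_sum_add_outside (F := F) H
  obtain h0 | h1 | h2 : #H = 0 ∨ #H = 1 ∨ 2 ≤ #H := by omega
  · rw [card_eq_zero] at h0
    subst h0
    rw [sum_empty] at e1 e2
    have hbal : Balanced (freePts F P ∅) := Or.inl fun h hh => by
      simp only [mem_freePts] at hh ⊢
      exact ⟨⟨hh.1.1, by omega⟩, by simp⟩
    rw [le_max_iff]
    rcases hR with ⟨-, hR⟩ | ⟨hR, -⟩
    · have := hR hbal
      omega
    · omega
  · obtain ⟨t, rfl⟩ := card_eq_one.1 h1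
    have ht := hH.hub t (mem_singleton_self t)
    have e3 := card_hubLeaves_add hF hP hH (mem_singleton_self t)
    have e4 := card_one_add_card_two hF t
    obtain ⟨b1, b2⟩ := ht.card_le hF
    rw [sum_singleton] at e1 e2
    rw [card_singleton] at e3
    rw [← e4] at b1 b2
    refine le_trans (by exact_mod_cast e2) (one_hub_arith hn (by omega) e1 (hblock t ht) b1 b2 ?_)
    refine hR.imp (fun h => ⟨h.1, fun h' => h.2 ?_⟩) fun h => ⟨h.1, fun h' => h.2 ?_⟩
    · rcases h' with h' | h'
      · exact Or.inl fun h hh => neg_mem_freePts hF ht (card_eq_zero.1 h') hh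
      · exact Or.inr fun h hh => neg_notMem_freePts hF hP ht h' hh
    · exact fun h hh => neg_notMem_freePts hF hP ht h' hh
  · have := card_le_of_two_hubs hF hP hblock hH h2 (by omega)
    rw [le_max_iff]
    omega

/-- With at most three points all vectors have the same support. -/
theorem card_le_of_card_le_three (hF : SignedTriples F) (hP : ∀ v ∈ F, ∀ p, v p ≠ 0 → p ∈ P)
    (hn : #P ≤ 3) : (#F : ℤ) ≤ 4 * #P - 4 * constC #P := by
  have hc := constC_cases #P
  have hsub : ∀ v ∈ F, pts v ⊆ P := fun v hv p hp => hP v hv p (mem_pts.1 hp)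
  rcases F.eq_empty_or_nonempty with rfl | ⟨v, hv⟩
  · rw [card_empty]
    omega
  · have h3 := card_le_card (hsub v hv)
    rw [hF.card_pts hv] at h3
    obtain ⟨a, b, c, hab, hac, hbc, rfl⟩ := card_eq_three.1 (le_antisymm hn h3)
    have h1 := card_core_le hF (t := ![a, b, c]) (by
      intro i j hij
      fin_cases i <;> fin_cases j <;> simp_all)
    rw [filter_true_of_mem] at h1
    · omega
    · intro w hw i
      rw [← mem_pts, eq_of_subset_of_card_le (hsub w hw) (by rw [hF.card_pts hw]; exact hn)]
      fin_cases i <;> simp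

/-- The upper bound: a family on the point set `P`. -/
theorem SignedTriples.card_le (hF : SignedTriples F) (hP : ∀ v ∈ F, ∀ p, v p ≠ 0 → p ∈ P) :
    (#F : ℤ) ≤ max (6 * (#P : ℤ) - 28) (4 * #P - 4 * constC #P) := by
  induction hn : #P using Nat.strong_induction_on generalizing F P with
  | _ n ih =>
  subst hn
  rcases Nat.lt_or_ge #P 4 with h4 | h4
  · exact le_max_of_le_right (card_le_of_card_le_three hF hP (by omega))
  by_cases hb : ∀ t, Hub F t → ¬ (#(oneLeaves F t) = 0 ∧ #(twoLeaves F t) = 1)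
  · exact card_le_of_no_block hF hP h4 hb
  push Not at hb
  obtain ⟨t, ht, h1, h2⟩ := hb
  have hH : DisjointHubs F {t} := ⟨fun t' h => mem_singleton.1 h ▸ ht, fun t₁ h₁ t₂ h₂ hne =>
    absurd ((mem_singleton.1 h₁).trans (mem_singleton.1 h₂).symm) hne⟩
  have e0 := card_one_add_card_two hF t
  have e1 := (ht.card_le hF).1 (by omega)
  have e2 := card_le_sum_add_outside (F := F) {t}
  rw [sum_singleton] at e2
  -- the hub and its leaf form a set of four points, avoided by all other vectors
  set Q := hubLeaves F t ∪ univ.image t with hQ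
  have hQ4 : #Q = 4 := by
    rw [hQ, card_union_of_disjoint, card_image_of_injective _ ht.inj, card_univ, Fintype.card_fin]
    · omega
    · rw [disjoint_left]
      intro q hq hq'
      obtain ⟨i, -, rfl⟩ := mem_image.1 hq'
      exact (mem_hubLeaves.1 hq).1 i rfl
  have hQP : Q ⊆ P := by
    intro q hq
    rcases mem_union.1 hq with hq | hq
    · obtain ⟨-, v, hv, hvq⟩ := mem_hubLeaves.1 hq
      exact hP v (mem_hubVecs.1 hv).1 q hvq
    · obtain ⟨i, -, rfl⟩ := mem_image.1 hq
      obtain ⟨v, hv, hv1⟩ := ht.pos i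
      exact hP v hv _ (by omega)
  have e3 : #(P \ Q) = #P - 4 := by rw [card_sdiff_of_subset hQP, hQ4]
  have hsub : outside F {t} ⊆ F := fun v hv => (mem_outside.1 hv).1
  have e4 := ih #(P \ Q) (by omega) (hF.mono hsub) (P := P \ Q) (fun v hv p hp => by
    refine mem_sdiff.2 ⟨hP v (hsub hv) p hp, fun hpQ => ?_⟩
    rcases mem_union.1 hpQ with hq | hq
    · refine outside_notMem hF hH hv (mem_singleton_self t) hp (mem_hubPts.2 ?_)
      refine mem_hubSigns_of_card hF ((card_hubSigns hF hq).resolve_left fun h => ?_)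
        (hF.sign v (hsub hv) p hp)
      have : p ∈ oneLeaves F t := mem_filter.2 ⟨hq, h⟩
      rw [card_eq_zero.1 h1] at this
      simp at this
    · obtain ⟨i, -, rfl⟩ := mem_image.1 hq
      exact hp ((mem_outside.1 hv).2 t (mem_singleton_self t) i)) rfl
  have c1 := constC_cases #P
  have c2 := constC_cases #(P \ Q)
  rw [le_max_iff] at e4 ⊢
  omega

end

section

/-! ### Integer vectors and the graph -/

section Dot

variable {ι : Type*} [Fintype ι]

theorem card_support_eq_three {v : ι → ℤ} (hv : ∀ i, v i = -1 ∨ v i = 0 ∨ v i = 1)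
    (h3 : ∑ i, v i * v i = 3) : #{i | v i ≠ 0} = 3 := by
  have h : ∑ i, v i * v i = ∑ i, if v i ≠ 0 then 1 else 0 :=
    sum_congr rfl fun i _ => by rcases hv i with h | h | h <;> simp [h]
  rw [h3, ← sum_filter, sum_const, nsmul_eq_mul, mul_one] at h
  exact_mod_cast h.symm

/-- Vectors with entries in `{-1, 0, 1}` and square norm `3`, no two with scalar product `1`, form a
family of signed triples. -/
theorem signedTriples_of_sum {F : Finset (ι → ℤ)}
    (hv : ∀ v ∈ F, ∀ i, v i = -1 ∨ v i = 0 ∨ v i = 1) (h3 : ∀ v ∈ F, ∑ i, v i * v i = 3)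
    (hdot : ∀ v ∈ F, ∀ w ∈ F, ∑ i, v i * w i ≠ 1) : SignedTriples F := by
  have hsq : ∀ v ∈ F, ∀ i, v i ≠ 0 → v i * v i = 1 := by
    intro v hvF i hi
    rcases hv v hvF i with h | h | h
    · simp [h]
    · exact absurd h hi
    · simp [h]
  refine ⟨fun v hvF p hp => ?_, fun v hvF => ?_, fun v hvF w hw p hp hpw => ?_,
    fun v hvF w hw p q hpq hp hq hp' hq' hs => ?_⟩
  · have := hv v hvF p
    tauto
  · obtain ⟨a, b, c, hab, hac, hbc, h⟩ := card_eq_three.1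
      (card_support_eq_three (hv v hvF) (h3 v hvF))
    refine ⟨a, b, c, hab, hac, hbc, fun p => ?_⟩
    have : p ∈ ({i | v i ≠ 0} : Finset ι) ↔ p ∈ ({a, b, c} : Finset ι) := by rw [h]
    simpa using this
  · by_contra! h
    refine hdot v hvF w hw ?_
    rw [sum_eq_single p, ← hpw, hsq v hvF p hp]
    · intro q _ hqp
      by_cases hq : v q = 0
      · simp [hq]
      · simp [h q hqp hq]
    · simp
  · ext r
    by_contra hr
    have hvr : v r ≠ 0 := fun h => by
      have := mt (hs r).2 (not_not.2 h)
      omega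
    have hwr := (hs r).1 hvr
    have hrp : p ≠ r := by rintro rfl; exact hr hp'
    have hrq : q ≠ r := by rintro rfl; exact hr hq'
    have hsupp : {p, q, r} = ({i | v i ≠ 0} : Finset ι) := by
      refine eq_of_subset_of_card_le ?_ ?_
      · intro x hx
        simp only [mem_insert, mem_singleton] at hx
        rcases hx with rfl | rfl | rfl <;> simpa
      · rw [card_support_eq_three (hv v hvF) (h3 v hvF),
          card_eq_three.2 ⟨p, q, r, hpq, hrp, hrq, rfl⟩]
    refine hdot v hvF w hw ?_
    rw [← sum_subset (subset_univ {p, q, r}), sum_insert (by simp [hpq, hrp]),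
      sum_insert (by simp [hrq]), sum_singleton, ← hp', ← hq', hsq v hvF p hp, hsq v hvF q hq]
    · have h1 := hv v hvF r
      have h2 := hv w hw r
      rcases h1 with h1 | h1 | h1 <;> rcases h2 with h2 | h2 | h2 <;> simp_all
    · intro x _ hx
      rw [hsupp] at hx
      have : v x = 0 := by simpa using hx
      simp [this]

end Dot

/-- The integer vector with the entries of a vertex. -/
noncomputable def toInt {n : ℕ} (v : EuclideanSpace ℝ (Fin n)) (i : Fin n) : ℤ := ⌊v i⌋

section Graph

variable {n : ℕ}

theorem cast_toInt {v : EuclideanSpace ℝ (Fin n)} (hv : v ∈ vertexSet n) (i : Fin n) :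
    (toInt v i : ℝ) = v i := by
  rcases hv.1 i with h | h | h <;> norm_num [toInt, h]

theorem toInt_cases {v : EuclideanSpace ℝ (Fin n)} (hv : v ∈ vertexSet n) (i : Fin n) :
    toInt v i = -1 ∨ toInt v i = 0 ∨ toInt v i = 1 := by
  rcases hv.1 i with h | h | h <;> norm_num [toInt, h]

theorem inner_eq_sum (v w : EuclideanSpace ℝ (Fin n)) : inner ℝ v w = ∑ i, v i * w i := by
  simp [PiLp.inner_apply, mul_comm]

theorem inner_eq_cast {v w : EuclideanSpace ℝ (Fin n)} (hv : v ∈ vertexSet n)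
    (hw : w ∈ vertexSet n) : inner ℝ v w = ((∑ i, toInt v i * toInt w i : ℤ) : ℝ) := by
  rw [inner_eq_sum]
  push_cast
  exact sum_congr rfl fun i _ => by rw [cast_toInt hv, cast_toInt hw]

theorem sum_toInt_sq {v : EuclideanSpace ℝ (Fin n)} (hv : v ∈ vertexSet n) :
    ∑ i, toInt v i * toInt v i = 3 := by
  have h := inner_eq_cast hv hv
  rw [real_inner_self_eq_norm_sq, hv.2, Real.sq_sqrt (by norm_num)] at h
  exact_mod_cast h.symm

/-- The upper bound for the independence number. -/
theorem indepNum_le (n : ℕ) : ((distGraph n).indepNum : ℤ) ≤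
    max (6 * (n : ℤ) - 28) (4 * (n : ℤ) - 4 * constC n) := by
  obtain ⟨s, hs, hcard⟩ := (distGraph n).exists_isNIndepSet_indepNum
  have hinj : Set.InjOn (fun v : vertexSet n => toInt (v : EuclideanSpace ℝ (Fin n))) s := by
    intro v _ w _ h
    ext i
    rw [← cast_toInt v.2 i, ← cast_toInt w.2 i]
    exact congrArg _ (congrFun h i)
  have hF : SignedTriples
      (s.image fun v : vertexSet n => toInt (v : EuclideanSpace ℝ (Fin n))) := by
    refine signedTriples_of_sum ?_ ?_ ?_
    · simp only [mem_image]
      rintro _ ⟨v, -, rfl⟩ i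
      exact toInt_cases v.2 i
    · simp only [mem_image]
      rintro _ ⟨v, -, rfl⟩
      exact sum_toInt_sq v.2
    · simp only [mem_image]
      rintro _ ⟨v, hv, rfl⟩ _ ⟨w, hw, rfl⟩ h
      by_cases hvw : v = w
      · subst hvw
        rw [sum_toInt_sq v.2] at h
        omega
      · apply hs hv hw hvw
        change inner ℝ v.1 w.1 = 1
        rw [inner_eq_cast v.2 w.2, h]
        simp
  have := hF.card_le (P := univ) fun _ _ _ _ => mem_univ _
  rwa [card_image_of_injOn hinj, hcard, card_univ, Fintype.card_fin] at this

/-- A system of vectors with entries in `{-1, 0, 1}` and square norm `3`, in which different members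
have scalar product neither `1` nor `3`. -/
structure Admissible {I : Type*} (V : I → Fin n → ℤ) : Prop where
  entry : ∀ i x, V i x = -1 ∨ V i x = 0 ∨ V i x = 1
  sq : ∀ i, V i ⬝ᵥ V i = 3
  dot : ∀ i j, i ≠ j → V i ⬝ᵥ V j ≠ 1 ∧ V i ⬝ᵥ V j ≠ 3

theorem Admissible.card_le_indepNum {I : Type*} [Fintype I] {V : I → Fin n → ℤ}
    (hV : Admissible V) : Fintype.card I ≤ (distGraph n).indepNum := by
  have hinner : ∀ i j, inner ℝ (WithLp.toLp 2 fun x => (V i x : ℝ) : EuclideanSpace ℝ (Fin n))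
      (WithLp.toLp 2 fun x => (V j x : ℝ)) = ((V i ⬝ᵥ V j : ℤ) : ℝ) := by
    intro i j
    rw [inner_eq_sum, dotProduct]
    push_cast
    rfl
  let f : I → vertexSet n := fun i => ⟨WithLp.toLp 2 fun x => (V i x : ℝ), by
    refine ⟨fun x => ?_, ?_⟩
    · rcases hV.entry i x with h | h | h <;> simp [h]
    · rw [norm_eq_sqrt_real_inner, hinner, hV.sq]
      norm_num⟩
  have hf : ∀ i j, i ≠ j → f i ≠ f j := by
    intro i j hij h
    refine (hV.dot i j hij).2 ?_
    have h1 := hinner i j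
    have h2 : (WithLp.toLp 2 fun x => (V i x : ℝ) : EuclideanSpace ℝ (Fin n)) =
      WithLp.toLp 2 fun x => (V j x : ℝ) := Subtype.ext_iff.1 h
    rw [← h2, hinner, hV.sq] at h1
    exact_mod_cast h1.symm
  rw [← card_univ, ← card_image_of_injective univ (f := f) fun i j h => by
    by_contra hij
    exact hf i j hij h]
  refine SimpleGraph.IsIndepSet.card_le_indepNum ?_
  intro v hv w hw hvw hadj
  simp only [coe_image, coe_univ, Set.image_univ, Set.mem_range] at hv hw
  obtain ⟨i, rfl⟩ := hv
  obtain ⟨j, rfl⟩ := hw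
  refine (hV.dot i j fun h => hvw (h ▸ rfl)).1 ?_
  have h1 : inner ℝ (f i).1 (f j).1 = 1 := hadj
  rw [hinner] at h1
  exact_mod_cast h1

end Graph

end

end TernaryTriples

namespace TernaryTriples

/-! ### The lower bound -/

/-- There is an admissible system of `c` vectors in dimension `n`. -/
def Realizes (n c : ℕ) : Prop :=
  ∃ (I : Type) (_ : Fintype I) (V : I → Fin n → ℤ), Admissible V ∧ Fintype.card I = c

theorem Realizes.le_indepNum {n c : ℕ} (h : Realizes n c) : c ≤ (distGraph n).indepNum := by
  obtain ⟨I, _, V, hV, rfl⟩ := h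
  exact hV.card_le_indepNum

theorem append_dotProduct {a b : ℕ} (v v' : Fin a → ℤ) (w w' : Fin b → ℤ) :
    Fin.append v w ⬝ᵥ Fin.append v' w' = v ⬝ᵥ v' + w ⬝ᵥ w' := by
  simp [dotProduct, Fin.sum_univ_add]

theorem append_entry {a b : ℕ} {v : Fin a → ℤ} {w : Fin b → ℤ}
    (hv : ∀ x, v x = -1 ∨ v x = 0 ∨ v x = 1) (hw : ∀ x, w x = -1 ∨ w x = 0 ∨ w x = 1)
    (x : Fin (a + b)) : Fin.append v w x = -1 ∨ Fin.append v w x = 0 ∨ Fin.append v w x = 1 := by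
  induction x using Fin.addCases with
  | left x => simpa using hv x
  | right x => simpa using hw x

/-- Systems on disjoint sets of coordinates can be united. -/
theorem Realizes.add {a b c d : ℕ} (h : Realizes a c) (h' : Realizes b d) :
    Realizes (a + b) (c + d) := by
  obtain ⟨I, _, V, hV, rfl⟩ := h
  obtain ⟨J, _, W, hW, rfl⟩ := h'
  refine ⟨I ⊕ J, inferInstance, Sum.elim (fun i => Fin.append (V i) 0) fun j => Fin.append 0 (W j),
    ⟨?_, ?_, ?_⟩, Fintype.card_sum⟩
  · rintro (i | j) x
    · exact append_entry (hV.entry i) (fun _ => by simp) x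
    · exact append_entry (fun _ => by simp) (hW.entry j) x
  · rintro (i | j)
    · simp [append_dotProduct, hV.sq]
    · simp [append_dotProduct, hW.sq]
  · rintro (i | j) (i' | j') hne
    · simpa [append_dotProduct] using hV.dot i i' fun h => hne (h ▸ rfl)
    · simp [append_dotProduct]
    · simp [append_dotProduct]
    · simpa [append_dotProduct] using hW.dot j j' fun h => hne (h ▸ rfl)

theorem realizes_zero (n : ℕ) : Realizes n 0 :=
  ⟨Empty, inferInstance, fun i => i.elim, ⟨fun i => i.elim, fun i => i.elim, fun i => i.elim⟩,
    by simp⟩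

/-- The vector of `ℤ⁴` with a zero at `m` and entries `s, t, s * t` at the other points. -/
def blockVec (m : Fin 4) (s t : ℤˣ) (i : Fin 4) : ℤ :=
  if i = m + 1 then s else if i = m + 2 then t else if i = m + 3 then s * t else 0

/-- The sixteen vectors `blockVec`, four for each support. -/
theorem realizes_four : Realizes 4 16 := by
  refine ⟨Fin 4 × ℤˣ × ℤˣ, inferInstance, fun i => blockVec i.1 i.2.1 i.2.2, ⟨?_, ?_, ?_⟩, ?_⟩
  · decide +kernel
  · decide +kernel
  · decide +kernel
  · rfl

theorem realizes_three : Realizes 3 4 := by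
  refine ⟨ℤˣ × ℤˣ, inferInstance, fun i => ![i.1, i.2, i.1 * i.2], ⟨?_, ?_, ?_⟩, ?_⟩
  · decide +kernel
  · decide +kernel
  · decide +kernel
  · rfl

theorem realizes_four_mul (k : ℕ) : Realizes (4 * k) (16 * k) := by
  induction k with
  | zero => exact realizes_zero 0
  | succ k ih => exact ih.add realizes_four

/-- Disjoint blocks of sixteen vectors on four coordinates, and four vectors on the last three
coordinates if `n % 4 = 3`. -/
theorem realizes_blocks (n : ℕ) : ∃ c : ℕ, (c : ℤ) = 4 * n - 4 * constC n ∧ Realizes n c := by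
  have hc := constC_cases n
  by_cases h3 : n % 4 = 3
  · refine ⟨16 * (n / 4) + 4, by omega, ?_⟩
    have := (realizes_four_mul (n / 4)).add realizes_three
    rwa [show 4 * (n / 4) + 3 = n by omega] at this
  · refine ⟨16 * (n / 4) + 0, by omega, ?_⟩
    have := (realizes_four_mul (n / 4)).add (realizes_zero (n % 4))
    rwa [Nat.div_add_mod] at this

/-- The first coordinate of the hub assigned to a sign: the hubs are `{0, 1, 2}` and `{3, 4, 5}`. -/
def hubStart (s : ℤˣ) : ℕ := if s = 1 then 0 else 3

/-- The vector of `ℤ⁶` with entries `1, -1` at two cyclically consecutive points of a hub. -/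
def hubEdge (s : ℤˣ) (r : Fin 3) (i : Fin 6) : ℤ :=
  if i.val = hubStart s + r.val then 1 else if i.val = hubStart s + (r + 1).val then -1 else 0

/-- The vector of `ℤ⁶` with entries `x, y, x * y` at the points of a hub. -/
def hubCore (s x y : ℤˣ) (i : Fin 6) : ℤ :=
  if i.val = hubStart s then x else if i.val = hubStart s + 1 then y else
    if i.val = hubStart s + 2 then x * y else 0

theorem hubEdge_entry : ∀ s r i, hubEdge s r i = -1 ∨ hubEdge s r i = 0 ∨ hubEdge s r i = 1 := by
  decide +kernel

theorem hubEdge_dot_self : ∀ s r, hubEdge s r ⬝ᵥ hubEdge s r = 2 := by decide +kernel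

theorem hubEdge_dot : ∀ s s' r r', (s, r) ≠ (s', r') →
    hubEdge s r ⬝ᵥ hubEdge s' r' = if s = s' then -1 else 0 := by
  decide +kernel

theorem hubCore_dot_hubEdge : ∀ s x y s' r, hubCore s x y ⬝ᵥ hubEdge s' r ≠ 1 ∧
    hubCore s x y ⬝ᵥ hubEdge s' r ≠ 3 := by
  decide +kernel

/-- The system of vectors on two hubs, one for each sign of the remaining coordinates. -/
def hubSystem (m : ℕ) : (ℤˣ × ℤˣ × ℤˣ) ⊕ (ℤˣ × Fin 3 × Fin m) → Fin (6 + m) → ℤ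
  | .inl i => Fin.append (hubCore i.1 i.2.1 i.2.2) 0
  | .inr i => Fin.append (hubEdge i.1 i.2.1) (Pi.single i.2.2 (i.1 : ℤ))

/-- Two disjoint hubs, each carrying four vectors, and three vectors through each hub and each
signed leaf, where the two hubs use opposite signs. -/
theorem realizes_hubs (m : ℕ) : Realizes (6 + m) (8 + 6 * m) := by
  refine ⟨_, inferInstance, hubSystem m, ⟨?_, ?_, ?_⟩, ?_⟩
  · rintro (i | ⟨s, r, j⟩) x
    · refine append_entry ?_ (fun _ => by simp) x
      revert i
      decide +kernel
    · refine append_entry (hubEdge_entry s r) (fun y => ?_) x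
      by_cases hy : y = j
      · subst hy
        rcases Int.units_eq_one_or s with rfl | rfl <;> simp
      · simp [Pi.single_eq_of_ne hy]
  · rintro (i | ⟨s, r, j⟩)
    · simp only [hubSystem, append_dotProduct, dotProduct_zero, add_zero]
      revert i
      decide +kernel
    · simp only [hubSystem, append_dotProduct, hubEdge_dot_self, single_dotProduct]
      rcases Int.units_eq_one_or s with rfl | rfl <;> simp
  · rintro (i | ⟨s, r, j⟩) (i' | ⟨s', r', j'⟩) hne
    · simp only [hubSystem, append_dotProduct, dotProduct_zero, add_zero]
      replace hne : i ≠ i' := fun h => hne (h ▸ rfl)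
      revert i i'
      decide +kernel
    · simp only [hubSystem, append_dotProduct, zero_dotProduct, add_zero]
      exact hubCore_dot_hubEdge _ _ _ _ _
    · simp only [hubSystem, append_dotProduct, dotProduct_zero, add_zero]
      rw [dotProduct_comm]
      exact hubCore_dot_hubEdge _ _ _ _ _
    · simp only [hubSystem, append_dotProduct, single_dotProduct]
      by_cases hsr : (s, r) = (s', r')
      · obtain ⟨rfl, rfl⟩ := Prod.mk.inj hsr
        have hj : j ≠ j' := fun h => hne (h ▸ rfl)
        rw [hubEdge_dot_self, Pi.single_eq_of_ne hj]
        simp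
      · rw [hubEdge_dot _ _ _ _ hsr]
        by_cases hj : j = j'
        · subst hj
          rcases Int.units_eq_one_or s with rfl | rfl <;>
          rcases Int.units_eq_one_or s' with rfl | rfl <;> simp
        · rw [Pi.single_eq_of_ne hj]
          split_ifs <;> simp
  · simp only [Fintype.card_sum, Fintype.card_prod, Fintype.card_fin, Fintype.card_units_int]
    ring

/-- The lower bound for the independence number. -/
theorem le_indepNum (n : ℕ) :
    max (6 * (n : ℤ) - 28) (4 * (n : ℤ) - 4 * constC n) ≤ (distGraph n).indepNum := by
  obtain ⟨c, hc, hr⟩ := realizes_blocks n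
  have h1 := hr.le_indepNum
  refine max_le ?_ (by omega)
  by_cases hn : 6 ≤ n
  · have h2 := (realizes_hubs (n - 6)).le_indepNum
    rw [Nat.add_sub_cancel' hn] at h2
    omega
  · have := constC_cases n
    omega

end TernaryTriples

theorem theorem1 (n : ℕ) (hn : 1 ≤ n) :
    ((distGraph n).indepNum : ℤ) = max (6 * (n : ℤ) - 28) (4 * (n : ℤ) - 4 * constC n) :=
  le_antisymm (TernaryTriples.indepNum_le n) (TernaryTriples.le_indepNum n)
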